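/- Let $\Gamma=PSL_2(\mathbb Z)$, let $\Gamma_\infty$ be the stabilizer of $\infty$, and let $E(z,s)=\sum_{\gamma\in\Gamma_\infty\backslash\Gamma}\operatorname{Im}(\gamma z)^s$ for $\operatorname{Re}(s)>1$, continued meromorphically in $s$. Let $L(s,E_T)=\sum_{n\ge1}\tau_{iT}(n)n^{-s}$ for $\operatorname{Re}(s)>1$, continued meromorphically, where $\tau_{iT}(n)=\sum_{ab=n}(a/b)^{iT}$ (so that $L(s,E_T)=\zeta(s+iT)\zeta(s-iT)$). For $y>0$ let $V_T(y)=\sqrt y\,K_{iT}(y)$, where $K_\nu(y)=\int_0^\infty e^{-y\cosh u}\cosh(\nu u)\,du$ is the modified Bessel function, and let $\gamma_{V_T}(1/2+s)=\int_0^\infty V_T(2\pi y)y^s\frac{dy}{y}$ for $\operatorname{Re}(s)>-1/2$. Put $$\theta(s)=\pi^{-s}\Gamma(s)\zeta(2s),\qquad \mu=\frac{\theta(1/2+iT)}{|\theta(1/2+iT)|},\qquad \rho^*(1)=\Big(\frac2\pi\Big)^{1/2}|\theta(1/2+iT)|^{-1}.$$ Let $\psi$ be a fixed smooth (complex-valued)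 function with compact support in $(0,\infty)$, with Mellin transform $\widetilde\psi(s)=\int_0^\infty\psi(y)y^s\frac{dy}{y}$, and let $$I(T;\psi)=\int_0^\infty\psi(y)\,|E(iy,1/2+iT)|^2\,\frac{dy}{y},\qquad b(T)=2\int_0^\infty\psi(y)\,(y+y^{-1}+\mu^2+\overline\mu^2)\,\frac{dy}{y},$$ $$M(v)=\frac{\cosh(\pi T)}{2\pi i}\int_{(0)}L(1/2+s+v,E_T)\,L(1/2-s,E_T)\,\gamma_{V_T}(1/2+s+v)\,\gamma_{V_T}(1/2-s)\,ds\qquad(\operatorname{Re}(v)=0),$$ where $\int_{(c)}$ is the integral along the line $\operatorname{Re}=c$, oriented upwards. Then for every $T>0$ the integrals defining $I(T;\psi)$ and $M(v)$ (for $\operatorname{Re}(v)=0$) and the integral over $v$ below converge absolutely, and for every $\varepsilon>0$, as $T\to\infty$, $$I(T;\psi)=4\,\frac{\rho^*(1)^2}{\cosh(\pi T)}\,\frac1{2\pi i}\int_{(0)}\widetilde\psi(-v)\,M(v)\,dv+b(T)+O_{\psi,\varepsilon}\big(T^{-1/12+\varepsilon}\big).$$ -/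

import Mathlib

open Complex Set Filter Asymptotics MeasureTheory
open scoped MatrixGroups UpperHalfPlane ContDiff

namespace GeodesicEisenstein

/-! ### Meromorphic continuation -/

/-- `F` is the meromorphic continuation to `ℂ` of the function `f`, which is given on the
half-plane `Re s > σ`. The normal form means that `F` takes the correct value at every point where
it is regular (and the value `0` at its poles), so that `F` is unique. -/
def IsMeromorphicContinuation (σ : ℝ) (f F : ℂ → ℂ) : Prop :=
  MeromorphicNFOn F univ ∧ ∀ s : ℂ, σ < s.re → F s = f s

open Classical in
/-- The meromorphic continuation to `ℂ` of a function given on `Re s > σ`. -/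
noncomputable def meromorphicContinuation (σ : ℝ) (f : ℂ → ℂ) : ℂ → ℂ :=
  if h : ∃ F, IsMeromorphicContinuation σ f F then h.choose else 0

/-! ### The Eisenstein series -/

/-- The stabilizer of `∞` in `SL₂(ℤ)`, i.e. the matrices with lower left entry `0`. -/
def stabInfty : Subgroup SL(2, ℤ) where
  carrier := {g | g 1 0 = 0}
  one_mem' := by simp
  mul_mem' := by
    intro a b ha hb
    simp only [mem_ofPred_eq] at ha hb ⊢
    simp [Matrix.mul_apply, Fin.sum_univ_two, ha, hb]
  inv_mem' := by
    intro a ha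
    simp only [mem_ofPred_eq] at ha ⊢
    simp [Matrix.SpecialLinearGroup.coe_inv, Matrix.adjugate_fin_two, ha]

theorem im_smul_of_mem_stabInfty {g : SL(2, ℤ)} (hg : g ∈ stabInfty) (z : ℍ) :
    (g • z).im = z.im := by
  have hg0 : g 1 0 = 0 := hg
  have hdet : g 0 0 * g 1 1 = 1 := by
    have h := g.det_coe
    rw [Matrix.det_fin_two, hg0] at h
    simpa using h
  have hd : (g 1 1 : ℝ) * (g 1 1 : ℝ) = 1 := by
    rcases Int.eq_one_or_neg_one_of_mul_eq_one' hdet with h | h <;> simp [h.2]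
  rw [ModularGroup.im_smul_eq_div_normSq, ModularGroup.denom_apply, hg0]
  simp [Complex.normSq_apply, hd]

/-- `Im (γ z)` as a function of the coset `Γ_∞ γ`. -/
noncomputable def imCoset (z : ℍ) (q : Quotient (QuotientGroup.rightRel stabInfty)) : ℝ :=
  Quotient.lift (fun g : SL(2, ℤ) => (g • z).im)
    (by
      intro a b hab
      have h : b * a⁻¹ ∈ stabInfty := QuotientGroup.rightRel_apply.mp hab
      have h' := im_smul_of_mem_stabInfty h (a • z)
      rw [← mul_smul, inv_mul_cancel_right] at h'
      exact h'.symm) q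

/-- The series `∑_{γ ∈ Γ_∞ \ Γ} Im(γ z)^s`, absolutely convergent for `Re s > 1`. -/
noncomputable def eisensteinSum (z : ℍ) (s : ℂ) : ℂ :=
  ∑' q : Quotient (QuotientGroup.rightRel stabInfty), (imCoset z q : ℂ) ^ s

/-- The Eisenstein series `E(z, s)`, continued meromorphically in `s`. -/
noncomputable def eisensteinE (z : ℍ) : ℂ → ℂ :=
  meromorphicContinuation 1 (eisensteinSum z)

/-! ### The `L`-function and its Gamma factor -/

/-- `τ_{iT}(n) = ∑_{ab = n} (a/b)^{iT}` for `n ≥ 1`. -/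
noncomputable def tau (T : ℝ) (n : ℕ) : ℂ :=
  ∑ p ∈ n.divisorsAntidiagonal, ((p.1 : ℂ) / (p.2 : ℂ)) ^ (I * (T : ℂ))

/-- `L(s, E_T) = ∑_{n ≥ 1} τ_{iT}(n) n^{-s}`, continued meromorphically from `Re s > 1`. -/
noncomputable def LEis (T : ℝ) : ℂ → ℂ :=
  meromorphicContinuation 1 (LSeries (tau T))

/-- The modified Bessel function `K_ν(y) = ∫_0^∞ e^{-y cosh u} cosh(ν u) du`, for `y > 0`. -/
noncomputable def besselK (ν : ℂ) (y : ℝ) : ℂ :=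
  ∫ u in Ioi (0 : ℝ), Complex.exp (-((y * Real.cosh u : ℝ) : ℂ)) * Complex.cosh (ν * (u : ℂ))

/-- `V_T(y) = √y K_{iT}(y)`. -/
noncomputable def VBessel (T y : ℝ) : ℂ :=
  (Real.sqrt y : ℂ) * besselK (I * (T : ℂ)) y

/-- `γ_{V_T}(w)`, normalized by `γ_{V_T}(1/2 + s) = ∫_0^∞ V_T(2πy) y^s dy/y`. -/
noncomputable def gammaV (T : ℝ) (w : ℂ) : ℂ :=
  mellin (fun y : ℝ => VBessel T (2 * Real.pi * y)) (w - 1 / 2)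

/-! ### Normalizing constants -/

/-- `θ(s) = π^{-s} Γ(s) ζ(2s)`. -/
noncomputable def theta (s : ℂ) : ℂ :=
  (Real.pi : ℂ) ^ (-s) * Complex.Gamma s * riemannZeta (2 * s)

/-- `μ = θ(1/2 + iT) / |θ(1/2 + iT)|`. -/
noncomputable def muT (T : ℝ) : ℂ :=
  theta (1 / 2 + I * (T : ℂ)) / (‖theta (1 / 2 + I * (T : ℂ))‖ : ℂ)

/-- `ρ*(1) = (2/π)^{1/2} |θ(1/2 + iT)|^{-1}`. -/
noncomputable def rhoStar (T : ℝ) : ℝ :=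
  Real.sqrt (2 / Real.pi) * ‖theta (1 / 2 + I * (T : ℂ))‖⁻¹

/-! ### The terms of the formula -/

/-- `∫_{(c)} f(s) ds`, along the line `Re s = c` oriented upwards. -/
noncomputable def lineIntegral (c : ℝ) (f : ℂ → ℂ) : ℂ :=
  ∫ t : ℝ, f ((c : ℂ) + (t : ℂ) * I) * I

/-- The integrand `ψ(y) |E(iy, 1/2 + iT)|² / y` of `I(T; ψ)`; here `y > 0`. -/
noncomputable def geodesicIntegrand (ψ : ℝ → ℂ) (T y : ℝ) : ℂ :=
  ψ y * ((‖eisensteinE (UpperHalfPlane.ofComplex ((y : ℂ) * I)) (1 / 2 + I * (T : ℂ))‖ ^ 2 : ℝ) : ℂ)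
    / (y : ℂ)

/-- `I(T; ψ) = ∫_0^∞ ψ(y) |E(iy, 1/2 + iT)|² dy/y`. -/
noncomputable def geodesicIntegral (ψ : ℝ → ℂ) (T : ℝ) : ℂ :=
  ∫ y in Ioi (0 : ℝ), geodesicIntegrand ψ T y

/-- The integrand of `M(v)`. -/
noncomputable def momentIntegrand (T : ℝ) (v s : ℂ) : ℂ :=
  LEis T (1 / 2 + s + v) * LEis T (1 / 2 - s) * gammaV T (1 / 2 + s + v) * gammaV T (1 / 2 - s)

/-- `M(v) = cosh(πT) / (2πi) ∫_{(0)} L(1/2+s+v, E_T) L(1/2-s, E_T) γ(1/2+s+v) γ(1/2-s) ds`. -/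
noncomputable def momentM (T : ℝ) (v : ℂ) : ℂ :=
  (Real.cosh (Real.pi * T) : ℂ) / (2 * (Real.pi : ℂ) * I) * lineIntegral 0 (momentIntegrand T v)

/-- `b(T) = 2 ∫_0^∞ ψ(y) (y + y⁻¹ + μ² + μ̄²) dy/y`. -/
noncomputable def bTerm (ψ : ℝ → ℂ) (T : ℝ) : ℂ :=
  2 * ∫ y in Ioi (0 : ℝ),
    ψ y * ((y : ℂ) + (y : ℂ)⁻¹ + muT T ^ 2 + (starRingEnd ℂ) (muT T) ^ 2) / (y : ℂ)

end GeodesicEisenstein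

/-! ### Uniqueness of meromorphic continuation -/

namespace GeodesicEisenstein

/-! On the geodesic the quadratic form `y c² + y⁻¹ d²` is diagonal, so the completed series `θ(s)
E(iy, s)` is half the Mellin transform of a product `ϑ(yt) ϑ(t/y)` of two Jacobi theta functions
(`theta_mul_eisensteinE`). Removing from each factor its asymptotics at both ends leaves a part
`geoP`, plus explicit powers of `y` (`eisPair_Λ_half`). By Mellin inversion, `geoP` is the Fourier
transform in `log y` of `Ξ(T+t) Ξ(T-t)`, where `Ξ(u)` is the completed zeta function at `1/2 + iu`
(`geoP_eq`). Up to a constant this kernel is also `L(1/2+it, E_T) γ(1/2+it)` (`LEis_mul_gammaV`).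
After multiplication by the unimodular `μ` everything becomes real: `μE = P/|θ| + D`, with `P` the
Fourier integral and `D` the powers of `y`. Hence `|E|² = (P/|θ| + D)²` (`norm_sq_eisensteinE`), and
expanding the square gives an exact formula (`geodesicIntegral_sub_eq`). The square of `P` is a
Fourier integral of an autocorrelation, which is `M(v)` up to a factor, so `P²` gives precisely the
main term. The stationary terms of `D²` give `b(T)`; the others carry `y^{±2iT}` and meet the rapid
decay of the Mellin transform of `ψ`. Only the cross term `2PD/|θ|` limits the error. Stirling's
`u^{-1/4}` and the Weyl bound `u^{1/6+ε}` give `Ξ(u) ≪ |u|^{-1/12+ε} e^{-π|u|/4}` for large `|u|`,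
so the kernel is `≪ T^{-1/12+ε} e^{-πT/2}` uniformly in `t` (`exists_norm_critKer_le`), while `1/|θ|
≪ T^ε e^{πT/2}` (`exists_inv_norm_theta_le`) because `1/ζ(1+it) ≪ t^ε`. The exponentials cancel and
`T^{-1/12+ε}` remains. The analytic inputs are proved here: the Weyl bound by van der Corput's
method (`norm_sum_zetaPhase_le`, `exists_norm_riemannZeta_half_le`), the bound for `1/ζ` by the
3-4-1 inequality, and the Gamma bound by the three lines theorem. -/

open Topology in
theorem MeromorphicNFOn.eq_of_eventuallyEq {F G : ℂ → ℂ} (hF : MeromorphicNFOn F univ)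
    (hG : MeromorphicNFOn G univ) {z₀ : ℂ} (h : F =ᶠ[𝓝 z₀] G) : F = G := by
  have hm : MeromorphicOn (F - G) univ := fun z hz => (hF hz).meromorphicAt.sub (hG hz).meromorphicAt
  have htop : meromorphicOrderAt (F - G) z₀ = ⊤ := by
    rw [meromorphicOrderAt_eq_top_iff]
    filter_upwards [h.filter_mono nhdsWithin_le_nhds] with z hz
    simp [hz]
  funext z
  have hz : meromorphicOrderAt (F - G) z = ⊤ := by
    by_contra hne
    exact MeromorphicOn.meromorphicOrderAt_ne_top_of_isPreconnected hm isPreconnected_univ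
      (mem_univ z) (mem_univ z₀) hne htop
  rw [meromorphicOrderAt_eq_top_iff] at hz
  have hev : F =ᶠ[𝓝[≠] z] G := by
    filter_upwards [hz] with w hw
    exact sub_eq_zero.mp hw
  -- Normal form is what upgrades agreement near `z` to agreement at `z`.
  exact ((MeromorphicNFAt.eventuallyEq_nhdsNE_iff_eventuallyEq_nhds (hF (mem_univ z))
    (hG (mem_univ z))).mp hev).eq_of_nhds

/-- The meromorphic continuation takes the expected value wherever a global meromorphic
extension is analytic. -/
theorem meromorphicContinuation_eq {σ : ℝ} {f G : ℂ → ℂ} (hG : MeromorphicOn G univ)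
    (hGan : ∀ s : ℂ, σ < s.re → AnalyticAt ℂ G s) (hGf : ∀ s : ℂ, σ < s.re → G s = f s)
    {s₀ : ℂ} (hs₀ : AnalyticAt ℂ G s₀) : meromorphicContinuation σ f s₀ = G s₀ := by
  have hval : ∀ s, AnalyticAt ℂ G s → toMeromorphicNFOn G univ s = G s := fun s hs => by
    rw [toMeromorphicNFOn_eq_toMeromorphicNFAt hG (mem_univ s),
      toMeromorphicNFAt_eq_self.2 hs.meromorphicNFAt]
  have hcont : IsMeromorphicContinuation σ f (toMeromorphicNFOn G univ) :=
    ⟨meromorphicNFOn_toMeromorphicNFOn G univ, fun s hs => by rw [hval s (hGan s hs), hGf s hs]⟩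
  have hex : ∃ F, IsMeromorphicContinuation σ f F := ⟨_, hcont⟩
  rw [meromorphicContinuation, dif_pos hex, ← hval s₀ hs₀]
  have hch := hex.choose_spec
  -- Any point of the half-plane would do; there both continuations equal `f`.
  refine congrFun (MeromorphicNFOn.eq_of_eventuallyEq hch.1 hcont.1 (z₀ := ((σ + 1 : ℝ) : ℂ)) ?_) s₀
  have hopen : IsOpen {s : ℂ | σ < s.re} := isOpen_lt continuous_const Complex.continuous_re
  filter_upwards [hopen.mem_nhds (show σ < (((σ + 1 : ℝ) : ℂ)).re by simp)] with s hs
  rw [hch.2 s hs, hcont.2 s hs]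

end GeodesicEisenstein

/-! ### Exponential sums -/

namespace GeodesicEisenstein

/-- The additive character `x ↦ exp(2πix)`. -/
noncomputable def addChar (x : ℝ) : ℂ := Complex.exp ((2 * Real.pi * x : ℝ) * I)

theorem norm_addChar (x : ℝ) : ‖addChar x‖ = 1 := Complex.norm_exp_ofReal_mul_I _

theorem addChar_add (x y : ℝ) : addChar (x + y) = addChar x * addChar y := by
  rw [addChar, addChar, addChar, ← Complex.exp_add]
  congr 1
  push_cast
  ring

theorem addChar_intCast (k : ℤ) : addChar k = 1 := by
  rw [addChar, Complex.exp_eq_one_iff]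
  exact ⟨k, by push_cast; ring⟩

theorem conj_addChar (x : ℝ) : (starRingEnd ℂ) (addChar x) = addChar (-x) := by
  rw [addChar, addChar, ← Complex.exp_conj, map_mul, Complex.conj_ofReal, Complex.conj_I]
  simp

/-- The function `1 / (1 - exp(2πix))`, in terms of the cotangent. -/
noncomputable def cotKernel (x : ℝ) : ℂ :=
  1 / 2 + ((Real.cos (Real.pi * x) / (2 * Real.sin (Real.pi * x)) : ℝ) : ℂ) * I

theorem one_sub_addChar_mul_cotKernel {x : ℝ} (hx : Real.sin (Real.pi * x) ≠ 0) :
    (1 - addChar x) * cotKernel x = 1 := by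
  have h : addChar x = ((Real.cos (Real.pi * x) : ℂ) + (Real.sin (Real.pi * x) : ℂ) * I) ^ 2 := by
    rw [Complex.ofReal_cos, Complex.ofReal_sin, ← Complex.exp_mul_I, ← Complex.exp_nat_mul, addChar]
    congr 1
    push_cast
    ring
  have hs : (Real.sin (Real.pi * x) : ℂ) ≠ 0 := by exact_mod_cast hx
  have h1 : (Real.cos (Real.pi * x) : ℂ) ^ 2 + (Real.sin (Real.pi * x) : ℂ) ^ 2 = 1 := by
    exact_mod_cast Real.cos_sq_add_sin_sq _
  rw [h, cotKernel]
  push_cast at *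
  generalize Complex.cos (Real.pi * x) = c at *
  generalize Complex.sin (Real.pi * x) = s at *
  field_simp
  have hI := Complex.I_sq
  linear_combination (-(s + c * I) + 2 * s) * h1  + (-2 * c ^ 2 * s - s ^ 3 - c * s ^ 2 * I) * hI

/-- The real part of the kernel is constantly `1/2`, so differences are purely imaginary, and the
sine quotient displays their sign. This makes the variation telescope in the Kuzmin–Landau
inequality. -/
theorem cotKernel_sub {x y : ℝ} (hx : Real.sin (Real.pi * x) ≠ 0)
    (hy : Real.sin (Real.pi * y) ≠ 0) :
    cotKernel x - cotKernel y = ((Real.sin (Real.pi * (y - x)) /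
      (2 * Real.sin (Real.pi * x) * Real.sin (Real.pi * y)) : ℝ) : ℂ) * I := by
  have h : Real.sin (Real.pi * (y - x)) / (2 * Real.sin (Real.pi * x) * Real.sin (Real.pi * y)) =
      Real.cos (Real.pi * x) / (2 * Real.sin (Real.pi * x)) -
      Real.cos (Real.pi * y) / (2 * Real.sin (Real.pi * y)) := by
    rw [mul_sub, Real.sin_sub]
    field_simp
  rw [h, cotKernel, cotKernel]
  push_cast
  ring

/-- Jordan's inequality on the left half of the interval, and the reflection `x ↦ 1 - x` for the
right half. -/
theorem two_mul_le_sin_pi_mul {δ x : ℝ} (hδ : 0 < δ) (h1 : δ ≤ x) (h2 : x ≤ 1 - δ) :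
    2 * δ ≤ Real.sin (Real.pi * x) := by
  have key : ∀ y, δ ≤ y → y ≤ 1 / 2 → 2 * δ ≤ Real.sin (Real.pi * y) := fun y hy1 hy2 => by
    have := Real.mul_le_sin (x := Real.pi * y)
      (mul_nonneg Real.pi_pos.le (by linarith)) (by nlinarith [Real.pi_pos])
    have h : 2 / Real.pi * (Real.pi * y) = 2 * y := by field_simp
    linarith
  rcases le_total x (1 / 2) with h | h
  · exact key x h1 h
  · have := key (1 - x) (by linarith) (by linarith)
    rwa [mul_sub, mul_one, Real.sin_pi_sub] at this

theorem norm_cotKernel_le {δ x : ℝ} (hδ : 0 < δ) (h1 : δ ≤ x) (h2 : x ≤ 1 - δ) :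
    ‖cotKernel x‖ ≤ 1 / (2 * δ) := by
  have hs := two_mul_le_sin_pi_mul hδ h1 h2
  have hs0 : 0 < Real.sin (Real.pi * x) := by linarith
  have hc : |Real.cos (Real.pi * x) / (2 * Real.sin (Real.pi * x))| ≤ 1 / (4 * δ) := by
    rw [abs_div, abs_of_pos (by positivity : 0 < 2 * Real.sin (Real.pi * x))]
    exact div_le_div₀ zero_le_one (Real.abs_cos_le_one _) (by positivity) (by linarith)
  have h3 : (1 : ℝ) / 2 ≤ 1 / (4 * δ) := by
    rw [div_le_div_iff₀ (by norm_num) (by positivity)]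
    linarith
  calc ‖cotKernel x‖ ≤ ‖(1 / 2 : ℂ)‖ + ‖((Real.cos (Real.pi * x) /
        (2 * Real.sin (Real.pi * x)) : ℝ) : ℂ) * I‖ := norm_add_le _ _
    _ ≤ 1 / (4 * δ) + 1 / (4 * δ) := by
        rw [norm_mul, Complex.norm_I, mul_one, Complex.norm_real, Real.norm_eq_abs]
        refine add_le_add ?_ hc
        simpa using h3
    _ = 1 / (2 * δ) := by field_simp; norm_num

/-- The Kuzmin–Landau inequality. -/
theorem norm_sum_range_addChar_le {f : ℕ → ℝ} {δ : ℝ} (hδ : 0 < δ) {N : ℕ}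
    (h1 : ∀ n < N, δ ≤ f (n + 1) - f n) (h2 : ∀ n < N, f (n + 1) - f n ≤ 1 - δ)
    (hmono : ∀ n, n + 1 < N → f (n + 1) - f n ≤ f (n + 2) - f (n + 1)) :
    ‖∑ n ∈ Finset.range N, addChar (f n)‖ ≤ 2 / δ := by
  rcases Nat.eq_zero_or_pos N with rfl | hN
  · simp only [Finset.range_zero, Finset.sum_empty, norm_zero]
    positivity
  obtain ⟨M, rfl⟩ : ∃ M, N = M + 1 := ⟨N - 1, by omega⟩
  set g : ℕ → ℝ := fun n => f (n + 1) - f n with hg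
  have hsin : ∀ n < M + 1, 0 < Real.sin (Real.pi * g n) := fun n hn => by
    have := two_mul_le_sin_pi_mul hδ (h1 n hn) (h2 n hn)
    linarith
  have hstep : ∀ n < M + 1, addChar (f n) + addChar (f (n + 1)) * cotKernel (g n) =
      addChar (f n) * cotKernel (g n) := fun n hn => by
    have h := one_sub_addChar_mul_cotKernel (hsin n hn).ne'
    have h' : f (n + 1) = f n + g n := by simp [hg]
    rw [h', addChar_add]
    linear_combination (-addChar (f n)) * h
  have hcotim : ∀ n < M + 1, |(cotKernel (g n)).im| ≤ 1 / (2 * δ) := fun n hn =>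
    (Complex.abs_im_le_norm _).trans (norm_cotKernel_le hδ (h1 n hn) (h2 n hn))
  -- Summation by parts. With the boundary term included, each step changes the partial sum by a
  -- unimodular number times `cotKernel (g m) - cotKernel (g (m + 1))`, whose norm is the drop of
  -- the imaginary part because `g` is increasing. The drops telescope.
  have hind : ∀ m, m < M + 1 →
      ‖(∑ n ∈ Finset.range (m + 1), addChar (f n)) + addChar (f (m + 1)) * cotKernel (g m)‖ ≤
        1 / (2 * δ) + ((cotKernel (g 0)).im - (cotKernel (g m)).im) := by
    intro m
    induction m with
    | zero =>
      intro hm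
      rw [Finset.sum_range_one, hstep 0 hm, norm_mul, norm_addChar, one_mul, sub_self, add_zero]
      exact norm_cotKernel_le hδ (h1 0 hm) (h2 0 hm)
    | succ m ih =>
      intro hm
      have ih' := ih (by omega)
      have hdiff := cotKernel_sub (hsin m (by omega)).ne' (hsin (m + 1) hm).ne'
      set r : ℝ := Real.sin (Real.pi * (g (m + 1) - g m)) /
        (2 * Real.sin (Real.pi * g m) * Real.sin (Real.pi * g (m + 1))) with hr
      have hr0 : 0 ≤ r := by
        have ha := hsin m (by omega)
        have hb := hsin (m + 1) hm
        have hc : 0 ≤ Real.sin (Real.pi * (g (m + 1) - g m)) := by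
          have hmm := hmono m hm
          have e1 := h2 (m + 1) hm
          have e2 := h1 m (by omega)
          apply Real.sin_nonneg_of_nonneg_of_le_pi
          · have : 0 ≤ g (m + 1) - g m := by simp only [hg]; linarith
            positivity
          · have : g (m + 1) - g m ≤ 1 := by
              simp only [hg]
              linarith
            nlinarith [Real.pi_pos]
        positivity
      have him : (cotKernel (g m)).im - (cotKernel (g (m + 1))).im = r := by
        rw [← Complex.sub_im, hdiff]
        simp
      have heq : (∑ n ∈ Finset.range (m + 1 + 1), addChar (f n)) +
          addChar (f (m + 1 + 1)) * cotKernel (g (m + 1)) =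
          ((∑ n ∈ Finset.range (m + 1), addChar (f n)) + addChar (f (m + 1)) * cotKernel (g m)) -
          addChar (f (m + 1)) * (cotKernel (g m) - cotKernel (g (m + 1))) := by
        rw [Finset.sum_range_succ]
        linear_combination hstep (m + 1) hm
      rw [heq]
      refine (norm_sub_le _ _).trans ?_
      rw [norm_mul, norm_addChar, hdiff, norm_mul, Complex.norm_I, Complex.norm_real,
        Real.norm_of_nonneg hr0]
      linarith
  have hfin := hind M (by omega)
  have hM : ‖addChar (f (M + 1)) * cotKernel (g M)‖ ≤ 1 / (2 * δ) := by
    rw [norm_mul, norm_addChar, one_mul]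
    exact norm_cotKernel_le hδ (h1 M (by omega)) (h2 M (by omega))
  have ha := abs_le.mp (hcotim 0 (by omega))
  have hb := abs_le.mp (hcotim M (by omega))
  -- Four quantities of size `1/(2δ)`: the initial term, the two imaginary parts and the final
  -- boundary term.
  have h4 : 2 / δ = 4 * (1 / (2 * δ)) := by field_simp; norm_num
  have h5 := norm_sub_le ((∑ n ∈ Finset.range (M + 1), addChar (f n)) +
    addChar (f (M + 1)) * cotKernel (g M)) (addChar (f (M + 1)) * cotKernel (g M))
  rw [add_sub_cancel_right] at h5
  have h6 : 0 < 1 / (2 * δ) := by positivity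
  linarith [ha.1, ha.2, hb.1, hb.2]

/-- Subtracting the integer-valued phase `k * i` does not change the character, and moves the
increments to `[δ, 1 - δ]`. -/
theorem norm_sum_Ico_addChar_le {f : ℕ → ℝ} {δ : ℝ} (hδ : 0 < δ) (k : ℤ) {a b : ℕ}
    (h1 : ∀ n ∈ Finset.Ico a b, k + δ ≤ f (n + 1) - f n)
    (h2 : ∀ n ∈ Finset.Ico a b, f (n + 1) - f n ≤ k + 1 - δ)
    (hmono : ∀ n, a ≤ n → n + 1 < b → f (n + 1) - f n ≤ f (n + 2) - f (n + 1)) :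
    ‖∑ n ∈ Finset.Ico a b, addChar (f n)‖ ≤ 2 / δ := by
  rw [Finset.sum_Ico_eq_sum_range]
  have hper : ∀ i ∈ Finset.range (b - a), addChar (f (a + i)) = addChar (f (a + i) - k * i) := by
    intro i _
    have h : f (a + i) = (f (a + i) - k * i) + ((k * i : ℤ) : ℝ) := by push_cast; ring
    conv_lhs => rw [h, addChar_add, addChar_intCast, mul_one]
  rw [Finset.sum_congr rfl hper]
  refine norm_sum_range_addChar_le (f := fun i => f (a + i) - k * i) hδ ?_ ?_ ?_
  · intro n hn
    have := h1 (a + n) (Finset.mem_Ico.mpr ⟨by omega, by omega⟩)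
    push_cast
    rw [← add_assoc]
    linarith
  · intro n hn
    have := h2 (a + n) (Finset.mem_Ico.mpr ⟨by omega, by omega⟩)
    push_cast
    rw [← add_assoc]
    linarith
  · intro n hn
    have := hmono (a + n) (by omega) (by omega)
    push_cast
    rw [← add_assoc, ← add_assoc]
    linarith

/-- A monotone sequence crosses each level once. The crossing indices turn conditions on the
increments of a phase into intervals of summation. -/
theorem exists_threshold {g : ℕ → ℝ} {N : ℕ} (hg : ∀ i j, i ≤ j → j < N → g i ≤ g j) (c : ℝ) :
    ∃ m ≤ N, ∀ n < N, g n < c ↔ n < m := by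
  induction N with
  | zero => exact ⟨0, le_rfl, fun n hn => by omega⟩
  | succ N ih =>
    obtain ⟨m, hmN, hm⟩ := ih fun i j hij hj => hg i j hij (by omega)
    by_cases h : g N < c
    · refine ⟨N + 1, le_rfl, fun n hn => ⟨fun _ => hn, fun _ => ?_⟩⟩
      exact (hg n N (by omega) (by omega)).trans_lt h
    · refine ⟨m, by omega, fun n hn => ?_⟩
      rcases Nat.lt_succ_iff_lt_or_eq.mp hn with h' | rfl
      · exact hm n h'
      · exact ⟨fun h' => absurd h' h, fun h' => by omega⟩

/-- The second derivative test of van der Corput, in terms of second differences. -/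
theorem norm_sum_addChar_le_of_second_difference {f : ℕ → ℝ} {N : ℕ} {l L : ℝ} (hl : 0 < l)
    (hl1 : l ≤ 1) (hL : 0 ≤ L) (h1 : ∀ n, n + 1 < N → l ≤ f (n + 2) - f (n + 1) - (f (n + 1) - f n))
    (h2 : ∀ n, n + 1 < N → f (n + 2) - f (n + 1) - (f (n + 1) - f n) ≤ L) :
    ‖∑ n ∈ Finset.range N, addChar (f n)‖ ≤ (L * N + 2) * (8 / Real.sqrt l) := by
  rcases Nat.eq_zero_or_pos N with rfl | hN
  · simp only [Finset.range_zero, Finset.sum_empty, norm_zero]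
    positivity
  set g : ℕ → ℝ := fun n => f (n + 1) - f n with hg
  have hlow : ∀ i j, i ≤ j → j < N → l * (j - i) ≤ g j - g i := by
    intro i j hij
    induction j, hij using Nat.le_induction with
    | base => simp
    | succ j hij ih =>
      intro hj
      have := ih (by omega)
      have := h1 j hj
      simp only [hg] at *
      push_cast
      linarith
  have hupp : ∀ i j, i ≤ j → j < N → g j - g i ≤ L * (j - i) := by
    intro i j hij
    induction j, hij using Nat.le_induction with
    | base => simp
    | succ j hij ih =>
      intro hj
      have := ih (by omega)
      have := h2 j hj
      simp only [hg] at *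
      push_cast
      linarith
  have hgm : ∀ i j, i ≤ j → j < N → g i ≤ g j := fun i j hij hj => by
    have := hlow i j hij hj
    have h : (i : ℝ) ≤ j := by exact_mod_cast hij
    nlinarith
  choose m hmN hm using exists_threshold hgm
  have hmm : ∀ c d, c ≤ d → m c ≤ m d := fun c d hcd => by
    by_contra! h
    have hlt : m d < N := h.trans_le (hmN c)
    have := (hm c (m d) hlt).mpr h
    exact absurd ((hm d (m d) hlt).mp (this.trans_le hcd)) (lt_irrefl _)
  set r := Real.sqrt l with hr
  have hr0 : 0 < r := Real.sqrt_pos.mpr hl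
  have hrl : r * r = l := Real.mul_self_sqrt hl.le
  have hr1 : r ≤ 1 := Real.sqrt_le_one.mpr hl1
  have hmem : ∀ c d n, n ∈ Finset.Ico (m c) (m d) → n < N ∧ c ≤ g n ∧ g n < d := by
    intro c d n hn
    rw [Finset.mem_Ico] at hn
    have hnN : n < N := hn.2.trans_le (hmN d)
    refine ⟨hnN, ?_, (hm d n hnN).mpr hn.2⟩
    by_contra! h
    have := (hm c n hnN).mp h
    omega
  -- The increments grow by at least `l = r²` per step, so at most `1 + 1/(2r) ≤ 2/r` of them fall
  -- in a window of width `r/2`; these are counted trivially.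
  have hshort : ∀ c, ‖∑ n ∈ Finset.Ico (m c) (m (c + r / 2)), addChar (f n)‖ ≤ 2 / r := by
    intro c
    refine (norm_sum_le _ _).trans ?_
    simp only [norm_addChar, Finset.sum_const, nsmul_eq_mul, mul_one, Nat.card_Ico]
    rcases Nat.lt_or_ge (m c) (m (c + r / 2)) with h | h
    · have ha := hmem c (c + r / 2) (m c) (Finset.mem_Ico.mpr ⟨le_rfl, h⟩)
      have hb := hmem c (c + r / 2) (m (c + r / 2) - 1) (Finset.mem_Ico.mpr ⟨by omega, by omega⟩)
      have hd := hlow (m c) (m (c + r / 2) - 1) (by omega) hb.1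
      rw [Nat.cast_sub h.le, le_div_iff₀ hr0]
      rw [Nat.cast_sub (by omega)] at hd
      push_cast at hd
      have : r * (r * ((m (c + r / 2) : ℝ) - 1 - m c)) ≤ r * (1 / 2) := by
        rw [← mul_assoc, hrl]
        linarith [ha.2.1, hb.2.2]
      have := le_of_mul_le_mul_left this hr0
      nlinarith
    · rw [Nat.sub_eq_zero_of_le h]
      simp only [Nat.cast_zero]
      positivity
  -- Increments within `r/2` of an integer are treated trivially, the rest by Kuzmin–Landau with `δ
  -- = r/2`: the total is `2/r + 4/r + 2/r`. The width `r/2` balances the two methods.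
  have hblock : ∀ k : ℤ, ‖∑ n ∈ Finset.Ico (m k) (m (k + 1)), addChar (f n)‖ ≤ 8 / r := by
    intro k
    have e1 : m k ≤ m (k + r / 2) := hmm _ _ (by linarith)
    have e2 : m (k + r / 2) ≤ m (k + 1 - r / 2) := hmm _ _ (by linarith)
    have e3 : m (k + 1 - r / 2) ≤ m (k + 1) := hmm _ _ (by linarith)
    rw [← Finset.sum_Ico_consecutive _ e1 (e2.trans e3), ← Finset.sum_Ico_consecutive _ e2 e3]
    have s1 := hshort k
    have s3 := hshort (k + 1 - r / 2)
    rw [sub_add_cancel] at s3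
    have s2 : ‖∑ n ∈ Finset.Ico (m (k + r / 2)) (m (k + 1 - r / 2)), addChar (f n)‖ ≤
        2 / (r / 2) := by
      refine norm_sum_Ico_addChar_le (by positivity) k ?_ ?_ ?_
      · exact fun n hn => (hmem _ _ n hn).2.1
      · exact fun n hn => (hmem _ _ n hn).2.2.le
      · exact fun n _ hn => hgm n (n + 1) (by omega) (hn.trans_le (hmN _))
    have h4 : 8 / r = 2 / r + (2 / (r / 2) + 2 / r) := by field_simp; norm_num
    rw [h4]
    exact (norm_add_le _ _).trans (add_le_add s1 ((norm_add_le _ _).trans (add_le_add s2 s3)))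
  -- The increments vary by at most `L (N - 1)`, hence meet at most `L N + 2` unit intervals.
  set T := Finset.Icc ⌊g 0⌋ ⌊g (N - 1)⌋ with hT
  have hmaps : ∀ n ∈ Finset.range N, ⌊g n⌋ ∈ T := fun n hn => by
    rw [Finset.mem_range] at hn
    exact Finset.mem_Icc.mpr ⟨Int.floor_le_floor (hgm 0 n (by omega) hn),
      Int.floor_le_floor (hgm n (N - 1) (by omega) (by omega))⟩
  rw [← Finset.sum_fiberwise_of_maps_to hmaps]
  have hfib : ∀ k : ℤ, (Finset.range N).filter (fun n => ⌊g n⌋ = k) =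
      Finset.Ico (m k) (m (k + 1)) := by
    intro k
    ext n
    rw [Finset.mem_filter, Finset.mem_range, Int.floor_eq_iff]
    constructor
    · rintro ⟨hn, ha, hb⟩
      rw [Finset.mem_Ico]
      refine ⟨?_, (hm _ n hn).mp hb⟩
      by_contra! h
      have := (hm _ n hn).mpr h
      linarith
    · intro h
      exact ⟨(hmem _ _ n h).1, (hmem _ _ n h).2⟩
  simp_rw [hfib]
  refine (norm_sum_le _ _).trans ((Finset.sum_le_sum fun k _ => hblock k).trans ?_)
  rw [Finset.sum_const, nsmul_eq_mul]
  refine mul_le_mul_of_nonneg_right ?_ (by positivity)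
  have hle : ⌊g 0⌋ ≤ ⌊g (N - 1)⌋ := Int.floor_le_floor (hgm 0 (N - 1) (by omega) (by omega))
  have hcard : (T.card : ℝ) = ⌊g (N - 1)⌋ + 1 - ⌊g 0⌋ := by
    rw [hT, Int.card_Icc]
    have : ((⌊g (N - 1)⌋ + 1 - ⌊g 0⌋).toNat : ℤ) = ⌊g (N - 1)⌋ + 1 - ⌊g 0⌋ :=
      Int.toNat_of_nonneg (by omega)
    exact_mod_cast this
  rw [hcard]
  have h3 := hupp 0 (N - 1) (by omega) (by omega)
  rw [Nat.cast_sub (by omega)] at h3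
  have h4 := Int.floor_le (g (N - 1))
  have h5 := Int.lt_floor_add_one (g 0)
  push_cast at h3
  nlinarith

/-- A window of length `N + H` contains the support of every translate by `h ≤ H`, so all these
translates have the same sum. -/
theorem sum_Ico_shift {F : ℤ → ℂ} {N H h : ℕ} (hF : ∀ j, F j ≠ 0 → 0 ≤ j ∧ j < N) (hh : h ≤ H) :
    ∑ j ∈ Finset.range (N + H), F ((j : ℤ) - h) = ∑ n ∈ Finset.range N, F n := by
  rw [Finset.range_eq_Ico, ← Finset.sum_Ico_consecutive _ (Nat.zero_le h) (by omega : h ≤ N + H),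
    ← Finset.sum_Ico_consecutive _ (by omega : h ≤ h + N) (by omega : h + N ≤ N + H)]
  have z1 : ∑ j ∈ Finset.Ico 0 h, F ((j : ℤ) - h) = 0 := by
    refine Finset.sum_eq_zero fun j hj => ?_
    rw [Finset.mem_Ico] at hj
    by_contra hne
    have := hF _ hne
    omega
  have z2 : ∑ j ∈ Finset.Ico (h + N) (N + H), F ((j : ℤ) - h) = 0 := by
    refine Finset.sum_eq_zero fun j hj => ?_
    rw [Finset.mem_Ico] at hj
    by_contra hne
    have := hF _ hne
    omega
  rw [z1, z2, zero_add, add_zero, Finset.sum_Ico_eq_sum_range, Nat.add_sub_cancel_left,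
    Finset.range_eq_Ico]
  refine Finset.sum_congr rfl fun n _ => ?_
  push_cast
  congr 1
  ring

/-- The van der Corput inequality. -/
theorem norm_sum_sq_le_of_correlations {z : ℕ → ℂ} {N H : ℕ} (hH : 0 < H) (c : ℕ → ℝ)
    (hc : ∀ d < H, ‖∑ n ∈ Finset.range (N - d), z n * (starRingEnd ℂ) (z (n + d))‖ ≤ c d) :
    (H : ℝ) * ‖∑ n ∈ Finset.range N, z n‖ ^ 2 ≤
      (N + H) * (2 * ∑ d ∈ Finset.range H, c d) := by
  set Z : ℤ → ℂ := fun j => if 0 ≤ j ∧ j < N then z j.toNat else 0 with hZ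
  have hZ0 : ∀ j, Z j ≠ 0 → 0 ≤ j ∧ j < N := fun j hj => by
    by_contra h
    exact hj (if_neg h)
  have hZn : ∀ n ∈ Finset.range N, Z n = z n := fun n hn => by
    rw [Finset.mem_range] at hn
    simp [hZ, hn]
  have hc0 : ∀ d < H, 0 ≤ c d := fun d hd => (norm_nonneg _).trans (hc d hd)
  -- Translating by `h + d` turns a product of two shifts into the correlation of lag `d`, supported
  -- on `n < N - d`.
  have hcorr : ∀ h ≤ H, ∀ d < H, h + d ≤ H →
      ‖∑ j ∈ Finset.range (N + H), Z ((j : ℤ) - (h + d : ℕ)) * (starRingEnd ℂ) (Z ((j : ℤ) - h))‖ ≤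
        c d := by
    intro h hh d hd hhd
    have e := sum_Ico_shift (F := fun j => Z j * (starRingEnd ℂ) (Z (j + d))) (N := N) (H := H)
      (h := h + d) (fun j hj => hZ0 j (left_ne_zero_of_mul hj)) hhd
    have e1 : ∀ j ∈ Finset.range (N + H),
        Z ((j : ℤ) - (h + d : ℕ)) * (starRingEnd ℂ) (Z ((j : ℤ) - h)) =
        Z ((j : ℤ) - (h + d : ℕ)) * (starRingEnd ℂ) (Z ((j : ℤ) - (h + d : ℕ) + d)) := by
      intro j _
      congr 3
      push_cast
      ring
    rw [Finset.sum_congr rfl e1, e]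
    have e2 : ∑ n ∈ Finset.range N, Z n * (starRingEnd ℂ) (Z ((n : ℤ) + d)) =
        ∑ n ∈ Finset.range (N - d), z n * (starRingEnd ℂ) (z (n + d)) := by
      symm
      rw [← Finset.sum_subset (Finset.range_mono (Nat.sub_le N d))]
      · refine Finset.sum_congr rfl fun n hn => ?_
        rw [Finset.mem_range] at hn
        rw [hZn n (Finset.mem_range.mpr (by omega)), ← hZn (n + d) (Finset.mem_range.mpr (by omega))]
        push_cast
        rfl
      · intro n hn hn'
        rw [Finset.mem_range] at hn hn'
        have : Z ((n : ℤ) + d) = 0 := if_neg (by omega)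
        rw [this, map_zero, mul_zero]
    rw [e2]
    exact hc d hd
  have hpair : ∀ h < H, ∀ h' < H,
      ‖∑ j ∈ Finset.range (N + H), Z ((j : ℤ) - h) * (starRingEnd ℂ) (Z ((j : ℤ) - h'))‖ ≤
        c (max h h' - min h h') := by
    intro h hh h' hh'
    rcases le_total h' h with hle | hle
    · obtain ⟨d, rfl⟩ := Nat.exists_eq_add_of_le hle
      rw [max_eq_left hle, min_eq_right hle, Nat.add_sub_cancel_left]
      exact hcorr h' (by omega) d (by omega) (by omega)
    · obtain ⟨d, rfl⟩ := Nat.exists_eq_add_of_le hle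
      rw [max_eq_right hle, min_eq_left hle, Nat.add_sub_cancel_left, ← Complex.norm_conj, map_sum]
      simp_rw [map_mul, Complex.conj_conj, mul_comm ((starRingEnd ℂ) (Z _))]
      exact hcorr h (by omega) d (by omega) (by omega)
  -- In each row of the `H × H` array every lag occurs at most twice, once on either side of the
  -- diagonal.
  have hsumpair : ∑ h ∈ Finset.range H, ∑ h' ∈ Finset.range H, c (max h h' - min h h') ≤
      H * (2 * ∑ d ∈ Finset.range H, c d) := by
    have hrow : ∀ h ∈ Finset.range H, ∑ h' ∈ Finset.range H, c (max h h' - min h h') ≤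
        2 * ∑ d ∈ Finset.range H, c d := by
      intro h hh
      rw [Finset.mem_range] at hh
      rw [Finset.range_eq_Ico, ← Finset.sum_Ico_consecutive _ (Nat.zero_le h) hh.le, two_mul]
      refine add_le_add ?_ ?_
      · rw [← Finset.range_eq_Ico, ← Finset.sum_range_reflect]
        calc _ = ∑ j ∈ Finset.range h, c (j + 1) := by
              refine Finset.sum_congr rfl fun j hj => ?_
              rw [Finset.mem_range] at hj
              rw [max_eq_left (by omega), min_eq_right (by omega)]
              congr 1
              omega
          _ = ∑ d ∈ Finset.Ico 1 (h + 1), c d := by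
              rw [Finset.sum_Ico_eq_sum_range]
              exact Finset.sum_congr rfl fun j _ => by rw [add_comm]
          _ ≤ _ := Finset.sum_le_sum_of_subset_of_nonneg
              (Finset.Ico_subset_Ico (by omega) (by omega))
              fun d hd _ => hc0 d (Finset.mem_Ico.mp hd).2
      · rw [Finset.sum_Ico_eq_sum_range, ← Finset.range_eq_Ico]
        calc _ = ∑ j ∈ Finset.range (H - h), c j := by
              refine Finset.sum_congr rfl fun j hj => ?_
              rw [max_eq_right (by omega), min_eq_left (by omega)]
              congr 1
              omega
          _ ≤ _ := Finset.sum_le_sum_of_subset_of_nonneg (Finset.range_mono (by omega))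
              fun d hd _ => hc0 d (Finset.mem_range.mp hd)
    refine (Finset.sum_le_sum hrow).trans ?_
    rw [Finset.sum_const, Finset.card_range, nsmul_eq_mul]
  -- Averaging over `H` shifts: the `w j` sum to `H` times the original sum. Cauchy–Schwarz over the
  -- `N + H` positions, followed by expanding the squares, produces the correlations.
  set w : ℕ → ℂ := fun j => ∑ h ∈ Finset.range H, Z ((j : ℤ) - h) with hw
  have hwsum : ∑ j ∈ Finset.range (N + H), w j = H * ∑ n ∈ Finset.range N, z n := by
    rw [hw, Finset.sum_comm]
    rw [Finset.sum_congr rfl fun h hh => sum_Ico_shift hZ0 (Finset.mem_range.mp hh).le,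
      Finset.sum_const, Finset.card_range, nsmul_eq_mul, Finset.sum_congr rfl hZn]
  have hcs : ‖∑ j ∈ Finset.range (N + H), w j‖ ^ 2 ≤
      (N + H) * ∑ j ∈ Finset.range (N + H), ‖w j‖ ^ 2 := by
    have h1 := norm_sum_le (Finset.range (N + H)) w
    have h2 := sq_sum_le_card_mul_sum_sq (s := Finset.range (N + H)) (f := fun j => ‖w j‖)
    rw [Finset.card_range] at h2
    push_cast at h2
    exact (pow_le_pow_left₀ (norm_nonneg _) h1 2).trans h2
  have hsq : ∑ j ∈ Finset.range (N + H), ‖w j‖ ^ 2 ≤ H * (2 * ∑ d ∈ Finset.range H, c d) := by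
    have e : ((∑ j ∈ Finset.range (N + H), ‖w j‖ ^ 2 : ℝ) : ℂ) =
        ∑ h ∈ Finset.range H, ∑ h' ∈ Finset.range H, ∑ j ∈ Finset.range (N + H),
          Z ((j : ℤ) - h) * (starRingEnd ℂ) (Z ((j : ℤ) - h')) := by
      push_cast
      calc _ = ∑ j ∈ Finset.range (N + H), ∑ h ∈ Finset.range H, ∑ h' ∈ Finset.range H,
            Z ((j : ℤ) - h) * (starRingEnd ℂ) (Z ((j : ℤ) - h')) := by
            refine Finset.sum_congr rfl fun j _ => ?_
            rw [← Complex.mul_conj', hw, map_sum, Finset.sum_mul_sum]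
        _ = _ := by
            rw [Finset.sum_comm]
            exact Finset.sum_congr rfl fun h _ => Finset.sum_comm
    have e2 : ∑ j ∈ Finset.range (N + H), ‖w j‖ ^ 2 =
        ‖((∑ j ∈ Finset.range (N + H), ‖w j‖ ^ 2 : ℝ) : ℂ)‖ := by
      rw [Complex.norm_real, Real.norm_of_nonneg (Finset.sum_nonneg fun _ _ => by positivity)]
    rw [e2, e]
    refine (norm_sum_le _ _).trans (le_trans (Finset.sum_le_sum fun h hh => ?_) hsumpair)
    refine (norm_sum_le _ _).trans (Finset.sum_le_sum fun h' hh' => ?_)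
    exact hpair h (Finset.mem_range.mp hh) h' (Finset.mem_range.mp hh')
  rw [hwsum, norm_mul, Complex.norm_natCast, mul_pow] at hcs
  have hHpos : (0 : ℝ) < H := by exact_mod_cast hH
  have := hcs.trans (mul_le_mul_of_nonneg_left hsq (by positivity))
  refine le_of_mul_le_mul_left ?_ hHpos
  linarith

end GeodesicEisenstein

/-! ### Derivative tests for the phase of `n^{-it}`: second and first order -/

namespace GeodesicEisenstein

/-- The mean value theorem twice: for `y ↦ φ (y + 1) - φ y`, and then for `φ'`. -/
theorem exists_second_difference_eq {φ φ' φ'' : ℝ → ℝ} {x : ℝ}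
    (h1 : ∀ y ∈ Icc x (x + 2), HasDerivAt φ (φ' y) y)
    (h2 : ∀ y ∈ Icc x (x + 2), HasDerivAt φ' (φ'' y) y) :
    ∃ y ∈ Ioo x (x + 2), φ (x + 2) - φ (x + 1) - (φ (x + 1) - φ x) = φ'' y := by
  have hψ : ∀ y ∈ Icc x (x + 1),
      HasDerivAt (fun y => φ (y + 1) - φ y) (φ' (y + 1) - φ' y) y := fun y hy =>
    ((h1 (y + 1) ⟨by linarith [hy.1], by linarith [hy.2]⟩).comp_add_const y 1).sub
      (h1 y ⟨hy.1, by linarith [hy.2]⟩)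
  obtain ⟨ξ, hξ, e1⟩ := exists_hasDerivAt_eq_slope (fun y => φ (y + 1) - φ y) _
    (by linarith : x < x + 1) (fun y hy => (hψ y hy).continuousAt.continuousWithinAt)
    (fun y hy => hψ y ⟨hy.1.le, hy.2.le⟩)
  have hmem : ∀ y ∈ Icc ξ (ξ + 1), y ∈ Icc x (x + 2) := fun y hy =>
    ⟨hξ.1.le.trans hy.1, by linarith [hy.2, hξ.2]⟩
  obtain ⟨η, hη, e2⟩ := exists_hasDerivAt_eq_slope φ' φ''
    (by linarith : ξ < ξ + 1) (fun y hy => (h2 y (hmem y hy)).continuousAt.continuousWithinAt)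
    (fun y hy => h2 y (hmem y ⟨hy.1.le, hy.2.le⟩))
  refine ⟨η, ⟨by linarith [hξ.1, hη.1], by linarith [hξ.2, hη.2]⟩, ?_⟩
  rw [add_sub_cancel_left, div_one] at e1 e2
  rw [e2, e1, show x + 1 + 1 = x + 2 by ring]

/-- The phase of `(M + x)^{-it}`. -/
noncomputable def zetaPhase (t : ℝ) (M : ℕ) (x : ℝ) : ℝ := -(t / (2 * Real.pi)) * Real.log (M + x)

theorem hasDerivAt_zetaPhase (t : ℝ) {M : ℕ} {x : ℝ} (hx : 0 < M + x) :
    HasDerivAt (zetaPhase t M) (-(t / (2 * Real.pi)) * (M + x)⁻¹) x := by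
  have := ((hasDerivAt_id x).const_add (M : ℝ) |>.log hx.ne').const_mul (-(t / (2 * Real.pi)))
  rwa [one_div] at this

theorem hasDerivAt_zetaPhase_deriv (t : ℝ) {M : ℕ} {x : ℝ} (hx : 0 < M + x) :
    HasDerivAt (fun x : ℝ => -(t / (2 * Real.pi)) * ((M : ℝ) + x)⁻¹)
      (t / (2 * Real.pi) / (M + x) ^ 2) x := by
  have := (((hasDerivAt_id x).const_add (M : ℝ)).inv hx.ne').const_mul (-(t / (2 * Real.pi)))
  convert! this using 1
  simp only [id, neg_div]
  ring

/-- The second derivative of the phase is `t / (2π x²)` with `M ≤ x ≤ 3M`, so it lies between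
`t/(64M²)` and `t/M²`. Here `64` is a perfect square above `2π · 9`, which keeps the square root
rational in `M`. -/
theorem norm_sum_zetaPhase_le_of_second {t : ℝ} (ht : 0 < t) {M N : ℕ} (hM : 0 < M) (hN : N ≤ M)
    (htM : t ≤ M ^ 2) :
    ‖∑ n ∈ Finset.range N, addChar (zetaPhase t M n)‖ ≤
      64 * Real.sqrt t + 128 * (M / Real.sqrt t) := by
  have hM' : (1 : ℝ) ≤ M := by exact_mod_cast hM
  have hNM : (N : ℝ) ≤ M := by exact_mod_cast hN
  have hpi := Real.pi_gt_three
  have hpi2 := Real.pi_lt_d2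
  have key : ∀ n : ℕ, n + 1 < N → ∃ x : ℝ, (M : ℝ) ≤ x ∧ x ≤ 3 * M ∧
      zetaPhase t M ((n + 2 : ℕ) : ℝ) - zetaPhase t M ((n + 1 : ℕ) : ℝ) -
        (zetaPhase t M ((n + 1 : ℕ) : ℝ) - zetaPhase t M n) = t / (2 * Real.pi) / x ^ 2 := by
    intro n hn
    have hn' : (n : ℝ) + 2 ≤ N := by exact_mod_cast hn
    have hn0 : (0 : ℝ) ≤ n := Nat.cast_nonneg n
    obtain ⟨y, hy, e⟩ := exists_second_difference_eq (x := (n : ℝ))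
      (fun y hy => hasDerivAt_zetaPhase t (M := M) (by linarith [hy.1] : 0 < M + y))
      (fun y hy => hasDerivAt_zetaPhase_deriv t (M := M) (by linarith [hy.1]))
    refine ⟨M + y, by linarith [hy.1], by linarith [hy.2], ?_⟩
    push_cast
    exact e
  have hl : 0 < t / (64 * M ^ 2) := by positivity
  have hmain := norm_sum_addChar_le_of_second_difference (f := fun n => zetaPhase t M n) (N := N)
    (l := t / (64 * M ^ 2)) (L := t / M ^ 2) hl
    (by rw [div_le_one (by positivity)]; linarith) (by positivity)
    (fun n hn => by
      obtain ⟨x, hx1, hx2, e⟩ := key n hn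
      rw [e, div_div]
      have hx0 : 0 < x := by linarith
      refine div_le_div_of_nonneg_left ht.le (by positivity) ?_
      calc 2 * Real.pi * x ^ 2 ≤ 2 * 3.15 * (3 * (M : ℝ)) ^ 2 := by gcongr
        _ ≤ 64 * (M : ℝ) ^ 2 := by nlinarith)
    (fun n hn => by
      obtain ⟨x, hx1, hx2, e⟩ := key n hn
      rw [e, div_div]
      refine div_le_div_of_nonneg_left ht.le (by positivity) ?_
      calc (M : ℝ) ^ 2 = 1 * M ^ 2 := by ring
        _ ≤ 2 * Real.pi * x ^ 2 := by gcongr; linarith)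
  refine hmain.trans ?_
  have hs : Real.sqrt (t / (64 * M ^ 2)) = Real.sqrt t / (8 * M) := by
    rw [Real.sqrt_div ht.le, show (64 : ℝ) * M ^ 2 = (8 * M) ^ 2 by ring,
      Real.sqrt_sq (by positivity)]
  have hst : 0 < Real.sqrt t := Real.sqrt_pos.mpr ht
  rw [hs]
  have h1 : t / M ^ 2 * N ≤ t / M := by
    calc t / M ^ 2 * N ≤ t / M ^ 2 * M := by gcongr
      _ = t / M := by field_simp
  calc (t / M ^ 2 * N + 2) * (8 / (Real.sqrt t / (8 * M)))
      ≤ (t / M + 2) * (8 / (Real.sqrt t / (8 * M))) := by gcongr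
    _ = 64 * (t / Real.sqrt t) + 128 * (M / Real.sqrt t) := by field_simp; ring
    _ = _ := by rw [Real.div_sqrt]

/-- For `t ≤ M` all increments of the phase are negative and at most `1/6` in size, so they stay
inside one unit interval and Kuzmin–Landau applies with `k = -1`; their size is at least `t/(32M)`.
-/
theorem norm_sum_zetaPhase_le_of_first {t : ℝ} (ht : 0 < t) {M N : ℕ} (hN : N ≤ M)
    (htM : t ≤ M) : ‖∑ n ∈ Finset.range N, addChar (zetaPhase t M n)‖ ≤ 64 * (M / t) := by
  have hM0 : (0 : ℝ) < M := ht.trans_le htM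
  have hM : 1 ≤ M := by exact_mod_cast hM0
  have hM' : (1 : ℝ) ≤ M := by exact_mod_cast hM
  have hpi := Real.pi_gt_three
  have hpi2 := Real.pi_lt_d2
  have hdiff : ∀ n : ℕ, zetaPhase t M ((n + 1 : ℕ) : ℝ) - zetaPhase t M n =
      -(t / (2 * Real.pi) * Real.log (1 + (M + n : ℝ)⁻¹)) := by
    intro n
    have hpos : (0 : ℝ) < M + n := by positivity
    have : (1 + (M + n : ℝ)⁻¹) = (M + (n + 1 : ℕ)) / (M + n) := by
      push_cast
      field_simp
      ring
    rw [this, Real.log_div (by positivity) (by positivity), zetaPhase, zetaPhase]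
    ring
  have hδ : 0 < t / (32 * M) := by positivity
  have := norm_sum_Ico_addChar_le (f := fun n : ℕ => zetaPhase t M n) hδ (-1) (a := 0) (b := N)
    (fun n hn => by
      rw [hdiff]
      have hpos : (0 : ℝ) < M + n := by positivity
      have hlog := Real.log_le_sub_one_of_pos (by positivity : 0 < 1 + (M + n : ℝ)⁻¹)
      have h1 : (M + n : ℝ)⁻¹ ≤ (M : ℝ)⁻¹ := by gcongr; simp
      have h2 : t / (2 * Real.pi) * Real.log (1 + (M + n : ℝ)⁻¹) ≤ t / (2 * Real.pi) * (M : ℝ)⁻¹ := by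
        gcongr
        linarith
      have h3 : t / (2 * Real.pi) * (M : ℝ)⁻¹ ≤ 1 / 6 := by
        rw [← div_eq_mul_inv, div_div, div_le_div_iff₀ (by positivity) (by norm_num)]
        nlinarith
      have h4 : t / (32 * M) ≤ 1 / 32 := by
        rw [div_le_div_iff₀ (by positivity) (by norm_num)]
        linarith
      push_cast
      linarith)
    (fun n hn => by
      rw [hdiff]
      rw [Finset.mem_Ico] at hn
      have hnM : (n : ℝ) + 1 ≤ M := by exact_mod_cast (by omega : n + 1 ≤ M)
      have hpos : (0 : ℝ) < M + n := by positivity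
      have hlog := Real.one_sub_inv_le_log_of_pos (by positivity : 0 < 1 + (M + n : ℝ)⁻¹)
      have h0 : 1 - (1 + (M + n : ℝ)⁻¹)⁻¹ = 1 / (M + n + 1) := by
        field_simp
        ring
      have h1 : 1 / (2 * M : ℝ) ≤ 1 / (M + n + 1) := by
        gcongr
        linarith
      have h2 : t / (2 * Real.pi) * (1 / (2 * M)) ≤
          t / (2 * Real.pi) * Real.log (1 + (M + n : ℝ)⁻¹) := by
        gcongr
        linarith
      have h3 : t / (32 * M) ≤ t / (2 * Real.pi) * (1 / (2 * M)) := by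
        rw [div_mul_div_comm, mul_one]
        refine div_le_div_of_nonneg_left ht.le (by positivity) ?_
        nlinarith
      push_cast
      linarith)
    (fun n _ hn => by
      rw [hdiff n, hdiff (n + 1), neg_le_neg_iff]
      have hpos : (0 : ℝ) < M + n := by positivity
      gcongr
      linarith)
  rw [← Finset.range_eq_Ico] at this
  refine this.trans (le_of_eq ?_)
  field_simp
  norm_num

end GeodesicEisenstein

/-! ### Weyl differencing, the third derivative test and blocks of all lengths -/

namespace GeodesicEisenstein

theorem inv_sq_sub_inv_sq_bounds {M d x : ℝ} (hM : 0 < M) (hd : 0 ≤ d) (hx : M ≤ x)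
    (hxd : x + d ≤ 3 * M) :
    d / (27 * M ^ 3) ≤ 1 / x ^ 2 - 1 / (x + d) ^ 2 ∧ 1 / x ^ 2 - 1 / (x + d) ^ 2 ≤ 2 * d / M ^ 3 := by
  have hx0 : 0 < x := hM.trans_le hx
  have e : 1 / x ^ 2 - 1 / (x + d) ^ 2 = d * (2 * x + d) / (x ^ 2 * (x + d) ^ 2) := by
    field_simp
    ring
  rw [e]
  constructor
  · calc d / (27 * M ^ 3) ≤ d / (x ^ 2 * (x + d)) := by
          refine div_le_div_of_nonneg_left hd (by positivity) ?_
          calc x ^ 2 * (x + d) ≤ (3 * M) ^ 2 * (3 * M) := by gcongr; linarith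
            _ = 27 * M ^ 3 := by ring
      _ = d * (x + d) / (x ^ 2 * (x + d) ^ 2) := by field_simp
      _ ≤ d * (2 * x + d) / (x ^ 2 * (x + d) ^ 2) := by gcongr; linarith
  · calc d * (2 * x + d) / (x ^ 2 * (x + d) ^ 2)
        ≤ d * (2 * (x + d)) / (x ^ 2 * (x + d) ^ 2) := by gcongr; linarith
      _ = 2 * d / (x ^ 2 * (x + d)) := by field_simp
      _ ≤ 2 * d / M ^ 3 := by
          refine div_le_div_of_nonneg_left (by positivity) (by positivity) ?_
          calc M ^ 3 = M ^ 2 * M := by ring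
            _ ≤ x ^ 2 * (x + d) := by gcongr; linarith

/-- The differenced phase has second derivative `t/(2π) (1/x² - 1/(x+d)²)`, of order `t d / M³`, so
the second derivative test applies. Again `256 = 16²` is a convenient square above `2π · 27`. -/
theorem norm_correlation_zetaPhase_le {t : ℝ} (ht : 0 < t) {M N d : ℕ} (hM : 0 < M) (hN : N ≤ M)
    (hd : 0 < d) (htd : t * d ≤ 256 * M ^ 3) :
    ‖∑ n ∈ Finset.range (N - d), addChar (zetaPhase t M n) *
        (starRingEnd ℂ) (addChar (zetaPhase t M (n + d : ℕ)))‖ ≤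
      128 * Real.sqrt (t * d / M) + 256 * (M * Real.sqrt (M / (t * d))) := by
  have hM' : (1 : ℝ) ≤ M := by exact_mod_cast hM
  have hd' : (1 : ℝ) ≤ d := by exact_mod_cast hd
  have hNM : (N : ℝ) ≤ M := by exact_mod_cast hN
  have hpi := Real.pi_gt_three
  have hpi2 := Real.pi_lt_d2
  have key : ∀ n : ℕ, n + 1 < N - d → ∃ x : ℝ, (M : ℝ) ≤ x ∧ x + d ≤ 3 * M ∧
      (zetaPhase t M ((n + 2 : ℕ) : ℝ) - zetaPhase t M ((n + 2 + d : ℕ) : ℝ)) -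
        (zetaPhase t M ((n + 1 : ℕ) : ℝ) - zetaPhase t M ((n + 1 + d : ℕ) : ℝ)) -
        ((zetaPhase t M ((n + 1 : ℕ) : ℝ) - zetaPhase t M ((n + 1 + d : ℕ) : ℝ)) -
        (zetaPhase t M n - zetaPhase t M ((n + d : ℕ) : ℝ))) =
        t / (2 * Real.pi) * (1 / x ^ 2 - 1 / (x + d) ^ 2) := by
    intro n hn
    have hn' : (n : ℝ) + 2 + d ≤ N := by exact_mod_cast (by omega : n + 2 + d ≤ N)
    have hn0 : (0 : ℝ) ≤ n := Nat.cast_nonneg n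
    obtain ⟨y, hy, e⟩ := exists_second_difference_eq (x := (n : ℝ))
      (φ := fun x => zetaPhase t M x - zetaPhase t M (x + d))
      (fun y hy => (hasDerivAt_zetaPhase t (M := M) (by linarith [hy.1] : 0 < M + y)).sub
        ((hasDerivAt_zetaPhase t (M := M) (x := y + d)
          (by linarith [hy.1])).comp_add_const y (d : ℝ)))
      (fun y hy => (hasDerivAt_zetaPhase_deriv t (M := M) (by linarith [hy.1])).sub
        ((hasDerivAt_zetaPhase_deriv t (M := M) (x := y + d)
          (by linarith [hy.1])).comp_add_const y (d : ℝ)))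
    refine ⟨M + y, by linarith [hy.1], by linarith [hy.2], ?_⟩
    push_cast
    rw [e]
    ring
  have e0 : ∀ n ∈ Finset.range (N - d), addChar (zetaPhase t M n) *
      (starRingEnd ℂ) (addChar (zetaPhase t M (n + d : ℕ))) =
      addChar (zetaPhase t M n - zetaPhase t M (n + d : ℕ)) := fun n _ => by
    rw [conj_addChar, ← addChar_add, sub_eq_add_neg]
  rw [Finset.sum_congr rfl e0]
  have hl : 0 < t * d / (256 * M ^ 3) := by positivity
  have hmain := norm_sum_addChar_le_of_second_difference
    (f := fun n => zetaPhase t M n - zetaPhase t M (n + d : ℕ)) (N := N - d)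
    (l := t * d / (256 * M ^ 3)) (L := t * d / M ^ 3) hl
    (by rw [div_le_one (by positivity)]; linarith) (by positivity)
    (fun n hn => by
      obtain ⟨x, hx1, hx2, e⟩ := key n hn
      rw [e]
      have hb := (inv_sq_sub_inv_sq_bounds (by linarith : (0 : ℝ) < M) (by positivity) hx1 hx2).1
      calc t * d / (256 * M ^ 3) ≤ t * d / (2 * Real.pi * (27 * M ^ 3)) := by
            refine div_le_div_of_nonneg_left (by positivity) (by positivity) ?_
            rw [← mul_assoc]
            gcongr
            linarith
        _ = t / (2 * Real.pi) * (d / (27 * M ^ 3)) := by field_simp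
        _ ≤ _ := by gcongr)
    (fun n hn => by
      obtain ⟨x, hx1, hx2, e⟩ := key n hn
      rw [e]
      have hb := (inv_sq_sub_inv_sq_bounds (by linarith : (0 : ℝ) < M) (by positivity) hx1 hx2).2
      calc _ ≤ t / (2 * Real.pi) * (2 * d / M ^ 3) := by gcongr
        _ = (t * d / M ^ 3) / Real.pi := by field_simp
        _ ≤ _ := div_le_self (by positivity) (by linarith))
  refine hmain.trans ?_
  have htd0 : 0 < t * d := by positivity
  have hM0 : (0 : ℝ) < M := by positivity
  have hcast : ((N - d : ℕ) : ℝ) ≤ M := by exact_mod_cast (Nat.sub_le _ _).trans hN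
  set r := Real.sqrt (M / (t * d)) with hr
  have hr0 : 0 < r := Real.sqrt_pos.mpr (by positivity)
  have hs1 : Real.sqrt (t * d / (256 * M ^ 3)) = 1 / (16 * M * r) := by
    have : t * d / (256 * M ^ 3) = (1 / (16 * M * r)) ^ 2 := by
      rw [div_pow, mul_pow, Real.sq_sqrt (by positivity)]
      field_simp
      norm_num
    rw [this, Real.sqrt_sq (by positivity)]
  have hs2 : Real.sqrt (t * d / M) = 1 / r := by
    rw [hr, one_div, ← Real.sqrt_inv, inv_div]
  have hs3 : r * r = M / (t * d) := Real.mul_self_sqrt (by positivity)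
  rw [hs1, hs2]
  have h1 : t * d / M ^ 3 * ((N - d : ℕ) : ℝ) ≤ 1 / (M * (r * r)) := by
    calc _ ≤ t * d / M ^ 3 * M := by gcongr
      _ = _ := by rw [hs3]; field_simp
  calc _ ≤ (1 / (M * (r * r)) + 2) * (8 / (1 / (16 * M * r))) := by gcongr
    _ = _ := by field_simp; ring

theorem sum_range_one_div_sqrt_le (H : ℕ) :
    ∑ d ∈ Finset.range H, 1 / Real.sqrt ((d : ℝ) + 1) ≤ 2 * Real.sqrt H := by
  induction H with
  | zero => simp
  | succ H ih =>
    rw [Finset.sum_range_succ]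
    push_cast
    have ha : 0 ≤ Real.sqrt H := Real.sqrt_nonneg _
    have hb : 0 < Real.sqrt ((H : ℝ) + 1) := Real.sqrt_pos.mpr (by positivity)
    have ha2 : Real.sqrt H * Real.sqrt H = H := Real.mul_self_sqrt (by positivity)
    have hb2 : Real.sqrt ((H : ℝ) + 1) * Real.sqrt ((H : ℝ) + 1) = H + 1 :=
      Real.mul_self_sqrt (by positivity)
    have : 1 / Real.sqrt ((H : ℝ) + 1) ≤ 2 * (Real.sqrt ((H : ℝ) + 1) - Real.sqrt H) := by
      rw [div_le_iff₀ hb]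
      nlinarith [sq_nonneg (Real.sqrt ((H : ℝ) + 1) - Real.sqrt H)]
    linarith

/-- Van der Corput's inequality, with the trivial bound `M` at lag `0` and
`norm_correlation_zetaPhase_le` at the other lags. -/
theorem norm_sum_zetaPhase_sq_le {t : ℝ} (ht : 0 < t) {M N H : ℕ} (hH : 0 < H) (hHM : H ≤ M)
    (hN : N ≤ M) (htH : t * H ≤ 256 * M ^ 3) :
    ‖∑ n ∈ Finset.range N, addChar (zetaPhase t M n)‖ ^ 2 ≤
      4 * M / H * (M + (128 * H * Real.sqrt (t * H / M) +
        512 * (M * Real.sqrt (M * H / t)))) := by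
  have hM : 0 < M := hH.trans_le hHM
  have hM' : (1 : ℝ) ≤ M := by exact_mod_cast hM
  have hM0 : (0 : ℝ) < M := by positivity
  have hH0 : (0 : ℝ) < H := by exact_mod_cast hH
  have hNM : (N : ℝ) ≤ M := by exact_mod_cast hN
  have hHM' : (H : ℝ) ≤ M := by exact_mod_cast hHM
  obtain ⟨G, rfl⟩ : ∃ G, H = G + 1 := ⟨H - 1, by omega⟩
  set c : ℕ → ℝ := fun d => if d = 0 then (M : ℝ) else
    128 * Real.sqrt (t * d / M) + 256 * (M * Real.sqrt (M / (t * d))) with hc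
  have hvc := norm_sum_sq_le_of_correlations (z := fun n => addChar (zetaPhase t M n)) (N := N)
    hH c (fun d hd => by
      rcases Nat.eq_zero_or_pos d with rfl | hd0
      · rw [hc]
        simp only [if_true]
        refine (norm_sum_le _ _).trans ?_
        simp [norm_addChar, hNM]
      · simp only [hc, hd0.ne', if_false]
        refine norm_correlation_zetaPhase_le ht hM hN hd0 (le_trans ?_ htH)
        gcongr)
  have hcsum : ∑ d ∈ Finset.range (G + 1), c d ≤ M + (128 * (G + 1 : ℕ) *
      Real.sqrt (t * (G + 1 : ℕ) / M) + 512 * (M * Real.sqrt (M * (G + 1 : ℕ) / t))) := by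
    rw [Finset.sum_range_succ', add_comm]
    refine add_le_add (by simp [hc]) ?_
    have hterm : ∀ d ∈ Finset.range G, c (d + 1) ≤ 128 * Real.sqrt (t * (G + 1 : ℕ) / M) +
        256 * (M * Real.sqrt (M / t)) * (1 / Real.sqrt ((d : ℝ) + 1)) := by
      intro d hd
      rw [Finset.mem_range] at hd
      simp only [hc, Nat.succ_ne_zero, if_false]
      refine add_le_add ?_ (le_of_eq ?_)
      · gcongr
      · push_cast
        rw [← div_div, Real.sqrt_div (by positivity)]
        ring
    refine (Finset.sum_le_sum hterm).trans ?_
    rw [Finset.sum_add_distrib, ← Finset.mul_sum, Finset.sum_const, Finset.card_range, nsmul_eq_mul]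
    have hsq := sum_range_one_div_sqrt_le G
    have hG : Real.sqrt G ≤ Real.sqrt (G + 1 : ℕ) := Real.sqrt_le_sqrt (by push_cast; linarith)
    refine add_le_add ?_ ?_
    · rw [← mul_assoc, mul_comm (128 : ℝ)]
      rw [mul_comm (128 : ℝ)]
      gcongr
      simp
    · have e : Real.sqrt (M * (G + 1 : ℕ) / t) = Real.sqrt (M / t) * Real.sqrt (G + 1 : ℕ) := by
        rw [← Real.sqrt_mul (by positivity)]
        congr 1
        ring
      rw [e, ← Finset.mul_sum]
      refine (mul_le_mul_of_nonneg_left (hsq.trans (mul_le_mul_of_nonneg_left hG zero_le_two))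
        (by positivity)).trans (le_of_eq ?_)
      ring
  set B := M + (128 * ((G + 1 : ℕ) : ℝ) *
      Real.sqrt (t * (G + 1 : ℕ) / M) + 512 * (M * Real.sqrt (M * (G + 1 : ℕ) / t))) with hB
  have hB0 : 0 ≤ B := by positivity
  rw [div_mul_eq_mul_div, le_div_iff₀ hH0, mul_comm]
  refine hvc.trans ?_
  calc _ ≤ (M + M : ℝ) * (2 * B) := by gcongr
    _ = 4 * M * B := by ring

/-- The third derivative test for `n^{-it}`, with an optimal choice of the shift. -/
theorem norm_sum_zetaPhase_le_of_third {q : ℝ} (hq : 1 ≤ q) {M N : ℕ} (hqM : q ≤ M)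
    (hMq : M ≤ q ^ 2) (hN : N ≤ M) :
    ‖∑ n ∈ Finset.range N, addChar (zetaPhase (q ^ 3) M n)‖ ≤ 64 * Real.sqrt (q * M) := by
  have hq0 : 0 < q := by linarith
  have hM0 : (0 : ℝ) < M := by linarith
  -- With `t = q³` the diagonal contributes `M²/H` and the lags contribute `M √(tH/M)`; both are of
  -- order `qM` when `H` is about `M/q`.
  set H := ⌈M / q⌉₊ with hHdef
  have hH1 : (M : ℝ) / q ≤ H := Nat.le_ceil _
  have hMq1 : 1 ≤ (M : ℝ) / q := by rwa [one_le_div hq0]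
  have hH2 : (H : ℝ) ≤ 2 * (M / q) := by
    have := Nat.ceil_lt_add_one (by positivity : 0 ≤ (M : ℝ) / q)
    linarith
  have hHpos : 0 < H := Nat.ceil_pos.mpr (by positivity)
  have hHM : H ≤ M := Nat.ceil_le.mpr (div_le_self hM0.le hq)
  have hH0 : (0 : ℝ) < H := by exact_mod_cast hHpos
  have hb := norm_sum_zetaPhase_sq_le (t := q ^ 3) (by positivity) hHpos hHM hN (by
    calc q ^ 3 * H ≤ q ^ 3 * (2 * (M / q)) := by gcongr
      _ = 2 * M * q ^ 2 := by field_simp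
      _ ≤ 2 * M * M ^ 2 := by gcongr
      _ ≤ 256 * (M : ℝ) ^ 3 := by nlinarith [pow_pos hM0 3])
  have e1 : Real.sqrt (q ^ 3 * H / M) ≤ 2 * q := by
    rw [Real.sqrt_le_left (by positivity)]
    calc q ^ 3 * H / M ≤ q ^ 3 * (2 * (M / q)) / M := by gcongr
      _ = 2 * q ^ 2 := by field_simp
      _ ≤ (2 * q) ^ 2 := by nlinarith [sq_nonneg q]
  have e2 : Real.sqrt (M * H / q ^ 3) ≤ H / q := by
    rw [Real.sqrt_le_left (by positivity)]
    calc M * H / q ^ 3 = (M / q) * H / q ^ 2 := by field_simp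
      _ ≤ H * H / q ^ 2 := by gcongr
      _ = (H / q) ^ 2 := by ring
  have hM2 : (M : ℝ) ^ 2 / q ≤ q * M := by
    rw [div_le_iff₀ hq0]
    nlinarith
  have hsq : ‖∑ n ∈ Finset.range N, addChar (zetaPhase (q ^ 3) M n)‖ ^ 2 ≤
      (64 * Real.sqrt (q * M)) ^ 2 := by
    refine hb.trans ?_
    calc _ ≤ 4 * M / H * (M + (128 * H * (2 * q) + 512 * (M * (H / q)))) := by gcongr
      _ = 4 * M * (M / H) + 1024 * (q * M) + 2048 * (M ^ 2 / q) := by field_simp; ring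
      _ ≤ 4 * M * q + 1024 * (q * M) + 2048 * (q * M) := by
          gcongr
          rw [div_le_iff₀ hH0, mul_comm, ← div_le_iff₀ hq0]
          exact hH1
      _ ≤ (64 * Real.sqrt (q * M)) ^ 2 := by
          rw [mul_pow, Real.sq_sqrt (by positivity)]
          nlinarith [mul_pos hq0 hM0]
  exact (pow_le_pow_iff_left₀ (norm_nonneg _) (by positivity) two_ne_zero).mp hsq

/-- A bound for `∑_{M ≤ n < M + N} n^{-it}` with `N ≤ M ≤ t²`, where `t = q³`. -/
theorem norm_sum_zetaPhase_le {q : ℝ} (hq : 1 ≤ q) {M N : ℕ} (hM : 0 < M) (hMq : M ≤ (q ^ 3) ^ 2)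
    (hN : N ≤ M) :
    ‖∑ n ∈ Finset.range N, addChar (zetaPhase (q ^ 3) M n)‖ ≤ 192 * Real.sqrt (q * M) := by
  have hM' : (1 : ℝ) ≤ M := by exact_mod_cast hM
  have hM0 : (0 : ℝ) < M := by positivity
  have hq0 : 0 < q := by linarith
  have hNM : (N : ℝ) ≤ M := by exact_mod_cast hN
  set w := Real.sqrt (q * M) with hw
  have hw0 : 0 ≤ w := Real.sqrt_nonneg _
  -- Four ranges, cut at `q`, `q²` and `q³`: the trivial bound, then the third, second and first
  -- derivative tests. Each yields a multiple of `√(qM)`.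
  rcases le_total (M : ℝ) q with h1 | h1
  · have : ‖∑ n ∈ Finset.range N, addChar (zetaPhase (q ^ 3) M n)‖ ≤ M := by
      refine (norm_sum_le _ _).trans ?_
      simpa [norm_addChar] using hNM
    have h2 : (M : ℝ) ≤ w := Real.le_sqrt_of_sq_le (by nlinarith)
    linarith
  rcases le_total (M : ℝ) (q ^ 2) with h2 | h2
  · have := norm_sum_zetaPhase_le_of_third hq h1 h2 hN
    linarith
  have hq3 : 0 < q ^ 3 := by positivity
  rcases le_total (M : ℝ) (q ^ 3) with h3 | h3
  · have := norm_sum_zetaPhase_le_of_second hq3 hM hN (by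
      calc q ^ 3 = q ^ 2 * q := by ring
        _ ≤ (M : ℝ) * M := by gcongr
        _ = (M : ℝ) ^ 2 := by ring)
    have e1 : Real.sqrt (q ^ 3) ≤ w := Real.sqrt_le_sqrt (by nlinarith)
    have e2 : M / Real.sqrt (q ^ 3) ≤ w := by
      rw [div_le_iff₀ (Real.sqrt_pos.mpr hq3), hw, ← Real.sqrt_mul (by positivity)]
      refine Real.le_sqrt_of_sq_le ?_
      calc (M : ℝ) ^ 2 = 1 * M * M := by ring
        _ ≤ q * M * q ^ 3 := by gcongr
    linarith
  · have := norm_sum_zetaPhase_le_of_first hq3 hN h3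
    have e : M / q ^ 3 ≤ w := by
      rw [div_le_iff₀ hq3]
      have : (M : ℝ) ≤ (w * q ^ 3) := by
        refine (pow_le_pow_iff_left₀ hM0.le (by positivity) two_ne_zero).mp ?_
        rw [mul_pow, Real.sq_sqrt (by positivity)]
        calc (M : ℝ) ^ 2 = 1 * M * M := by ring
          _ ≤ q * M * (q ^ 3) ^ 2 := by gcongr
      exact this
    linarith

end GeodesicEisenstein

/-! ### Approximation of the zeta function by partial sums -/

namespace GeodesicEisenstein

/-- Integrate the derivative `-s u^{-s-1}` and take norms inside. Evaluating the real integral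
exactly keeps a difference that will telescope. -/
theorem norm_cpow_neg_sub_cpow_neg_le {s : ℂ} (hs : 0 < s.re) {x y : ℝ} (hx : 0 < x)
    (hxy : x ≤ y) :
    ‖(y : ℂ) ^ (-s) - (x : ℂ) ^ (-s)‖ ≤ ‖s‖ / s.re * (x ^ (-s.re) - y ^ (-s.re)) := by
  have hs0 : s ≠ 0 := fun h => by simp [h] at hs
  have h0 : (0 : ℝ) ∉ uIcc x y := by
    rw [uIcc_of_le hxy]
    exact fun h => absurd h.1 (not_le.mpr hx)
  have h1 : ∫ u in x..y, (u : ℂ) ^ (-s - 1) = ((y : ℂ) ^ (-s) - (x : ℂ) ^ (-s)) / (-s) := by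
    rw [integral_cpow (Or.inr ⟨fun h => hs0 (by linear_combination -h), h0⟩), sub_add_cancel]
  have h2 : ∫ u in x..y, u ^ (-s.re - 1) = (y ^ (-s.re) - x ^ (-s.re)) / (-s.re) := by
    rw [integral_rpow (Or.inr ⟨by intro h; linarith, h0⟩), sub_add_cancel]
  have h3 : ‖∫ u in x..y, (u : ℂ) ^ (-s - 1)‖ ≤ ∫ u in x..y, u ^ (-s.re - 1) := by
    refine (intervalIntegral.norm_integral_le_integral_norm hxy).trans (le_of_eq ?_)
    refine intervalIntegral.integral_congr fun u hu => ?_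
    rw [uIcc_of_le hxy] at hu
    simp [Complex.norm_cpow_eq_rpow_re_of_pos (hx.trans_le hu.1)]
  have h4 : (y : ℂ) ^ (-s) - (x : ℂ) ^ (-s) = -s * ∫ u in x..y, (u : ℂ) ^ (-s - 1) := by
    rw [h1]
    field_simp
  rw [h4, norm_mul, norm_neg]
  refine (mul_le_mul_of_nonneg_left h3 (norm_nonneg _)).trans (le_of_eq ?_)
  rw [h2]
  field_simp
  ring

/-- The general term of the series for `(s - 1) ζ(s) - s`. -/
noncomputable def zetaTerm (n : ℕ) (s : ℂ) : ℂ :=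
  (s - 1) * ((n + 2 : ℝ) : ℂ) ^ (-s) + (((n + 2 : ℝ) : ℂ) ^ (1 - s) - ((n + 1 : ℝ) : ℂ) ^ (1 - s))

/-- The term is the increment over `[n+1, n+2]` of a function with derivative `(s-1) ((n+2)^{-s} -
x^{-s})`. The bound telescopes in `n`, which gives sharp tails later. -/
theorem norm_zetaTerm_le {s : ℂ} (hs : 0 < s.re) (n : ℕ) :
    ‖zetaTerm n s‖ ≤
      ‖s - 1‖ * (‖s‖ / s.re * ((n + 1 : ℝ) ^ (-s.re) - (n + 2 : ℝ) ^ (-s.re))) := by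
  set F : ℝ → ℂ := fun x => (s - 1) * ((x : ℂ) - (n + 1)) * ((n + 2 : ℝ) : ℂ) ^ (-s) +
    (x : ℂ) ^ (1 - s) with hF
  have hder : ∀ x : ℝ, 0 < x → HasDerivAt F
      ((s - 1) * (((n + 2 : ℝ) : ℂ) ^ (-s) - (x : ℂ) ^ (-s))) x := by
    intro x hx
    have hid : HasDerivAt (fun x : ℝ => (x : ℂ)) 1 x := Complex.ofRealCLM.hasDerivAt
    have h1 := (((hid.sub_const ((n : ℂ) + 1)).const_mul (s - 1)).mul_const
      (((n + 2 : ℝ) : ℂ) ^ (-s)))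
    have h2 : HasDerivAt (fun x : ℝ => (x : ℂ) ^ (1 - s)) ((1 - s) * (x : ℂ) ^ (1 - s - 1) * 1) x :=
      ((hasDerivAt_id (x : ℂ)).cpow_const (c := 1 - s) (Or.inl (by simpa using hx))).comp_ofReal
    convert! h1.add h2 using 1
    rw [show (1 - s - 1 : ℂ) = -s by ring]
    ring
  have hn : (0 : ℝ) < n + 1 := by positivity
  have hbound := norm_image_sub_le_of_norm_deriv_le_segment' (f := F) (a := (n : ℝ) + 1)
    (b := (n : ℝ) + 2)
    (C := ‖s - 1‖ * (‖s‖ / s.re * ((n + 1 : ℝ) ^ (-s.re) - (n + 2 : ℝ) ^ (-s.re))))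
    (fun x hx => (hder x (hn.trans_le hx.1)).hasDerivWithinAt)
    (fun x hx => by
      rw [norm_mul]
      gcongr
      refine (norm_cpow_neg_sub_cpow_neg_le hs (hn.trans_le hx.1) hx.2.le).trans ?_
      exact mul_le_mul_of_nonneg_left (sub_le_sub_right
        (Real.rpow_le_rpow_of_nonpos hn hx.1 (neg_nonpos.mpr hs.le)) _) (by positivity))
    ((n : ℝ) + 2) ⟨by linarith, le_rfl⟩
  have e : F ((n : ℝ) + 2) - F ((n : ℝ) + 1) = zetaTerm n s := by
    simp only [hF, zetaTerm]
    push_cast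
    ring
  rw [e] at hbound
  refine hbound.trans (le_of_eq ?_)
  ring

theorem rpow_neg_sub_rpow_neg_le {σ : ℝ} (hσ : 0 < σ) (n : ℕ) :
    1 / σ * ((n + 1 : ℝ) ^ (-σ) - (n + 2 : ℝ) ^ (-σ)) ≤ (n + 1 : ℝ) ^ (-σ - 1) := by
  have hn : (0 : ℝ) < n + 1 := by positivity
  have h0 : (0 : ℝ) ∉ uIcc ((n : ℝ) + 1) (n + 2) := by
    rw [uIcc_of_le (by linarith)]
    exact fun h => absurd h.1 (not_le.mpr hn)
  have h2 : ∫ u in ((n : ℝ) + 1)..(n + 2), u ^ (-σ - 1) =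
      ((n + 2 : ℝ) ^ (-σ) - (n + 1 : ℝ) ^ (-σ)) / (-σ) := by
    rw [integral_rpow (Or.inr ⟨by intro h; linarith, h0⟩), sub_add_cancel]
  have h3 : ∫ u in ((n : ℝ) + 1)..(n + 2), u ^ (-σ - 1) ≤
      ∫ u in ((n : ℝ) + 1)..(n + 2), (n + 1 : ℝ) ^ (-σ - 1) := by
    refine intervalIntegral.integral_mono_on (by linarith)
      (intervalIntegral.intervalIntegrable_rpow (Or.inr h0)) (by simp) fun x hx => ?_
    exact Real.rpow_le_rpow_of_nonpos hn hx.1 (by linarith)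
  rw [h2] at h3
  simp only [intervalIntegral.integral_const, smul_eq_mul] at h3
  have : ((n + 2 : ℝ) ^ (-σ) - (n + 1 : ℝ) ^ (-σ)) / (-σ) =
      1 / σ * ((n + 1 : ℝ) ^ (-σ) - (n + 2 : ℝ) ^ (-σ)) := by
    field_simp
    ring
  rw [← this]
  linarith

theorem norm_zetaTerm_le' {s : ℂ} (hs : 0 < s.re) (n : ℕ) :
    ‖zetaTerm n s‖ ≤ ‖s - 1‖ * ‖s‖ * (n + 1 : ℝ) ^ (-s.re - 1) := by
  refine (norm_zetaTerm_le hs n).trans ?_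
  have := rpow_neg_sub_rpow_neg_le hs n
  calc _ = ‖s - 1‖ * ‖s‖ * (1 / s.re * ((n + 1 : ℝ) ^ (-s.re) - (n + 2 : ℝ) ^ (-s.re))) := by ring
    _ ≤ _ := by gcongr

theorem summable_zetaTerm {s : ℂ} (hs : 0 < s.re) : Summable fun n => zetaTerm n s := by
  refine Summable.of_norm_bounded (g := fun n : ℕ => ‖s - 1‖ * ‖s‖ * (n + 1 : ℝ) ^ (-s.re - 1)) ?_
    (norm_zetaTerm_le' hs)
  refine Summable.mul_left _ ?_
  have := (summable_nat_add_iff 1).mpr (Real.summable_nat_rpow.mpr (by linarith : -s.re - 1 < -1))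
  exact_mod_cast this

theorem sum_range_zetaTerm (N : ℕ) (s : ℂ) :
    ∑ n ∈ Finset.range N, zetaTerm n s =
      (s - 1) * ∑ n ∈ Finset.range N, ((n + 2 : ℝ) : ℂ) ^ (-s) + ((N + 1 : ℝ) : ℂ) ^ (1 - s) - 1 := by
  induction N with
  | zero => simp
  | succ N ih =>
    rw [Finset.sum_range_succ, Finset.sum_range_succ, ih, zetaTerm]
    push_cast
    rw [show ((N : ℂ) + 1 + 1) = N + 2 by ring]
    ring

theorem hasSum_zetaTerm_of_one_lt_re {s : ℂ} (hs : 1 < s.re) :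
    HasSum (fun n => zetaTerm n s) (riemannZeta₁ s - s) := by
  have hs1 : s ≠ 1 := fun h => by simp [h] at hs
  have hsum := (summable_zetaTerm (by linarith : 0 < s.re)).hasSum
  have hz : Tendsto (fun N : ℕ => ∑ n ∈ Finset.range N, ((n + 2 : ℝ) : ℂ) ^ (-s)) atTop
      (nhds (riemannZeta s - 1)) := by
    have h1 : HasSum (fun n : ℕ => 1 / ((n : ℂ) + 1) ^ s) (riemannZeta s) := by
      rw [zeta_eq_tsum_one_div_nat_add_one_cpow hs]
      refine Summable.hasSum ?_
      have := (summable_nat_add_iff 1).mpr (Complex.summable_one_div_nat_cpow.mpr hs)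
      exact_mod_cast this
    have h2 := ((hasSum_nat_add_iff' 1).mpr h1).tendsto_sum_nat
    simp only [Finset.sum_range_one, Nat.cast_zero, zero_add, one_cpow, div_one] at h2
    refine h2.congr fun N => Finset.sum_congr rfl fun n _ => ?_
    rw [cpow_neg, one_div]
    push_cast
    rw [show ((n : ℂ) + 1 + 1) = n + 2 by ring]
  have hpow : Tendsto (fun N : ℕ => ((N + 1 : ℝ) : ℂ) ^ (1 - s)) atTop (nhds 0) := by
    rw [tendsto_zero_iff_norm_tendsto_zero]
    have h1 : Tendsto (fun x : ℝ => x ^ (-(s.re - 1))) atTop (nhds 0) :=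
      tendsto_rpow_neg_atTop (by linarith)
    have h2 : Tendsto (fun N : ℕ => (N : ℝ) + 1) atTop atTop :=
      tendsto_atTop_add_const_right _ _ tendsto_natCast_atTop_atTop
    refine (h1.comp h2).congr fun N => ?_
    rw [Complex.norm_cpow_eq_rpow_re_of_pos (by positivity)]
    simp
  have hlim := ((hz.const_mul (s - 1)).add hpow).sub_const 1
  have huniq := tendsto_nhds_unique hsum.tendsto_sum_nat
    (hlim.congr fun N => (sum_range_zetaTerm N s).symm)
  have : (s - 1) * (riemannZeta s - 1) + 0 - 1 = riemannZeta₁ s - s := by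
    rw [riemannZeta_eq_inv_sub_mul hs1]
    field_simp [sub_ne_zero.mpr hs1]
    ring
  rwa [huniq, this] at hsum

/-- Both sides are analytic on `Re s > 0` and agree on `Re s > 1`. Using the entire function
`riemannZeta₁` avoids the pole at `1`. -/
theorem hasSum_zetaTerm {s : ℂ} (hs : 0 < s.re) :
    HasSum (fun n => zetaTerm n s) (riemannZeta₁ s - s) := by
  have hU : IsOpen {s : ℂ | 0 < s.re} := isOpen_lt continuous_const continuous_re
  have hdiff : DifferentiableOn ℂ (fun s => ∑' n, zetaTerm n s) {s : ℂ | 0 < s.re} := by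
    intro z hz
    set V : Set ℂ := {s : ℂ | z.re / 2 < s.re} ∩ Metric.ball z 1 with hV
    have hVo : IsOpen V := (isOpen_lt continuous_const continuous_re).inter Metric.isOpen_ball
    have hz0 : (0 : ℝ) < z.re := hz
    have hzV : z ∈ V := ⟨by simp only [mem_ofPred_eq]; linarith, Metric.mem_ball_self one_pos⟩
    refine (DifferentiableOn.differentiableAt ?_ (hVo.mem_nhds hzV)).differentiableWithinAt
    refine differentiableOn_tsum_of_summable_norm
      (u := fun n : ℕ => (‖z‖ + 2) * (‖z‖ + 1) * (n + 1 : ℝ) ^ (-(z.re / 2) - 1)) ?_ ?_ hVo ?_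
    · refine Summable.mul_left _ ?_
      have := (summable_nat_add_iff 1).mpr
        (Real.summable_nat_rpow.mpr (by linarith : -(z.re / 2) - 1 < -1))
      exact_mod_cast this
    · intro n
      have h1 : ((n + 1 : ℝ) : ℂ) ≠ 0 := by exact_mod_cast (by positivity : (n + 1 : ℝ) ≠ 0)
      have h2 : ((n + 2 : ℝ) : ℂ) ≠ 0 := by exact_mod_cast (by positivity : (n + 2 : ℝ) ≠ 0)
      unfold zetaTerm
      refine Differentiable.differentiableOn ?_
      refine ((differentiable_id.sub_const 1).mul ?_).add (Differentiable.sub ?_ ?_)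
      · exact differentiable_id.neg.const_cpow (Or.inl h2)
      · exact (differentiable_id.const_sub 1).const_cpow (Or.inl h2)
      · exact (differentiable_id.const_sub 1).const_cpow (Or.inl h1)
    · intro n w hw
      have hw1 : z.re / 2 < w.re := hw.1
      have hw2 : ‖w - z‖ < 1 := by simpa [dist_eq_norm] using hw.2
      have hw3 : ‖w‖ ≤ ‖z‖ + 1 := by
        have := norm_le_norm_add_norm_sub' w z
        linarith
      have hw4 : ‖w - 1‖ ≤ ‖z‖ + 2 := by
        have := norm_sub_le w 1
        rw [norm_one] at this
        linarith
      refine (norm_zetaTerm_le' (by linarith) n).trans ?_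
      gcongr
      · simp
  have hg : DifferentiableOn ℂ (fun s => riemannZeta₁ s - s) {s : ℂ | 0 < s.re} :=
    (differentiable_riemannZeta₁.sub differentiable_id).differentiableOn
  have hconv : IsPreconnected {s : ℂ | 0 < s.re} := (convex_halfSpace_re_gt 0).isPreconnected
  have heq := (hdiff.analyticOnNhd hU).eqOn_of_preconnected_of_eventuallyEq (hg.analyticOnNhd hU)
    hconv (show (2 : ℂ) ∈ {s : ℂ | 0 < s.re} by simp) (by
      filter_upwards [(isOpen_lt continuous_const continuous_re : IsOpen {s : ℂ | 1 < s.re}).mem_nhds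
        (by simp : (1 : ℝ) < (2 : ℂ).re)] with s hs
      exact (hasSum_zetaTerm_of_one_lt_re hs).tsum_eq)
  have := (summable_zetaTerm hs).hasSum
  rwa [show ∑' n, zetaTerm n s = riemannZeta₁ s - s from heq hs] at this

/-- Approximation of the zeta function in the half-plane `Re s > 0` by a partial sum of its
Dirichlet series. -/
theorem norm_riemannZeta_sub_sum_le {s : ℂ} (hs : 0 < s.re) (hs1 : s ≠ 1) (N : ℕ) :
    ‖riemannZeta s - ∑ n ∈ Finset.range (N + 1), ((n + 1 : ℝ) : ℂ) ^ (-s) -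
      ((N + 1 : ℝ) : ℂ) ^ (1 - s) / (s - 1)‖ ≤ ‖s‖ / s.re * (N + 1 : ℝ) ^ (-s.re) := by
  have hs1' : s - 1 ≠ 0 := sub_ne_zero.mpr hs1
  have hsum := (hasSum_nat_add_iff' N).mpr (hasSum_zetaTerm hs)
  -- The bounds for the terms from index `N` on telescope to a single power of `N + 1`.
  have htel : HasSum (fun n : ℕ => ‖s - 1‖ * (‖s‖ / s.re *
      (((n + N : ℕ) + 1 : ℝ) ^ (-s.re) - ((n + N : ℕ) + 2 : ℝ) ^ (-s.re))))
      (‖s - 1‖ * (‖s‖ / s.re * (N + 1 : ℝ) ^ (-s.re))) := by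
    refine HasSum.mul_left _ (HasSum.mul_left _ ?_)
    rw [hasSum_iff_tendsto_nat_of_nonneg]
    · have h1 : Tendsto (fun M : ℕ => (N + 1 : ℝ) ^ (-s.re) - ((M + N : ℕ) + 1 : ℝ) ^ (-s.re)) atTop
          (nhds ((N + 1 : ℝ) ^ (-s.re) - 0)) := by
        refine Tendsto.const_sub _ ((tendsto_rpow_neg_atTop hs).comp ?_)
        exact tendsto_atTop_add_const_right _ _
          (tendsto_natCast_atTop_atTop.comp (tendsto_add_atTop_nat N))
      rw [sub_zero] at h1
      refine h1.congr fun M => ?_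
      have := Finset.sum_range_sub' (fun n : ℕ => ((n + N : ℕ) + 1 : ℝ) ^ (-s.re)) M
      simp only [zero_add] at this
      rw [← this]
      refine Finset.sum_congr rfl fun n _ => ?_
      push_cast
      rw [show (n : ℝ) + 1 + N + 1 = n + N + 2 by ring]
    · intro n
      rw [sub_nonneg]
      exact Real.rpow_le_rpow_of_nonpos (by positivity) (by linarith) (by linarith)
  have hb : ‖riemannZeta₁ s - s - ∑ n ∈ Finset.range N, zetaTerm n s‖ ≤
      ‖s - 1‖ * (‖s‖ / s.re * (N + 1 : ℝ) ^ (-s.re)) := by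
    rw [← hsum.tsum_eq]
    exact tsum_of_norm_bounded htel fun n => norm_zetaTerm_le hs (n + N)
  have e : riemannZeta₁ s - s - ∑ n ∈ Finset.range N, zetaTerm n s = (s - 1) *
      (riemannZeta s - ∑ n ∈ Finset.range (N + 1), ((n + 1 : ℝ) : ℂ) ^ (-s) -
      ((N + 1 : ℝ) : ℂ) ^ (1 - s) / (s - 1)) := by
    rw [sum_range_zetaTerm, Finset.sum_range_succ', riemannZeta_eq_inv_sub_mul hs1]
    have : ∀ n ∈ Finset.range N, (((n + 1 : ℕ) + 1 : ℝ) : ℂ) ^ (-s) = ((n + 2 : ℝ) : ℂ) ^ (-s) := by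
      intro n _
      push_cast
      rw [show ((n : ℂ) + 1 + 1) = n + 2 by ring]
    rw [Finset.sum_congr rfl this]
    simp only [Nat.cast_zero, zero_add, ofReal_one, one_cpow]
    field_simp
    ring
  rw [e, norm_mul] at hb
  exact le_of_mul_le_mul_left hb (norm_pos_iff.mpr hs1')

end GeodesicEisenstein

/-! ### The Weyl bound for the zeta function -/

namespace GeodesicEisenstein

/-- Abel summation: the final weight and the total variation of nonnegative decreasing weights add
up to `w 0`. -/
theorem norm_sum_antitone_mul_le {w : ℕ → ℝ} (hw : Antitone w) (hw0 : ∀ n, 0 ≤ w n) {z : ℕ → ℂ}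
    {B : ℝ} {N : ℕ} (hB : ∀ m ≤ N, ‖∑ n ∈ Finset.range m, z n‖ ≤ B) :
    ‖∑ n ∈ Finset.range N, (w n : ℂ) * z n‖ ≤ w 0 * B := by
  have hid : ∀ N, ∑ n ∈ Finset.range N, (w n : ℂ) * z n = w N * ∑ n ∈ Finset.range N, z n +
      ∑ n ∈ Finset.range N, ((w n - w (n + 1) : ℝ) : ℂ) * ∑ k ∈ Finset.range (n + 1), z k := by
    intro N
    induction N with
    | zero => simp
    | succ N ih =>
      rw [Finset.sum_range_succ, ih, Finset.sum_range_succ (fun n =>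
        ((w n - w (n + 1) : ℝ) : ℂ) * ∑ k ∈ Finset.range (n + 1), z k), Finset.sum_range_succ]
      push_cast
      ring
  rw [hid]
  calc _ ≤ w N * B + ∑ n ∈ Finset.range N, (w n - w (n + 1)) * B := by
        refine (norm_add_le _ _).trans (add_le_add ?_ ((norm_sum_le _ _).trans
          (Finset.sum_le_sum fun n hn => ?_)))
        · rw [norm_mul, Complex.norm_real, Real.norm_of_nonneg (hw0 N)]
          exact mul_le_mul_of_nonneg_left (hB N le_rfl) (hw0 N)
        · have h := sub_nonneg.mpr (hw (Nat.le_succ n))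
          rw [norm_mul, Complex.norm_real, Real.norm_of_nonneg h]
          exact mul_le_mul_of_nonneg_left (hB (n + 1) (Finset.mem_range.mp hn)) h
    _ = w 0 * B := by
        rw [← Finset.sum_mul, Finset.sum_range_sub']
        ring

theorem cpow_neg_half_eq {t : ℝ} {M n : ℕ} (hM : 0 < M) :
    ((M + n : ℕ) : ℂ) ^ (-(1 / 2 + I * t)) =
      (((M + n : ℝ) ^ (-(1 / 2) : ℝ) : ℝ) : ℂ) * addChar (zetaPhase t M n) := by
  have hpos : (0 : ℝ) < M + n := by positivity
  have hne : ((M + n : ℝ) : ℂ) ≠ 0 := by exact_mod_cast hpos.ne'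
  rw [show ((M + n : ℕ) : ℂ) = ((M + n : ℝ) : ℂ) by push_cast; rfl,
    show (-(1 / 2 + I * t) : ℂ) = ((-(1 / 2) : ℝ) : ℂ) + -(I * t) by push_cast; ring,
    Complex.cpow_add _ _ hne, Complex.ofReal_cpow hpos.le]
  congr 1
  rw [Complex.cpow_def_of_ne_zero hne, ← Complex.ofReal_log hpos.le, addChar, zetaPhase]
  congr 1
  push_cast
  field_simp

/-- The leading weight `M^{-1/2}` cancels `√M` in the bound `√(qM)`, so every dyadic block costs the
same, and only their number matters. -/
theorem norm_dyadic_block_le {q : ℝ} (hq : 1 ≤ q) {M : ℕ} (hM : 0 < M) (hMq : M ≤ (q ^ 3) ^ 2) :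
    ‖∑ n ∈ Finset.range M, ((M + n : ℕ) : ℂ) ^ (-(1 / 2 + I * ((q ^ 3 : ℝ) : ℂ)))‖ ≤
      192 * Real.sqrt q := by
  have hM0 : (0 : ℝ) < M := by exact_mod_cast hM
  rw [Finset.sum_congr rfl fun n _ => cpow_neg_half_eq hM]
  refine (norm_sum_antitone_mul_le (w := fun n : ℕ => (M + n : ℝ) ^ (-(1 / 2) : ℝ)) ?_ ?_
    (fun m hm => norm_sum_zetaPhase_le hq hM hMq hm)).trans (le_of_eq ?_)
  · intro m n hmn
    refine Real.rpow_le_rpow_of_nonpos (by positivity) ?_ (by norm_num)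
    gcongr
  · intro n
    positivity
  · simp only [Nat.cast_zero, add_zero]
    rw [Real.rpow_neg hM0.le, ← Real.sqrt_eq_rpow, Real.sqrt_mul (by linarith)]
    field_simp

theorem norm_partial_zeta_half_le {q : ℝ} (hq : 1 ≤ q) (J : ℕ)
    (hJ : ∀ j < J, (2 : ℝ) ^ j ≤ (q ^ 3) ^ 2) :
    ‖∑ n ∈ Finset.range (2 ^ J - 1), ((n + 1 : ℝ) : ℂ) ^ (-(1 / 2 + I * ((q ^ 3 : ℝ) : ℂ)))‖ ≤
      J * (192 * Real.sqrt q) := by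
  induction J with
  | zero => simp
  | succ J ih =>
    have hpow : 1 ≤ 2 ^ J := Nat.one_le_two_pow
    have e : 2 ^ (J + 1) - 1 = (2 ^ J - 1) + 2 ^ J := by rw [pow_succ]; omega
    rw [e, Finset.sum_range_add]
    have hb := norm_dyadic_block_le hq (M := 2 ^ J) (by positivity)
      (by exact_mod_cast hJ J (Nat.lt_succ_self J))
    have e2 : ∀ n ∈ Finset.range (2 ^ J), (((2 ^ J - 1 + n : ℕ) + 1 : ℝ) : ℂ) ^
        (-(1 / 2 + I * ((q ^ 3 : ℝ) : ℂ))) =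
        ((2 ^ J + n : ℕ) : ℂ) ^ (-(1 / 2 + I * ((q ^ 3 : ℝ) : ℂ))) := by
      intro n _
      congr 1
      have : (2 ^ J - 1 + n) + 1 = 2 ^ J + n := by omega
      exact_mod_cast this
    rw [Finset.sum_congr rfl e2]
    refine (norm_add_le _ _).trans ?_
    push_cast at *
    linarith [ih fun j hj => hJ j (by omega)]

/-- The Weyl bound for the zeta function on the critical line. -/
theorem exists_norm_riemannZeta_half_le {ε : ℝ} (hε : 0 < ε) :
    ∃ C : ℝ, 0 < C ∧ ∀ t : ℝ, 1 ≤ t → ‖riemannZeta (1 / 2 + I * t)‖ ≤ C * t ^ (1 / 6 + ε) := by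
  refine ⟨192 * (1 + 3 / ε) + 6, by positivity, fun t ht => ?_⟩
  have ht0 : 0 < t := by linarith
  set q : ℝ := t ^ (1 / 3 : ℝ) with hqdef
  have hq3 : q ^ 3 = t := by
    rw [hqdef, ← Real.rpow_natCast, ← Real.rpow_mul ht0.le]
    norm_num
  have hq : 1 ≤ q := Real.one_le_rpow ht (by norm_num)
  have hsq : Real.sqrt q = t ^ (1 / 6 : ℝ) := by
    rw [Real.sqrt_eq_rpow, hqdef, ← Real.rpow_mul ht0.le]
    norm_num
  -- A cutoff `2^{m+1}` of order `t²` makes both the boundary term, of size `2^{(m+1)/2} / t`, and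
  -- the remainder, of size `t / 2^{(m+1)/2}`, bounded.
  obtain ⟨m, hm1, hm2⟩ := exists_nat_pow_near (by nlinarith : 1 ≤ t ^ 2) (by norm_num : (1 : ℝ) < 2)
  have hpow1 : (1 : ℝ) ≤ 2 ^ (m + 1) := one_le_pow₀ (by norm_num)
  have hpow : 1 ≤ 2 ^ (m + 1) := Nat.one_le_two_pow
  have hpart := norm_partial_zeta_half_le hq (m + 1) (fun j hj => by
    rw [hq3]
    exact (pow_le_pow_right₀ (by norm_num) (by omega)).trans hm1)
  rw [hq3] at hpart
  set s : ℂ := 1 / 2 + I * t with hs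
  have hsre : s.re = 1 / 2 := by simp [hs]
  have hsim : s.im = t := by simp [hs]
  have hs1 : s ≠ 1 := fun h => by
    have := congrArg Complex.im h
    simp [hsim] at this
    linarith
  have happ := norm_riemannZeta_sub_sum_le (by rw [hsre]; norm_num : 0 < s.re) hs1 (2 ^ (m + 1) - 1)
  have hc : (((2 ^ (m + 1) - 1 : ℕ) : ℝ) + 1) = 2 ^ (m + 1) := by
    rw [Nat.cast_sub hpow]
    push_cast
    ring
  rw [Finset.sum_range_succ, hc, hsre] at happ
  set S := ∑ n ∈ Finset.range (2 ^ (m + 1) - 1), ((n + 1 : ℝ) : ℂ) ^ (-s) with hS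
  have hpos : (0 : ℝ) < 2 ^ (m + 1) := by positivity
  have hrt : t ≤ (2 ^ (m + 1) : ℝ) ^ (1 / 2 : ℝ) := by
    rw [← Real.sqrt_eq_rpow]
    exact Real.le_sqrt_of_sq_le hm2.le
  have hrt2 : (2 ^ (m + 1) : ℝ) ^ (1 / 2 : ℝ) ≤ 2 * t := by
    rw [← Real.sqrt_eq_rpow, Real.sqrt_le_left (by positivity), pow_succ]
    nlinarith
  have hnorms : ‖s‖ ≤ t + 1 / 2 := by
    refine (Complex.norm_le_abs_re_add_abs_im s).trans ?_
    rw [hsre, hsim, abs_of_pos ht0, abs_of_pos (by norm_num : (0 : ℝ) < 1 / 2)]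
    linarith
  have hA : ‖((2 ^ (m + 1) : ℝ) : ℂ) ^ (-s)‖ ≤ 1 := by
    rw [Complex.norm_cpow_eq_rpow_re_of_pos hpos]
    exact Real.rpow_le_one_of_one_le_of_nonpos hpow1 (by simp [hsre])
  have hB : ‖((2 ^ (m + 1) : ℝ) : ℂ) ^ (1 - s) / (s - 1)‖ ≤ 2 := by
    rw [norm_div, Complex.norm_cpow_eq_rpow_re_of_pos hpos, Complex.sub_re, hsre, Complex.one_re,
      show (1 - 1 / 2 : ℝ) = 1 / 2 by norm_num]
    have h1 : t ≤ ‖s - 1‖ := by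
      have := Complex.abs_im_le_norm (s - 1)
      rwa [Complex.sub_im, hsim, Complex.one_im, sub_zero, abs_of_pos ht0] at this
    rw [div_le_iff₀ (by linarith)]
    linarith
  have hD : ‖s‖ / (1 / 2) * (2 ^ (m + 1) : ℝ) ^ (-(1 / 2) : ℝ) ≤ 3 := by
    rw [Real.rpow_neg hpos.le, ← div_eq_mul_inv, div_le_iff₀ (by positivity)]
    linarith
  have hzeta : ‖riemannZeta s‖ ≤ ‖S‖ + 6 := by
    have e : riemannZeta s = (riemannZeta s - (S + ((2 ^ (m + 1) : ℝ) : ℂ) ^ (-s)) -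
        ((2 ^ (m + 1) : ℝ) : ℂ) ^ (1 - s) / (s - 1)) + S + ((2 ^ (m + 1) : ℝ) : ℂ) ^ (-s) +
        ((2 ^ (m + 1) : ℝ) : ℂ) ^ (1 - s) / (s - 1) := by ring
    rw [e]
    refine (norm_add_le _ _).trans ?_
    refine (add_le_add_left ((norm_add_le _ _).trans
      (add_le_add_left (norm_add_le _ _) _)) _).trans ?_
    linarith
  -- The number of dyadic blocks is `O(log t)`, which is the only source of `t^ε`.
  have hlog : (m : ℝ) ≤ 3 / ε * t ^ ε := by
    have h1 : m * Real.log 2 ≤ 2 * Real.log t := by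
      have := Real.log_le_log (by positivity) hm1
      rwa [Real.log_pow, Real.log_pow] at this
    have h2 := Real.log_le_rpow_div ht0.le hε
    have h3 := Real.log_two_gt_d9
    have h4 : (0 : ℝ) ≤ m := Nat.cast_nonneg m
    have h5 : 0 ≤ Real.log t := Real.log_nonneg ht
    have h6 : (m : ℝ) ≤ 3 * Real.log t := by nlinarith
    calc (m : ℝ) ≤ 3 * Real.log t := h6
      _ ≤ 3 * (t ^ ε / ε) := by gcongr
      _ = 3 / ε * t ^ ε := by ring
  have hte : 1 ≤ t ^ ε := Real.one_le_rpow ht hε.le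
  have htall : 1 ≤ t ^ (1 / 6 + ε) := Real.one_le_rpow ht (by positivity)
  have hS2 : ‖S‖ ≤ 192 * (1 + 3 / ε) * t ^ (1 / 6 + ε) := by
    refine hpart.trans ?_
    rw [hsq, Real.rpow_add ht0]
    push_cast
    calc ((m : ℝ) + 1) * (192 * t ^ (1 / 6 : ℝ))
        ≤ (3 / ε * t ^ ε + t ^ ε) * (192 * t ^ (1 / 6 : ℝ)) := by gcongr
      _ = _ := by ring
  linarith

end GeodesicEisenstein

/-! ### The zeta function near the line `Re s = 1` -/

namespace GeodesicEisenstein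

/-- Bernoulli's inequality for the exponent `η ≤ 1` shows that each increment of `N^η / η` dominates
the next summand. -/
theorem sum_range_rpow_neg_le {η : ℝ} (hη : 0 < η) (hη1 : η ≤ 1) (N : ℕ) :
    ∑ n ∈ Finset.range N, (n + 1 : ℝ) ^ (η - 1) ≤ (N : ℝ) ^ η / η := by
  induction N with
  | zero => simp [Real.zero_rpow hη.ne']
  | succ N ih =>
    rw [Finset.sum_range_succ]
    refine (add_le_add_left ih _).trans ?_
    push_cast
    have hpos : (0 : ℝ) < N + 1 := by positivity
    have hb := _root_.rpow_one_add_le_one_add_mul_self (s := -(1 / ((N : ℝ) + 1))) (p := η)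
      (by rw [neg_le_neg_iff, div_le_one hpos]; linarith [Nat.cast_nonneg (α := ℝ) N]) hη.le hη1
    have h1 : (N : ℝ) ^ η = (N + 1 : ℝ) ^ η * (1 + -(1 / ((N : ℝ) + 1))) ^ η := by
      rw [← Real.mul_rpow hpos.le]
      · congr 1
        field_simp
        ring
      · have : 1 / ((N : ℝ) + 1) ≤ 1 := by
          rw [div_le_one hpos]
          linarith [Nat.cast_nonneg (α := ℝ) N]
        linarith
    rw [h1, Real.rpow_sub_one hpos.ne']
    calc _ ≤ (N + 1 : ℝ) ^ η * (1 + η * -(1 / ((N : ℝ) + 1))) / η + (N + 1 : ℝ) ^ η / (N + 1) := by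
          gcongr
      _ = _ := by field_simp; ring

/-- With a partial sum of length about `t`, the sum, the boundary term and the remainder are all `≪
t^η`. Reaching slightly to the left of `Re s = 1` leaves room for Cauchy's estimate. -/
theorem exists_norm_riemannZeta_le {η : ℝ} (hη : 0 < η) (hη1 : η ≤ 1 / 2) :
    ∃ C : ℝ, 0 < C ∧ ∀ s : ℂ, 1 - η ≤ s.re → s.re ≤ 3 → 1 ≤ s.im →
      ‖riemannZeta s‖ ≤ C * s.im ^ η := by
  refine ⟨2 / η + 10, by positivity, fun s h1 h3 ht => ?_⟩
  set t := s.im with htdef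
  set σ := s.re with hσdef
  have ht0 : 0 < t := by linarith
  have hσ : 1 / 2 ≤ σ := by linarith
  have hs1 : s ≠ 1 := fun h => by
    have := congrArg Complex.im h
    rw [← htdef, Complex.one_im] at this
    linarith
  set N := ⌊t⌋₊ with hN
  have hNt : (N : ℝ) ≤ t := Nat.floor_le ht0.le
  have hNt1 : t < N + 1 := Nat.lt_floor_add_one t
  have hpos : (0 : ℝ) < N + 1 := by positivity
  have happ := norm_riemannZeta_sub_sum_le (by linarith : 0 < s.re) hs1 N
  rw [← hσdef] at happ
  have hpow : (N + 1 : ℝ) ^ η ≤ 2 * t ^ η := by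
    calc (N + 1 : ℝ) ^ η ≤ (2 * t) ^ η := by gcongr; linarith
      _ = 2 ^ η * t ^ η := Real.mul_rpow (by norm_num) ht0.le
      _ ≤ 2 ^ (1 : ℝ) * t ^ η := by
          gcongr
          · norm_num
          · linarith
      _ = 2 * t ^ η := by rw [Real.rpow_one]
  have hS : ‖∑ n ∈ Finset.range (N + 1), ((n + 1 : ℝ) : ℂ) ^ (-s)‖ ≤ 2 / η * t ^ η := by
    calc _ ≤ ∑ n ∈ Finset.range (N + 1), (n + 1 : ℝ) ^ (η - 1) := by
          refine (norm_sum_le _ _).trans (Finset.sum_le_sum fun n _ => ?_)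
          rw [Complex.norm_cpow_eq_rpow_re_of_pos (by positivity)]
          refine Real.rpow_le_rpow_of_exponent_le (by linarith [Nat.cast_nonneg (α := ℝ) n]) ?_
          rw [Complex.neg_re]
          linarith
      _ ≤ ((N + 1 : ℕ) : ℝ) ^ η / η := sum_range_rpow_neg_le hη (by linarith) _
      _ ≤ 2 * t ^ η / η := by
          push_cast
          gcongr
      _ = 2 / η * t ^ η := by ring
  have hB : ‖((N + 1 : ℝ) : ℂ) ^ (1 - s) / (s - 1)‖ ≤ 2 * t ^ η := by
    rw [norm_div, Complex.norm_cpow_eq_rpow_re_of_pos hpos]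
    have h5 : t ≤ ‖s - 1‖ := by
      have := Complex.abs_im_le_norm (s - 1)
      rwa [Complex.sub_im, ← htdef, Complex.one_im, sub_zero, abs_of_pos ht0] at this
    refine (div_le_self (by positivity) (by linarith)).trans (le_trans ?_ hpow)
    refine Real.rpow_le_rpow_of_exponent_le (by linarith) ?_
    rw [Complex.sub_re, Complex.one_re]
    linarith
  have hD : ‖s‖ / σ * (N + 1 : ℝ) ^ (-σ) ≤ 8 * t ^ η := by
    have h6 : ‖s‖ ≤ 4 * t := by
      refine (Complex.norm_le_abs_re_add_abs_im s).trans ?_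
      rw [← htdef, ← hσdef, abs_of_pos ht0, abs_of_pos (by linarith)]
      linarith
    have h7 : (N + 1 : ℝ) ^ (-σ) ≤ t ^ (η - 1) := by
      calc (N + 1 : ℝ) ^ (-σ) ≤ t ^ (-σ) :=
            Real.rpow_le_rpow_of_nonpos ht0 hNt1.le (by linarith)
        _ ≤ t ^ (η - 1) := Real.rpow_le_rpow_of_exponent_le ht (by linarith)
    calc ‖s‖ / σ * (N + 1 : ℝ) ^ (-σ) ≤ 4 * t / (1 / 2) * t ^ (η - 1) := by gcongr
      _ = 8 * t ^ η := by
          rw [Real.rpow_sub_one ht0.ne']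
          field_simp
          norm_num
  set S := ∑ n ∈ Finset.range (N + 1), ((n + 1 : ℝ) : ℂ) ^ (-s)
  set B := ((N + 1 : ℝ) : ℂ) ^ (1 - s) / (s - 1)
  have e : riemannZeta s = (riemannZeta s - S - B) + S + B := by ring
  rw [e]
  refine (norm_add_le _ _).trans ((add_le_add_left (norm_add_le _ _) _).trans ?_)
  have : (2 / η + 10) * t ^ η = 8 * t ^ η + 2 / η * t ^ η + 2 * t ^ η := by ring
  rw [this]
  exact add_le_add (add_le_add (happ.trans hD) hS) hB

/-- The 3-4-1 inequality for Dirichlet `L`-functions, specialized to the character of modulus one.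
-/
theorem one_le_norm_riemannZeta_prod {x : ℝ} (hx : 0 < x) (t : ℝ) :
    1 ≤ ‖riemannZeta (1 + x)‖ ^ 3 * ‖riemannZeta (1 + x + I * t)‖ ^ 4 *
      ‖riemannZeta (1 + x + I * (2 * t : ℝ))‖ := by
  have := DirichletCharacter.norm_LFunction_product_ge_one (N := 1)
    (1 : DirichletCharacter ℂ 1) hx t
  simp only [DirichletCharacter.LFunctionTrivChar, one_pow,
    DirichletCharacter.LFunction_modOne_eq, norm_mul, norm_pow] at this
  rw [show ((1 : ℂ) + x + I * (2 * t : ℝ)) = 1 + x + 2 * I * t by push_cast; ring]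
  exact this

theorem norm_riemannZeta_one_add_le {x : ℝ} (hx : 0 < x) (hx1 : x ≤ 1) :
    ‖riemannZeta (1 + x)‖ ≤ 3 / x := by
  have hre : ((1 : ℂ) + x).re = 1 + x := by simp
  have h := norm_riemannZeta_sub_sum_le (s := 1 + x) (by rw [hre]; linarith)
    (fun h => hx.ne' (by simpa using h)) 0
  rw [hre] at h
  simp only [zero_add, Finset.range_one, Finset.sum_singleton, Nat.cast_zero, ofReal_one, one_cpow,
    add_sub_cancel_left, Real.one_rpow, mul_one] at h
  have hn : ‖(1 + x : ℂ)‖ = 1 + x := by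
    rw [show (1 + x : ℂ) = ((1 + x : ℝ) : ℂ) by push_cast; rfl, Complex.norm_real,
      Real.norm_of_nonneg (by linarith)]
  rw [hn, div_self (by linarith)] at h
  have hx' : ‖(1 / x : ℂ)‖ = 1 / x := by
    rw [norm_div, norm_one, Complex.norm_real, Real.norm_of_nonneg hx.le]
  have e : riemannZeta (1 + x) = (riemannZeta (1 + x) - 1 - 1 / x) + 1 + 1 / x := by ring
  rw [e]
  refine (norm_add_le _ _).trans ((add_le_add_left (norm_add_le _ _) _).trans ?_)
  rw [hx', norm_one]
  have : 1 ≤ 1 / x := by rwa [one_le_div hx]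
  have h3 : 3 / x = 1 / x + 1 / x + 1 / x := by ring
  linarith

/-- The inverse of the zeta function on the line `Re s = 1` grows slower than any power. -/
theorem exists_inv_norm_riemannZeta_le {ε : ℝ} (hε : 0 < ε) :
    ∃ C : ℝ, 0 < C ∧ ∀ t : ℝ, 2 ≤ t → ‖riemannZeta (1 + I * t)‖⁻¹ ≤ C * t ^ ε := by
  set η : ℝ := min (ε / 4) (1 / 2) with hηdef
  have hη : 0 < η := lt_min (by linarith) (by norm_num)
  have hη2 : η ≤ 1 / 2 := min_le_right _ _
  have hηε : 4 * η ≤ ε := by linarith [min_le_left (ε / 4) (1 / 2 : ℝ)]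
  obtain ⟨C, hC, hb⟩ := exists_norm_riemannZeta_le hη hη2
  set D : ℝ := 2 * C / η with hD
  have hD0 : 0 < D := by positivity
  have hpow2 : ∀ t : ℝ, 0 < t → (2 * t) ^ η ≤ 2 * t ^ η := fun t ht0 => by
    rw [Real.mul_rpow (by norm_num) ht0.le]
    gcongr
    calc (2 : ℝ) ^ η ≤ 2 ^ (1 : ℝ) := by
          gcongr
          · norm_num
          · linarith
      _ = 2 := Real.rpow_one 2
  have hne1 : ∀ s : ℂ, 1 ≤ s.im → s ≠ 1 := fun s hs h => by
    rw [h, Complex.one_im] at hs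
    linarith
  -- Cauchy's estimate on a circle of radius `η`, where `ζ ≪ t^η`.
  have hderiv : ∀ t : ℝ, 2 ≤ t → ∀ σ : ℝ, 1 ≤ σ → σ ≤ 2 →
      ‖deriv riemannZeta (σ + I * t)‖ ≤ D * t ^ η := by
    intro t ht σ h1 h2
    have ht0 : 0 < t := by linarith
    have hmem : ∀ z ∈ Metric.closedBall (σ + I * t : ℂ) η, 1 - η ≤ z.re ∧ z.re ≤ 3 ∧ 1 ≤ z.im ∧
        z.im ≤ 2 * t := by
      intro z hz
      rw [mem_closedBall_iff_norm] at hz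
      have hre := abs_le.mp ((Complex.abs_re_le_norm _).trans hz)
      have him := abs_le.mp ((Complex.abs_im_le_norm _).trans hz)
      simp at hre him
      refine ⟨by linarith [hre.1], by linarith [hre.2], by linarith [him.1], by linarith [him.2]⟩
    have hd : DiffContOnCl ℂ riemannZeta (Metric.ball (σ + I * t : ℂ) η) := by
      refine DifferentiableOn.diffContOnCl_ball (U := {z : ℂ | 1 ≤ z.im}) ?_ fun z hz =>
        (hmem z hz).2.2.1
      exact fun z hz => (differentiableAt_riemannZeta (hne1 z hz)).differentiableWithinAt
    refine (Complex.norm_deriv_le_of_forall_mem_sphere_norm_le (C := C * (2 * t ^ η)) hη hd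
      fun z hz => ?_).trans (le_of_eq ?_)
    · obtain ⟨a, b, c, d⟩ := hmem z (Metric.sphere_subset_closedBall hz)
      refine (hb z a b c).trans ?_
      gcongr
      exact (Real.rpow_le_rpow (by linarith) d hη.le).trans (hpow2 t ht0)
    · rw [hD]
      ring
  -- Chosen so that `x = κ / T⁵` contradicts the 3-4-1 inequality below; `864 = 54 · 2⁴`.
  set κ : ℝ := min 1 (1 / (864 * C * D ^ 4)) with hκ
  have hκ0 : 0 < κ := lt_min one_pos (by positivity)
  refine ⟨1 / (D * κ), by positivity, fun t ht => ?_⟩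
  have ht0 : 0 < t := by linarith
  have ht1 : 1 ≤ t := by linarith
  set T : ℝ := t ^ η with hT
  have hT1 : 1 ≤ T := Real.one_le_rpow ht1 hη.le
  have hT0 : 0 < T := by linarith
  set x : ℝ := κ / T ^ 5 with hx
  have hx0 : 0 < x := by positivity
  have hx1 : x ≤ 1 := by
    rw [hx, div_le_one (by positivity)]
    exact (min_le_left _ _).trans (one_le_pow₀ hT1)
  have hdiff : ‖riemannZeta (1 + x + I * t) - riemannZeta (1 + I * t)‖ ≤ D * T * x := by
    have hder : ∀ σ ∈ Icc (1 : ℝ) (1 + x), HasDerivWithinAt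
        (fun σ : ℝ => riemannZeta (σ + I * t)) (deriv riemannZeta (σ + I * t)) (Icc (1 : ℝ) (1 + x)) σ := by
      intro σ _
      have h1 : HasDerivAt (fun z : ℂ => riemannZeta (z + I * t))
          (deriv riemannZeta (σ + I * t)) (σ : ℂ) :=
        ((differentiableAt_riemannZeta (hne1 _ (by simp [ht1]))).hasDerivAt).comp_add_const _ _
      exact h1.comp_ofReal.hasDerivWithinAt
    have := norm_image_sub_le_of_norm_deriv_le_segment' hder (C := D * T)
      (fun σ hσ => hderiv t ht σ hσ.1 (by linarith [hσ.2])) (1 + x) ⟨by linarith, le_rfl⟩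
    rw [add_sub_cancel_left] at this
    push_cast at this
    exact this
  set A := ‖riemannZeta (1 + x + I * t)‖ with hA
  have hprod := one_le_norm_riemannZeta_prod hx0 t
  have hz1 := norm_riemannZeta_one_add_le hx0 hx1
  have hz2 : ‖riemannZeta (1 + x + I * (2 * t : ℝ))‖ ≤ 2 * C * T := by
    have := hb (1 + x + I * (2 * t : ℝ)) (by simp; linarith) (by simp; linarith)
      (by simp; linarith)
    refine this.trans ?_
    have him : ((1 : ℂ) + x + I * (2 * t : ℝ)).im = 2 * t := by simp
    rw [him, hT]
    have := hpow2 t ht0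
    nlinarith
  have hA0 : 0 ≤ A := norm_nonneg _
  have hfour : x ^ 3 ≤ 54 * C * T * A ^ 4 := by
    have h1 : 1 ≤ (3 / x) ^ 3 * A ^ 4 * (2 * C * T) := by
      refine hprod.trans ?_
      gcongr
    rw [div_pow] at h1
    have h2 : x ^ 3 * 1 ≤ x ^ 3 * (3 ^ 3 / x ^ 3 * A ^ 4 * (2 * C * T)) := by gcongr
    calc x ^ 3 = x ^ 3 * 1 := by ring
      _ ≤ _ := h2
      _ = _ := by field_simp; ring
  -- Otherwise `hfour` would force `1 < 864 C D⁴ x T⁵`. So `|ζ(1+x+it)|` is at least twice the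
  -- possible change `DTx` between `1 + x + it` and `1 + it`, and `DTx`, of order `T^{-4} =
  -- t^{-4η}`, survives on the line.
  have hAlow : 2 * (D * T * x) ≤ A := by
    by_contra! h
    have h4 : A ^ 4 < (2 * (D * T * x)) ^ 4 := by gcongr
    have h5 : x ^ 3 < 54 * C * T * (2 * (D * T * x)) ^ 4 := by
      refine hfour.trans_lt ?_
      gcongr
    have h6 : x * T ^ 5 ≤ 1 / (864 * C * D ^ 4) := by
      rw [hx, div_mul_cancel₀ _ (by positivity)]
      exact min_le_right _ _
    have h7 : 864 * C * D ^ 4 * (x * T ^ 5) ≤ 1 := by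
      rwa [le_div_iff₀ (by positivity), mul_comm] at h6
    have h8 : 54 * C * T * (2 * (D * T * x)) ^ 4 = x ^ 3 * (864 * C * D ^ 4 * (x * T ^ 5)) := by ring
    rw [h8] at h5
    have h9 : 0 < x ^ 3 := by positivity
    nlinarith
  have hlow : D * κ / T ^ 4 ≤ ‖riemannZeta (1 + I * t)‖ := by
    have h1 : A ≤ ‖riemannZeta (1 + x + I * t) - riemannZeta (1 + I * t)‖ +
        ‖riemannZeta (1 + I * t)‖ := by
      have := norm_add_le (riemannZeta (1 + x + I * t) - riemannZeta (1 + I * t))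
        (riemannZeta (1 + I * t))
      rwa [sub_add_cancel] at this
    have h2 : D * κ / T ^ 4 = D * T * x := by
      rw [hx]
      field_simp
    linarith
  have hTpow : T ^ 4 ≤ t ^ ε := by
    rw [hT, ← Real.rpow_natCast, ← Real.rpow_mul ht0.le]
    exact Real.rpow_le_rpow_of_exponent_le ht1 (by push_cast; linarith)
  calc ‖riemannZeta (1 + I * t)‖⁻¹ ≤ (D * κ / T ^ 4)⁻¹ := by gcongr
    _ = 1 / (D * κ) * T ^ 4 := by field_simp
    _ ≤ 1 / (D * κ) * t ^ ε := by gcongr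

end GeodesicEisenstein

/-! ### Bounds for the Gamma function -/

namespace GeodesicEisenstein

/-- On the line `Re s = 1/2` one has `1 - s = s̄`, so the reflection formula computes the modulus
exactly. -/
theorem norm_Gamma_half_sq (v : ℝ) :
    ‖Complex.Gamma (1 / 2 + I * v)‖ ^ 2 = Real.pi / Real.cosh (Real.pi * v) := by
  have h := Complex.Gamma_mul_Gamma_one_sub (1 / 2 + I * v)
  have hc : (1 : ℂ) - (1 / 2 + I * v) = (starRingEnd ℂ) (1 / 2 + I * v) := by
    apply Complex.ext <;> simp
    norm_num
  rw [hc, Complex.Gamma_conj, Complex.mul_conj', show (Real.pi : ℂ) * (1 / 2 + I * v) =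
    Real.pi / 2 + (Real.pi * v : ℂ) * I by ring, add_comm (Real.pi / 2 : ℂ), Complex.sin_add_pi_div_two,
    Complex.cos_mul_I] at h
  exact_mod_cast h

theorem exp_abs_le_two_mul_cosh (x : ℝ) : Real.exp |x| ≤ 2 * Real.cosh x := by
  rw [← Real.cosh_abs x, Real.cosh_eq]
  have := Real.exp_pos (-|x|)
  linarith

theorem norm_Gamma_half_le (v : ℝ) :
    ‖Complex.Gamma (1 / 2 + I * v)‖ ≤ 3 * Real.exp (-(Real.pi * |v| / 2)) := by
  refine (pow_le_pow_iff_left₀ (norm_nonneg _) (by positivity) two_ne_zero).mp ?_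
  rw [norm_Gamma_half_sq, mul_pow, ← Real.exp_nat_mul]
  have h1 := exp_abs_le_two_mul_cosh (Real.pi * v)
  rw [abs_mul, abs_of_pos Real.pi_pos] at h1
  have h2 : ((2 : ℕ) : ℝ) * -(Real.pi * |v| / 2) = -(Real.pi * |v|) := by push_cast; ring
  rw [h2, Real.exp_neg, div_le_iff₀ (Real.cosh_pos _), ← div_eq_mul_inv, div_mul_eq_mul_div,
    le_div_iff₀ (Real.exp_pos _)]
  have h3 := Real.pi_lt_d2
  have h4 := Real.cosh_pos (Real.pi * v)
  nlinarith [Real.pi_pos, Real.exp_pos (Real.pi * |v|)]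

theorem norm_Gamma_le_of_re_pos {s : ℂ} (hs : 0 < s.re) :
    ‖Complex.Gamma s‖ ≤ Real.Gamma s.re := by
  rw [Complex.Gamma_eq_integral hs, Real.Gamma_eq_integral hs, Complex.GammaIntegral]
  refine (norm_integral_le_integral_norm _).trans (le_of_eq ?_)
  refine setIntegral_congr_fun measurableSet_Ioi fun x hx => ?_
  rw [norm_mul, Complex.norm_real, Real.norm_of_nonneg (Real.exp_pos _).le,
    Complex.norm_cpow_eq_rpow_re_of_pos hx]
  simp

/-- The function to which the three lines theorem is applied. -/
noncomputable def gammaStrip (v : ℝ) (s : ℂ) : ℂ :=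
  Complex.Gamma s * Complex.exp (-(I * Real.pi / 2) * s + (s - I * v) ^ 2)

/-- The linear exponent compensates the decay `e^{-π Im s / 2}` of Gamma; the Gaussian centred at
height `v` localizes there and is harmless at `Im s = v`. -/
theorem norm_gammaStrip (v : ℝ) (s : ℂ) : ‖gammaStrip v s‖ =
    ‖Complex.Gamma s‖ * Real.exp (Real.pi * s.im / 2 + (s.re ^ 2 - (s.im - v) ^ 2)) := by
  rw [gammaStrip, norm_mul, Complex.norm_exp]
  congr 2
  simp [pow_two]
  ring

theorem mul_exp_neg_sq_le (y : ℝ) : |y| * Real.exp (-y ^ 2) ≤ 1 := by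
  rw [Real.exp_neg, ← div_eq_mul_inv, div_le_one (Real.exp_pos _)]
  have := Real.add_one_le_exp (y ^ 2)
  nlinarith [sq_abs y, sq_nonneg (|y| - 1)]

-- Three lines between `Re s = 1/2`, where `gammaStrip` is bounded, and `Re s = 3/2`, where it is
-- `O(v)`: the weights `1/4` and `3/4` give Stirling's exponent. The abscissa `5/4` is used instead
-- of `1/4` so that the strip avoids the poles of Gamma.
open Complex.HadamardThreeLines in
theorem exists_norm_Gamma_five_quarters_le :
    ∃ C : ℝ, 0 < C ∧ ∀ v : ℝ, 1 ≤ v →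
      ‖Complex.Gamma (5 / 4 + I * v)‖ ≤ C * v ^ (3 / 4 : ℝ) * Real.exp (-(Real.pi * v / 2)) := by
  set a : ℝ := 3 * Real.exp (1 / 4) with ha
  set b : ℝ := 9 * Real.exp (9 / 4) with hb
  refine ⟨a ^ (1 / 4 : ℝ) * b ^ (3 / 4 : ℝ), by positivity, fun v hv => ?_⟩
  have hv0 : 0 < v := by linarith
  have hmem : (5 / 4 + I * v : ℂ) ∈ verticalClosedStrip (1 / 2) (3 / 2) := by
    simp only [verticalClosedStrip, mem_preimage, mem_Icc]
    constructor <;> norm_num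
  have hstrip_re : ∀ z ∈ verticalClosedStrip (1 / 2) (3 / 2), 1 / 2 ≤ z.re ∧ z.re ≤ 3 / 2 :=
    fun z hz => hz
  have hdiffΓ : ∀ z : ℂ, 0 < z.re → DifferentiableAt ℂ Complex.Gamma z := fun z hz =>
    Complex.differentiableAt_Gamma _ fun m h => by
      rw [h] at hz
      simp only [neg_re, natCast_re, Left.neg_pos_iff] at hz
      exact absurd hz (not_lt.mpr (Nat.cast_nonneg m))
  have hdiff : ∀ z : ℂ, 0 < z.re → DifferentiableAt ℂ (gammaStrip v) z := fun z hz => by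
    unfold gammaStrip
    have := hdiffΓ z hz
    fun_prop
  have hd : DiffContOnCl ℂ (gammaStrip v) (verticalStrip (1 / 2) (3 / 2)) := by
    refine DifferentiableOn.diffContOnCl fun z hz => ?_
    have hcl : closure (verticalStrip (1 / 2) (3 / 2)) ⊆ verticalClosedStrip (1 / 2) (3 / 2) := by
      refine closure_minimal ?_ (isClosed_Icc.preimage Complex.continuous_re)
      exact preimage_mono Ioo_subset_Icc_self
    exact (hdiff z (by linarith [(hstrip_re z (hcl hz)).1])).differentiableWithinAt
  have hbdd : BddAbove ((norm ∘ gammaStrip v) '' verticalClosedStrip (1 / 2) (3 / 2)) := by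
    obtain ⟨G, hG⟩ := (isCompact_Icc (a := (1 / 2 : ℝ)) (b := 3 / 2)).bddAbove_image
      (f := Real.Gamma) (fun x hx => by
        refine (Real.differentiableAt_Gamma fun m h => ?_).continuousAt.continuousWithinAt
        have h1 := hx.1
        rw [h] at h1
        linarith [Nat.cast_nonneg (α := ℝ) m])
    refine ⟨G * Real.exp (Real.pi * v / 2 + Real.pi ^ 2 + 9 / 4), ?_⟩
    rintro _ ⟨z, hz, rfl⟩
    obtain ⟨h1, h2⟩ := hstrip_re z hz
    have hΓ : ‖Complex.Gamma z‖ ≤ G := (norm_Gamma_le_of_re_pos (by linarith)).trans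
      (hG ⟨z.re, ⟨h1, h2⟩, rfl⟩)
    rw [Function.comp_apply, norm_gammaStrip]
    have hG0 : 0 ≤ G := (norm_nonneg _).trans hΓ
    refine mul_le_mul hΓ (Real.exp_le_exp.mpr ?_) (Real.exp_pos _).le hG0
    nlinarith [sq_nonneg (z.im - v - Real.pi), sq_nonneg (z.im - v), Real.pi_pos, sq_nonneg Real.pi]
  have hA : ∀ z ∈ re ⁻¹' {(1 / 2 : ℝ)}, ‖gammaStrip v z‖ ≤ a := by
    intro z hz
    have hz' : z.re = 1 / 2 := hz
    have hzeq : z = 1 / 2 + I * z.im := by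
      apply Complex.ext <;> simp [hz']
    have hΓ := norm_Gamma_half_le z.im
    rw [← hzeq] at hΓ
    rw [norm_gammaStrip, hz']
    calc _ ≤ 3 * Real.exp (-(Real.pi * |z.im| / 2)) *
          Real.exp (Real.pi * z.im / 2 + ((1 / 2) ^ 2 - (z.im - v) ^ 2)) := by gcongr
      _ = 3 * Real.exp (-(Real.pi * |z.im| / 2) +
          (Real.pi * z.im / 2 + ((1 / 2) ^ 2 - (z.im - v) ^ 2))) := by
          rw [mul_assoc, ← Real.exp_add]
      _ ≤ a := by
          rw [ha]
          gcongr
          nlinarith [le_abs_self z.im, Real.pi_pos, sq_nonneg (z.im - v)]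
  have hB : ∀ z ∈ re ⁻¹' {(3 / 2 : ℝ)}, ‖gammaStrip v z‖ ≤ b * v := by
    intro z hz
    have hz' : z.re = 3 / 2 := hz
    have hzeq : z = (1 / 2 + I * z.im) + 1 := by
      apply Complex.ext
      · simp [hz']
        norm_num
      · simp
    have hne : (1 / 2 + I * z.im : ℂ) ≠ 0 := fun h => by
      have := congrArg Complex.re h
      simp at this
    have hn : ‖(1 / 2 + I * z.im : ℂ)‖ ≤ 1 / 2 + |z.im| := by
      refine (norm_add_le _ _).trans ?_
      simp
    have hΓ : ‖Complex.Gamma z‖ ≤ (1 / 2 + |z.im|) * (3 * Real.exp (-(Real.pi * |z.im| / 2))) := by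
      rw [hzeq, Complex.Gamma_add_one _ hne, norm_mul]
      have := norm_Gamma_half_le z.im
      simp only [add_im, one_im, add_zero] at *
      convert! mul_le_mul hn this (norm_nonneg _) (by positivity) using 3 <;> simp
    rw [norm_gammaStrip, hz']
    have hexp : Real.exp (-(Real.pi * |z.im| / 2)) *
        Real.exp (Real.pi * z.im / 2 + ((3 / 2) ^ 2 - (z.im - v) ^ 2)) ≤
        Real.exp (9 / 4) * Real.exp (-(z.im - v) ^ 2) := by
      rw [← Real.exp_add, ← Real.exp_add]
      refine Real.exp_le_exp.mpr ?_
      nlinarith [le_abs_self z.im, Real.pi_pos]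
    have htri : |z.im| ≤ v + |z.im - v| := by
      have := abs_add_le v (z.im - v)
      rwa [add_sub_cancel, abs_of_pos hv0] at this
    have hg := mul_exp_neg_sq_le (z.im - v)
    have hg1 : Real.exp (-(z.im - v) ^ 2) ≤ 1 := by
      rw [Real.exp_le_one_iff]
      nlinarith [sq_nonneg (z.im - v)]
    have hg0 := Real.exp_pos (-(z.im - v) ^ 2)
    calc _ ≤ (1 / 2 + |z.im|) * (3 * Real.exp (-(Real.pi * |z.im| / 2))) *
          Real.exp (Real.pi * z.im / 2 + ((3 / 2) ^ 2 - (z.im - v) ^ 2)) := by gcongr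
      _ = 3 * (1 / 2 + |z.im|) * (Real.exp (-(Real.pi * |z.im| / 2)) *
          Real.exp (Real.pi * z.im / 2 + ((3 / 2) ^ 2 - (z.im - v) ^ 2))) := by ring
      _ ≤ 3 * (1 / 2 + (v + |z.im - v|)) * (Real.exp (9 / 4) * Real.exp (-(z.im - v) ^ 2)) := by
          gcongr
      _ = 3 * Real.exp (9 / 4) * ((1 / 2 + v) * Real.exp (-(z.im - v) ^ 2) +
          |z.im - v| * Real.exp (-(z.im - v) ^ 2)) := by ring
      _ ≤ 3 * Real.exp (9 / 4) * (3 * v) := by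
          gcongr
          nlinarith
      _ = b * v := by
          rw [hb]
          ring
  have hthree := norm_le_interp_of_mem_verticalClosedStrip' (by norm_num : (1 / 2 : ℝ) < 3 / 2)
    hmem hd hbdd hA hB
  have hre : (5 / 4 + I * v : ℂ).re = 5 / 4 := by simp
  have him : (5 / 4 + I * v : ℂ).im = v := by simp
  rw [norm_gammaStrip, hre, him, show (1 : ℝ) - (5 / 4 - 1 / 2) / (3 / 2 - 1 / 2) = 1 / 4 by norm_num,
    show ((5 : ℝ) / 4 - 1 / 2) / (3 / 2 - 1 / 2) = 3 / 4 by norm_num,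
    Real.mul_rpow (by positivity) hv0.le, sub_self] at hthree
  have hlow : Real.exp (Real.pi * v / 2) ≤
      Real.exp (Real.pi * v / 2 + ((5 / 4 : ℝ) ^ 2 - 0 ^ 2)) := by
    gcongr
    norm_num
  rw [Real.exp_neg, ← div_eq_mul_inv, le_div_iff₀ (Real.exp_pos _)]
  calc _ ≤ _ := mul_le_mul_of_nonneg_left hlow (norm_nonneg _)
    _ ≤ _ := hthree
    _ = _ := by ring

/-- One step of the recursion `Γ(s+1) = s Γ(s)` from `5/4`, dividing by `|s| ≥ v`. -/
theorem exists_norm_Gamma_quarter_le :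
    ∃ C : ℝ, 0 < C ∧ ∀ v : ℝ, 1 ≤ v →
      ‖Complex.Gamma (1 / 4 + I * v)‖ ≤
        C * v ^ (-(1 / 4) : ℝ) * Real.exp (-(Real.pi * v / 2)) := by
  obtain ⟨C, hC, h⟩ := exists_norm_Gamma_five_quarters_le
  refine ⟨C, hC, fun v hv => ?_⟩
  have hv0 : 0 < v := by linarith
  have hne : (1 / 4 + I * v : ℂ) ≠ 0 := fun h => by
    have := congrArg Complex.re h
    simp at this
  have hrec := Complex.Gamma_add_one _ hne
  rw [show (1 / 4 + I * v + 1 : ℂ) = 5 / 4 + I * v by ring] at hrec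
  have hv' := h v hv
  rw [hrec, norm_mul] at hv'
  have hlow : v ≤ ‖(1 / 4 + I * v : ℂ)‖ := by
    have := Complex.abs_im_le_norm (1 / 4 + I * v : ℂ)
    have him : (1 / 4 + I * v : ℂ).im = v := by simp
    rwa [him, abs_of_pos hv0] at this
  have h2 := (mul_le_mul_of_nonneg_right hlow (norm_nonneg (Complex.Gamma (1 / 4 + I * v)))).trans hv'
  have h3 : v ^ (3 / 4 : ℝ) = v * v ^ (-(1 / 4) : ℝ) := by
    rw [← Real.rpow_one_add' hv0.le (by norm_num)]
    norm_num
  rw [h3] at h2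
  refine le_of_mul_le_mul_left (h2.trans (le_of_eq ?_)) hv0
  ring

end GeodesicEisenstein

/-! ### The completed zeta function on the critical line -/

namespace GeodesicEisenstein

/-- The completed zeta function on the critical line. -/
noncomputable def critXi (u : ℝ) : ℂ := completedRiemannZeta (1 / 2 + I * u)

theorem completedRiemannZeta_eq_Gammaℝ_mul {s : ℂ} (hs : 0 < s.re) :
    completedRiemannZeta s = Gammaℝ s * riemannZeta s := by
  have hs0 : s ≠ 0 := fun h => by simp [h] at hs
  rw [riemannZeta_def_of_ne_zero hs0, mul_div_cancel₀ _ (Gammaℝ_ne_zero_of_re_pos hs)]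

theorem completedRiemannZeta_conj {s : ℂ} (hs : 0 < s.re) :
    completedRiemannZeta ((starRingEnd ℂ) s) = (starRingEnd ℂ) (completedRiemannZeta s) := by
  rw [completedRiemannZeta_eq_Gammaℝ_mul hs, completedRiemannZeta_eq_Gammaℝ_mul (by simpa using hs),
    map_mul, riemannZeta_conj, Gammaℝ_def, Gammaℝ_def, map_mul, ← Complex.Gamma_conj]
  have h : (Real.pi : ℂ).arg ≠ Real.pi := by
    rw [Complex.arg_ofReal_of_nonneg Real.pi_pos.le]
    exact Real.pi_pos.ne
  have hc := Complex.cpow_conj (Real.pi : ℂ) (-s / 2) h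
  rw [Complex.conj_ofReal] at hc
  rw [← hc]
  simp only [map_div₀, map_neg, Complex.conj_ofNat]

theorem critXi_neg (u : ℝ) : critXi (-u) = critXi u := by
  rw [critXi, critXi, ← completedRiemannZeta_one_sub]
  congr 1
  push_cast
  ring

/-- On the critical line conjugation is `u ↦ -u`, which the functional equation undoes. -/
theorem conj_critXi (u : ℝ) : (starRingEnd ℂ) (critXi u) = critXi u := by
  conv_rhs => rw [← critXi_neg u]
  unfold critXi
  rw [← completedRiemannZeta_conj (by simp)]
  congr 1
  apply Complex.ext <;> simp

theorem continuous_critXi : Continuous critXi := by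
  refine continuous_iff_continuousAt.mpr fun u => ?_
  refine ContinuousAt.comp (f := fun u : ℝ => (1 / 2 + I * u : ℂ)) ?_ (by fun_prop)
  refine (differentiableAt_completedZeta (fun h => ?_) fun h => ?_).continuousAt
  · have := congrArg Complex.re h
    simp at this
  · have := congrArg Complex.re h
    norm_num at this

/-- The convexity-breaking bound for the completed zeta function on the critical line. -/
theorem exists_norm_critXi_le {a : ℝ} (ha0 : 0 ≤ a) (ha : a < 1 / 12) :
    ∃ C : ℝ, 0 < C ∧ ∀ u : ℝ,
      ‖critXi u‖ ≤ C * (1 + |u|) ^ (-a) * Real.exp (-(Real.pi * |u| / 4)) := by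
  -- The loss `1/12 - a` is tuned to the target: Gamma and zeta contribute `-1/4 + 1/6 + (1/12 - a)
  -- = -a`.
  obtain ⟨C₁, hC₁, hz⟩ := exists_norm_riemannZeta_half_le (by linarith : 0 < 1 / 12 - a)
  obtain ⟨C₂, hC₂, hΓ⟩ := exists_norm_Gamma_quarter_le
  set F : ℝ → ℝ := fun u => ‖critXi u‖ * (1 + |u|) ^ a * Real.exp (Real.pi * |u| / 4) with hF
  have hcont : Continuous F := by
    have h1 : Continuous fun u : ℝ => (1 + |u|) ^ a :=
      Continuous.rpow_const (by fun_prop) fun u => Or.inr ha0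
    have h2 := continuous_critXi
    fun_prop
  obtain ⟨B, hB⟩ := (isCompact_Icc (a := (-2 : ℝ)) (b := 2)).bddAbove_image hcont.continuousOn
  have hlarge : ∀ u : ℝ, 2 ≤ u → F u ≤ 4 * C₁ * C₂ := by
    intro u hu
    have hu0 : 0 < u := by linarith
    have hz' := hz u (by linarith)
    have hΓ' := hΓ (u / 2) (by linarith)
    have hXi : ‖critXi u‖ ≤ C₂ * (u / 2) ^ (-(1 / 4) : ℝ) * Real.exp (-(Real.pi * (u / 2) / 2)) *
        (C₁ * u ^ (1 / 6 + (1 / 12 - a))) := by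
      rw [critXi, completedRiemannZeta_eq_Gammaℝ_mul (by simp), norm_mul, Gammaℝ_def, norm_mul,
        Complex.norm_cpow_eq_rpow_re_of_pos Real.pi_pos,
        show ((1 / 2 + I * u) / 2 : ℂ) = 1 / 4 + I * (u / 2 : ℝ) by push_cast; ring]
      have hpi : Real.pi ^ (-(1 / 2 + I * u) / 2 : ℂ).re ≤ 1 := by
        refine Real.rpow_le_one_of_one_le_of_nonpos (by linarith [Real.pi_gt_three]) ?_
        simp
        norm_num
      calc _ ≤ 1 * (C₂ * (u / 2) ^ (-(1 / 4) : ℝ) * Real.exp (-(Real.pi * (u / 2) / 2))) *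
            (C₁ * u ^ (1 / 6 + (1 / 12 - a))) := by gcongr
        _ = _ := by ring
    have h1 : (u / 2) ^ (-(1 / 4) : ℝ) ≤ 2 * u ^ (-(1 / 4) : ℝ) := by
      rw [Real.div_rpow hu0.le (by norm_num), Real.rpow_neg zero_le_two, div_inv_eq_mul, mul_comm]
      gcongr
      calc (2 : ℝ) ^ (1 / 4 : ℝ) ≤ 2 ^ (1 : ℝ) := by gcongr <;> norm_num
        _ = 2 := Real.rpow_one 2
    have h2 : (1 + |u|) ^ a ≤ 2 * u ^ a := by
      rw [abs_of_pos hu0]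
      calc (1 + u) ^ a ≤ (2 * u) ^ a := by gcongr; linarith
        _ = 2 ^ a * u ^ a := Real.mul_rpow (by norm_num) hu0.le
        _ ≤ 2 ^ (1 : ℝ) * u ^ a := by
            gcongr
            · norm_num
            · linarith
        _ = 2 * u ^ a := by rw [Real.rpow_one]
    have h3 : u ^ (-(1 / 4) : ℝ) * (u ^ (1 / 6 + (1 / 12 - a)) * u ^ a) = 1 := by
      rw [← Real.rpow_add hu0, ← Real.rpow_add hu0,
        show (-(1 / 4) + (1 / 6 + (1 / 12 - a) + a) : ℝ) = 0 by ring, Real.rpow_zero]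
    have h4 : Real.exp (-(Real.pi * (u / 2) / 2)) * Real.exp (Real.pi * |u| / 4) = 1 := by
      rw [← Real.exp_add, abs_of_pos hu0]
      ring_nf
      simp
    calc F u ≤ (C₂ * (2 * u ^ (-(1 / 4) : ℝ)) * Real.exp (-(Real.pi * (u / 2) / 2)) *
          (C₁ * u ^ (1 / 6 + (1 / 12 - a)))) * (2 * u ^ a) * Real.exp (Real.pi * |u| / 4) := by
          simp only [hF]
          gcongr
          exact hXi.trans (by gcongr)
      _ = 4 * C₁ * C₂ * (u ^ (-(1 / 4) : ℝ) * (u ^ (1 / 6 + (1 / 12 - a)) * u ^ a)) *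
          (Real.exp (-(Real.pi * (u / 2) / 2)) * Real.exp (Real.pi * |u| / 4)) := by ring
      _ = 4 * C₁ * C₂ := by rw [h3, h4, mul_one, mul_one]
  have hFneg : ∀ u, F (-u) = F u := fun u => by simp only [hF, critXi_neg, abs_neg]
  have hall : ∀ u, F u ≤ max B (4 * C₁ * C₂) := by
    intro u
    rcases le_or_gt 2 u with h | h
    · exact (hlarge u h).trans (le_max_right _ _)
    rcases le_or_gt 2 (-u) with h' | h'
    · rw [← hFneg]
      exact (hlarge _ h').trans (le_max_right _ _)
    · exact (hB ⟨u, ⟨by linarith, h.le⟩, rfl⟩).trans (le_max_left _ _)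
  refine ⟨max B (4 * C₁ * C₂), lt_max_of_lt_right (by positivity), fun u => ?_⟩
  have hpos : 0 < (1 + |u|) ^ a := by positivity
  have hexp := Real.exp_pos (Real.pi * |u| / 4)
  have := hall u
  simp only [hF] at this
  rw [Real.rpow_neg (by positivity), Real.exp_neg, ← div_eq_mul_inv, ← div_eq_mul_inv,
    le_div_iff₀ hexp, le_div_iff₀ hpos]
  calc _ = _ := by ring
    _ ≤ _ := this

theorem theta_eq_completedRiemannZeta {s : ℂ} (hs : 0 < s.re) :
    theta s = completedRiemannZeta (2 * s) := by
  rw [completedRiemannZeta_eq_Gammaℝ_mul (by simpa using hs), theta, Gammaℝ_def,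
    show -(2 * s) / 2 = -s by ring, show 2 * s / 2 = s by ring]

/-- The Gamma factor sits on `Re s = 1/2`, where its modulus is known exactly; `√π` cancels against
`π^{-1/2}`. -/
theorem norm_theta (T : ℝ) : ‖theta (1 / 2 + I * T)‖ =
    ‖riemannZeta (1 + I * (2 * T : ℝ))‖ / Real.sqrt (Real.cosh (Real.pi * T)) := by
  have h1 : ‖Complex.Gamma (1 / 2 + I * T)‖ =
      Real.sqrt Real.pi / Real.sqrt (Real.cosh (Real.pi * T)) := by
    rw [← Real.sqrt_div Real.pi_pos.le, ← norm_Gamma_half_sq, Real.sqrt_sq (norm_nonneg _)]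
  have h2 : ‖(Real.pi : ℂ) ^ (-(1 / 2 + I * T) : ℂ)‖ = (Real.sqrt Real.pi)⁻¹ := by
    rw [Complex.norm_cpow_eq_rpow_re_of_pos Real.pi_pos, Real.sqrt_eq_rpow,
      ← Real.rpow_neg Real.pi_pos.le]
    simp
  rw [theta, norm_mul, norm_mul, h1, h2,
    show (2 * (1 / 2 + I * T) : ℂ) = 1 + I * (2 * T : ℝ) by push_cast; ring]
  have : Real.sqrt Real.pi ≠ 0 := (Real.sqrt_pos.mpr Real.pi_pos).ne'
  field_simp

theorem theta_ne_zero (T : ℝ) : theta (1 / 2 + I * T) ≠ 0 := by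
  rw [← norm_ne_zero_iff, norm_theta]
  refine div_ne_zero (norm_ne_zero_iff.mpr (riemannZeta_ne_zero_of_one_le_re (by simp)))
    (Real.sqrt_pos.mpr (Real.cosh_pos _)).ne'

theorem exists_inv_norm_theta_le {ε : ℝ} (hε : 0 < ε) : ∃ C : ℝ, 0 < C ∧ ∀ T : ℝ, 1 ≤ T →
    ‖theta (1 / 2 + I * T)‖⁻¹ ≤ C * T ^ ε * Real.exp (Real.pi * T / 2) := by
  obtain ⟨C, hC, h⟩ := exists_inv_norm_riemannZeta_le hε
  refine ⟨C * 2 ^ ε, by positivity, fun T hT => ?_⟩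
  have hcosh : Real.sqrt (Real.cosh (Real.pi * T)) ≤ Real.exp (Real.pi * T / 2) := by
    rw [Real.sqrt_le_left (Real.exp_pos _).le, ← Real.exp_nat_mul, Real.cosh_eq]
    have h1 : Real.exp (-(Real.pi * T)) ≤ Real.exp (Real.pi * T) := by
      gcongr
      have := Real.pi_pos
      nlinarith
    have h2 : ((2 : ℕ) : ℝ) * (Real.pi * T / 2) = Real.pi * T := by push_cast; ring
    rw [h2]
    linarith
  rw [norm_theta, inv_div, div_eq_mul_inv, mul_comm]
  have := h (2 * T) (by linarith)
  rw [Real.mul_rpow (by norm_num) (by linarith)] at this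
  calc _ ≤ C * (2 ^ ε * T ^ ε) * Real.exp (Real.pi * T / 2) := by gcongr
    _ = _ := by ring

/-! ### Decay of the Mellin transform of a test function -/

/-- With `y = e^{-u}` the Mellin transform on a vertical line becomes the Fourier transform of a
smooth compactly supported, hence Schwartz, function. -/
theorem exists_norm_mellin_le {ψ : ℝ → ℂ} (hψ : ContDiff ℝ ∞ ψ) (hψc : HasCompactSupport ψ)
    (hψ0 : tsupport ψ ⊆ Ioi (0 : ℝ)) (α : ℝ) :
    ∃ D : ℝ, 0 < D ∧ ∀ r : ℝ, ‖mellin ψ (α + I * r)‖ ≤ D * ((1 + r ^ 2) ^ 2)⁻¹ := by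
  set g : ℝ → ℂ := fun u => Real.exp (-α * u) • ψ (Real.exp (-u)) with hg
  have hgsmooth : ContDiff ℝ ∞ g := by
    have h1 : ContDiff ℝ ∞ fun u : ℝ => Real.exp (-α * u) :=
      Real.contDiff_exp.comp (contDiff_const.mul contDiff_id)
    have h2 : ContDiff ℝ ∞ fun u : ℝ => ψ (Real.exp (-u)) :=
      hψ.comp (Real.contDiff_exp.comp contDiff_neg)
    exact h1.smul h2
  have hgc : HasCompactSupport g := by
    have hK : IsCompact (Real.log '' tsupport ψ) :=
      hψc.isCompact.image_of_continuousOn (Real.continuousOn_log.mono fun x hx =>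
        (show (0 : ℝ) < x from hψ0 hx).ne')
    refine HasCompactSupport.intro (hK.image continuous_neg) fun u hu => ?_
    by_contra hne
    refine hu ⟨-u, ⟨Real.exp (-u), subset_tsupport _ ?_, Real.log_exp _⟩, neg_neg u⟩
    exact fun h => hne (by simp [hg, h])
  set G : SchwartzMap ℝ ℂ := hgc.toSchwartzMap hgsmooth with hG
  obtain ⟨C, hC, hdec⟩ := (FourierTransform.fourier G : SchwartzMap ℝ ℂ).decay 4 0
  obtain ⟨C', hC', hdec'⟩ := (FourierTransform.fourier G : SchwartzMap ℝ ℂ).decay 0 0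
  -- Decay of orders `0` and `4` suffices, since `(1 + r²)² ≤ 2 (1 + r⁴)`.
  refine ⟨2 * (C' + (2 * Real.pi) ^ 4 * C), by positivity, fun r => ?_⟩
  have hm : mellin ψ (α + I * r) =
      (FourierTransform.fourier G : SchwartzMap ℝ ℂ) (r / (2 * Real.pi)) := by
    have hcoe : ⇑G = g := rfl
    rw [mellin_eq_fourier, SchwartzMap.fourier_coe, hcoe, hg]
    simp
  have h4 := hdec (r / (2 * Real.pi))
  have h0 := hdec' (r / (2 * Real.pi))
  rw [norm_iteratedFDeriv_zero, ← hm] at h4 h0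
  rw [pow_zero, one_mul] at h0
  rw [Real.norm_eq_abs, abs_div, abs_of_pos (by positivity : 0 < 2 * Real.pi), div_pow,
    div_mul_eq_mul_div, div_le_iff₀ (by positivity),
    show |r| ^ 4 = r ^ 4 from Even.pow_abs (by decide) r] at h4
  rw [← div_eq_mul_inv, le_div_iff₀ (by positivity)]
  have hn := norm_nonneg (mellin ψ (α + I * r))
  nlinarith [sq_nonneg (1 - r ^ 2), mul_nonneg hn (sq_nonneg (1 - r ^ 2))]

end GeodesicEisenstein

/-! ### Mellin transforms of theta kernels in the critical strip -/

namespace GeodesicEisenstein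

theorem hasMellin_cpow_Ioi {a s : ℂ} (h : (s + a).re < 0) :
    HasMellin ((Ioi (1 : ℝ)).indicator fun t => (t : ℂ) ^ a) s (-(1 / (s + a))) := by
  have e : ∀ t ∈ Ioi (0 : ℝ), (t : ℂ) ^ (s - 1) • (Ioi (1 : ℝ)).indicator (fun t => (t : ℂ) ^ a) t =
      (Ioi (1 : ℝ)).indicator (fun t => (t : ℂ) ^ (s + a - 1)) t := by
    intro t ht
    by_cases h1 : t ∈ Ioi (1 : ℝ)
    · rw [indicator_of_mem h1, indicator_of_mem h1, smul_eq_mul,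
        ← Complex.cpow_add _ _ (by exact_mod_cast (ne_of_gt ht : t ≠ 0))]
      congr 1
      ring
    · rw [indicator_of_notMem h1, indicator_of_notMem h1, smul_zero]
  have hre : (s + a - 1).re < -1 := by
    rw [Complex.sub_re, Complex.one_re]
    linarith
  constructor
  · rw [MellinConvergent, integrableOn_congr_fun e measurableSet_Ioi]
    exact IntegrableOn.integrable_indicator (s := Ioi (1 : ℝ))
      (integrableOn_Ioi_cpow_of_lt hre one_pos) measurableSet_Ioi |>.integrableOn
  · rw [mellin, setIntegral_congr_fun measurableSet_Ioi e, setIntegral_indicator measurableSet_Ioi,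
      inter_eq_right.mpr (Ioi_subset_Ioi zero_le_one), integral_Ioi_cpow_of_lt hre one_pos]
    simp
    ring

/-- The point `1` is exempted because `f_modif` is cut there and follows neither branch. -/
theorem HasMellin.congr_ae {f g : ℝ → ℂ} {s m : ℂ} (h : HasMellin f s m)
    (hfg : ∀ t : ℝ, 0 < t → t ≠ 1 → f t = g t) : HasMellin g s m := by
  have hae : (fun t : ℝ => (t : ℂ) ^ (s - 1) • f t) =ᵐ[volume.restrict (Ioi 0)]
      fun t : ℝ => (t : ℂ) ^ (s - 1) • g t := by
    have h1 : ∀ᵐ t : ℝ ∂(volume.restrict (Ioi 0)), t ≠ 1 :=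
      ae_restrict_of_ae (Measure.ae_ne volume 1)
    filter_upwards [h1, ae_restrict_mem measurableSet_Ioi] with t ht1 ht0
    rw [hfg t ht0 ht1]
  exact ⟨h.1.congr hae, (integral_congr_ae hae).symm.trans h.2⟩

/-- Inside the strip `0 < Re s < k`, the function `Λ` of a weak functional equation pair is the
Mellin transform of `f` minus its asymptotics at both ends. -/
theorem WeakFEPair.hasMellin_strip (P : WeakFEPair ℂ) {s : ℂ} (hs0 : 0 < s.re) (hsk : s.re < P.k) :
    HasMellin (fun t => P.f t - P.f₀ - P.ε * (t : ℂ) ^ (-(P.k : ℂ)) * P.g₀) s (P.Λ s) := by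
  have h1 : HasMellin P.f_modif s (P.Λ₀ s) := by
    have := P.isStrongFEPair_toStrongFEPair.hasMellin s
    exact ⟨this.1, rfl⟩
  have h2 := hasMellin_one_Ioc hs0
  have h3 := hasMellin_cpow_Ioi (a := -(P.k : ℂ)) (s := s) (by simp; linarith)
  -- `f_modif` lacks `f₀` only beyond `1` and `ε t^{-k} g₀` only below `1`. Removing each on the
  -- other side as well contributes exactly the polar terms by which `Λ` differs from `Λ₀`.
  have h4 : HasMellin (fun t => P.f₀ • (Ioc (0 : ℝ) 1).indicator (fun _ => (1 : ℂ)) t) s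
      (P.f₀ • (1 / s)) := ⟨h2.1.const_smul _, by rw [mellin_const_smul, h2.2]⟩
  have h5 : HasMellin (fun t => (P.ε * P.g₀) •
      (Ioi (1 : ℝ)).indicator (fun t => (t : ℂ) ^ (-(P.k : ℂ))) t) s
      ((P.ε * P.g₀) • (-(1 / (s + -(P.k : ℂ))))) := ⟨h3.1.const_smul _, by rw [mellin_const_smul, h3.2]⟩
  have h6 := hasMellin_sub h1.1 h4.1
  have h7 := hasMellin_sub h6.1 h5.1
  rw [h6.2, h1.2, h4.2, h5.2] at h7
  have hne : (P.k : ℂ) - s ≠ 0 := fun h => by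
    have := congrArg Complex.re h
    simp at this
    linarith
  have hne' : s + -(P.k : ℂ) ≠ 0 := fun h => hne (by linear_combination -h)
  have hΛ : P.Λ₀ s - P.f₀ • (1 / s) - (P.ε * P.g₀) • (-(1 / (s + -(P.k : ℂ)))) = P.Λ s := by
    rw [WeakFEPair.Λ]
    simp only [smul_eq_mul]
    have : 1 / (s + -(P.k : ℂ)) = -(1 / (P.k - s)) := by
      field_simp
      ring
    rw [this]
    ring
  rw [hΛ] at h7
  refine HasMellin.congr_ae h7 fun t ht ht1 => ?_
  rw [WeakFEPair.f_modif, Pi.add_apply]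
  rcases lt_or_gt_of_ne ht1 with h | h
  · rw [indicator_of_notMem (by simp [h.le]), indicator_of_mem (by simp [h, ht]),
      indicator_of_mem (by simp [h.le, ht]), indicator_of_notMem (by simp [h.le])]
    rw [Complex.ofReal_cpow ht.le]
    simp
    ring
  · rw [indicator_of_mem (by simpa using h), indicator_of_notMem (by simp [h.le]),
      indicator_of_notMem (by simp [h]), indicator_of_mem (by simpa using h)]
    simp
    ring

theorem HasMellin.comp_mul_left {f : ℝ → ℂ} {s m : ℂ} (h : HasMellin f s m) {a : ℝ} (ha : 0 < a) :
    HasMellin (fun t => f (a * t)) s ((a : ℂ) ^ (-s) * m) :=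
  ⟨(MellinConvergent.comp_mul_left ha).mpr h.1, by rw [mellin_comp_mul_left _ _ ha, h.2, smul_eq_mul]⟩

theorem HasMellin.cpow_mul {f : ℝ → ℂ} {s a m : ℂ} (h : HasMellin f (s + a) m) :
    HasMellin (fun t => (t : ℂ) ^ a * f t) s m :=
  ⟨MellinConvergent.cpow_smul.mpr h.1, (mellin_cpow_smul f s a).trans h.2⟩

theorem HasMellin.const_mul {f : ℝ → ℂ} {s m : ℂ} (h : HasMellin f s m) (c : ℂ) :
    HasMellin (fun t => c * f t) s (c * m) :=
  ⟨h.1.const_smul c, by rw [← h.2]; exact mellin_const_smul f s c⟩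

theorem HasMellin.add {f g : ℝ → ℂ} {s m n : ℂ} (hf : HasMellin f s m) (hg : HasMellin g s n) :
    HasMellin (fun t => f t + g t) s (m + n) := by
  have := hasMellin_add hf.1 hg.1
  rwa [hf.2, hg.2] at this

/-- The Jacobi theta function `∑ exp(-π n² t)`. -/
noncomputable def thetaKernel (t : ℝ) : ℝ := HurwitzZeta.evenKernel 0 t

theorem thetaKernel_eq {x : ℝ} (hx : 0 < x) :
    thetaKernel (1 / x) = x ^ (1 / 2 : ℝ) * thetaKernel x := by
  have h := HurwitzZeta.evenKernel_functional_equation 0 x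
  rw [← HurwitzZeta.evenKernel_eq_cosKernel_of_zero] at h
  rw [thetaKernel, thetaKernel, h]
  have : x ^ (1 / 2 : ℝ) ≠ 0 := by positivity
  field_simp

theorem continuousOn_thetaKernel : ContinuousOn thetaKernel (Ioi 0) :=
  HurwitzZeta.continuousOn_evenKernel 0

theorem isBigO_thetaKernel_sub_one (r : ℝ) :
    (fun t => (thetaKernel t : ℂ) - 1) =O[atTop] fun t : ℝ => t ^ r := by
  simpa [HurwitzZeta.hurwitzEvenFEPair, thetaKernel] using (HurwitzZeta.hurwitzEvenFEPair 0).hf_top r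

/-- The theta function with its asymptotics at both ends removed. -/
noncomputable def thetaReg (t : ℝ) : ℂ := (thetaKernel t : ℂ) - 1 - (t : ℂ) ^ (-(1 / 2) : ℂ)

theorem continuousOn_thetaReg : ContinuousOn thetaReg (Ioi 0) := by
  refine ((Complex.continuous_ofReal.comp_continuousOn continuousOn_thetaKernel).sub
    continuousOn_const).sub fun t ht => ?_
  refine ContinuousAt.continuousWithinAt ?_
  exact Complex.continuousAt_ofReal_cpow_const _ _ (Or.inr (ne_of_gt ht))

theorem norm_cpow_neg_half {t : ℝ} (ht : 0 < t) :
    ‖(t : ℂ) ^ (-(1 / 2) : ℂ)‖ = t ^ (-(1 / 2) : ℝ) := by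
  rw [Complex.norm_cpow_eq_rpow_re_of_pos ht]
  norm_num

/-- At infinity only the subtracted `t^{-1/2}` survives, and at zero only the subtracted `1`. This
gives one factor the strip `0 < Re s < 1/2`, and a product of two the strip `0 < Re s < 1`. -/
theorem isBigO_thetaReg_atTop : thetaReg =O[atTop] fun t : ℝ => t ^ (-(1 / 2) : ℝ) := by
  refine (isBigO_thetaKernel_sub_one _).sub (IsBigO.of_bound 1 ?_)
  filter_upwards [eventually_gt_atTop 0] with t ht
  rw [norm_cpow_neg_half ht, Real.norm_of_nonneg (by positivity), one_mul]

theorem isBigO_thetaReg_zero : thetaReg =O[nhdsWithin 0 (Ioi 0)] fun t : ℝ => t ^ (-0 : ℝ) := by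
  have h := (HurwitzZeta.hurwitzEvenFEPair 0).hf_zero 0
  have h1 : (fun _ : ℝ => (1 : ℂ)) =O[nhdsWithin 0 (Ioi 0)] fun t : ℝ => t ^ (0 : ℝ) := by
    simpa using isBigO_const_const (1 : ℂ) (one_ne_zero : (1 : ℝ) ≠ 0) _
  rw [neg_zero]
  refine (h.sub h1).congr' ?_ EventuallyEq.rfl
  filter_upwards [self_mem_nhdsWithin] with t ht
  have ht0 : (0 : ℝ) < t := ht
  simp only [HurwitzZeta.hurwitzEvenFEPair, thetaReg, thetaKernel, Function.comp_apply, one_mul,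
    smul_eq_mul, mul_one]
  rw [Complex.ofReal_cpow ht0.le]
  push_cast
  ring

theorem hasMellin_thetaReg {s : ℂ} (hs0 : 0 < s.re) (hs1 : s.re < 1 / 2) :
    HasMellin thetaReg s (2 * completedRiemannZeta (2 * s)) := by
  have h := WeakFEPair.hasMellin_strip (HurwitzZeta.hurwitzEvenFEPair 0) hs0 hs1
  have e : 2 * completedRiemannZeta (2 * s) = (HurwitzZeta.hurwitzEvenFEPair 0).Λ s := by
    rw [completedRiemannZeta, HurwitzZeta.completedHurwitzZetaEven,
      show 2 * s / 2 = s by ring]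
    ring
  rw [e]
  refine HasMellin.congr_ae h fun t ht _ => ?_
  simp [HurwitzZeta.hurwitzEvenFEPair, thetaReg, thetaKernel]

theorem hasMellin_thetaKernel_sub_one {s : ℂ} (hs : 1 / 2 < s.re) :
    HasMellin (fun t => (thetaKernel t : ℂ) - 1) s (2 * completedRiemannZeta (2 * s)) := by
  have h := (HurwitzZeta.hurwitzEvenFEPair 0).hasMellin hs
  have e : 2 * completedRiemannZeta (2 * s) = (HurwitzZeta.hurwitzEvenFEPair 0).Λ s := by
    rw [completedRiemannZeta, HurwitzZeta.completedHurwitzZetaEven,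
      show 2 * s / 2 = s by ring]
    ring
  rw [e]
  refine HasMellin.congr_ae h fun t ht _ => ?_
  simp [HurwitzZeta.hurwitzEvenFEPair, thetaKernel]

end GeodesicEisenstein

/-! ### The completed Eisenstein series on the geodesic -/

namespace GeodesicEisenstein

theorem isBigO_thetaKernel_mul_sub_one {c : ℝ} (hc : 0 < c) (r : ℝ) :
    (fun t => (thetaKernel (c * t) : ℂ) - 1) =O[atTop] fun t : ℝ => t ^ r := by
  refine ((isBigO_thetaKernel_sub_one r).comp_tendsto
    (tendsto_id.const_mul_atTop hc)).trans (IsBigO.of_bound (c ^ r) ?_)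
  filter_upwards [eventually_gt_atTop 0] with t ht
  simp only [Function.comp_apply, id]
  rw [Real.mul_rpow hc.le ht.le, norm_mul, Real.norm_of_nonneg (by positivity : 0 ≤ c ^ r)]

theorem continuousOn_thetaKernel_mul {c : ℝ} (hc : 0 < c) :
    ContinuousOn (fun t => thetaKernel (c * t)) (Ioi 0) :=
  continuousOn_thetaKernel.comp (by fun_prop) fun _ ht => mul_pos hc ht

/-- The product of two theta kernels, whose Mellin transform is the completed Eisenstein series. -/
noncomputable def thetaProd (y t : ℝ) : ℂ := thetaKernel (y * t) * thetaKernel (y⁻¹ * t)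

theorem continuousOn_thetaProd {y : ℝ} (hy : 0 < y) : ContinuousOn (thetaProd y) (Ioi 0) :=
  (Complex.continuous_ofReal.comp_continuousOn (continuousOn_thetaKernel_mul hy)).mul
    (Complex.continuous_ofReal.comp_continuousOn (continuousOn_thetaKernel_mul (inv_pos.mpr hy)))

theorem isBigO_thetaProd_sub_one {y : ℝ} (hy : 0 < y) (r : ℝ) :
    (fun t => thetaProd y t - 1) =O[atTop] fun t : ℝ => t ^ r := by
  have h1 := isBigO_thetaKernel_mul_sub_one hy r
  have h2 := isBigO_thetaKernel_mul_sub_one (inv_pos.mpr hy) r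
  have h3 := h1.mul (isBigO_thetaKernel_mul_sub_one (inv_pos.mpr hy) 0)
  simp only [Real.rpow_zero, mul_one] at h3
  refine ((h3.add h1).add h2).congr_left fun t => ?_
  rw [thetaProd]
  ring

/-- Inversion exchanges the two theta factors, and their half-powers multiply to `x`. -/
theorem thetaProd_one_div {y : ℝ} (hy : 0 < y) {x : ℝ} (hx : 0 < x) :
    thetaProd y (1 / x) = x * thetaProd y x := by
  have h1 : y * (1 / x) = 1 / (y⁻¹ * x) := by field_simp
  have h2 : y⁻¹ * (1 / x) = 1 / (y * x) := by field_simp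
  have h3 : (y⁻¹ * x) ^ (1 / 2 : ℝ) * (y * x) ^ (1 / 2 : ℝ) = x := by
    rw [← Real.mul_rpow (by positivity) (by positivity),
      show y⁻¹ * x * (y * x) = x ^ 2 by field_simp, ← Real.sqrt_eq_rpow, Real.sqrt_sq hx.le]
  rw [thetaProd, thetaProd, h1, h2, thetaKernel_eq (by positivity), thetaKernel_eq (by positivity)]
  calc _ = (((y⁻¹ * x) ^ (1 / 2 : ℝ) * (y * x) ^ (1 / 2 : ℝ) : ℝ) : ℂ) *
        ((thetaKernel (y * x) : ℂ) * (thetaKernel (y⁻¹ * x) : ℂ)) := by push_cast; ring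
    _ = _ := by rw [h3]

/-- The functional equation pair of the Eisenstein series at `iy`. -/
noncomputable def eisPair {y : ℝ} (hy : 0 < y) : WeakFEPair ℂ where
  f := thetaProd y
  g := thetaProd y
  k := 1
  ε := 1
  f₀ := 1
  g₀ := 1
  hf_int := (continuousOn_thetaProd hy).locallyIntegrableOn measurableSet_Ioi
  hg_int := (continuousOn_thetaProd hy).locallyIntegrableOn measurableSet_Ioi
  hk := one_pos
  hε := one_ne_zero
  h_feq x hx := by rw [thetaProd_one_div hy hx]; simp
  hf_top := isBigO_thetaProd_sub_one hy
  hg_top := isBigO_thetaProd_sub_one hy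

/-- The product is `O(1)` at zero and `O(1/t)` at infinity. Regularizing each factor at both ends is
what makes the strip contain the line `Re s = 1/2`. -/
theorem mellinConvergent_thetaReg_mul {y : ℝ} (hy : 0 < y) {s : ℂ} (hs0 : 0 < s.re)
    (hs1 : s.re < 1) :
    MellinConvergent (fun t => thetaReg (y * t) * thetaReg (y⁻¹ * t)) s ∧
      DifferentiableAt ℂ (mellin fun t => thetaReg (y * t) * thetaReg (y⁻¹ * t)) s := by
  have hcont : ∀ c : ℝ, 0 < c → ContinuousOn (fun t => thetaReg (c * t)) (Ioi 0) := fun c hc =>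
    continuousOn_thetaReg.comp (by fun_prop) fun _ ht => mul_pos hc ht
  have hint := ((hcont y hy).mul (hcont _ (inv_pos.mpr hy))).locallyIntegrableOn measurableSet_Ioi
    (μ := volume)
  have htop : ∀ c : ℝ, 0 < c →
      (fun t => thetaReg (c * t)) =O[atTop] fun t : ℝ => t ^ (-(1 / 2) : ℝ) := by
    intro c hc
    refine (isBigO_thetaReg_atTop.comp_tendsto
      (tendsto_id.const_mul_atTop hc)).trans (IsBigO.of_bound (c ^ (-(1 / 2) : ℝ)) ?_)
    filter_upwards [eventually_gt_atTop 0] with t ht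
    simp only [Function.comp_apply, id]
    rw [Real.mul_rpow hc.le ht.le, norm_mul, Real.norm_of_nonneg (by positivity)]
  have hzero : ∀ c : ℝ, 0 < c →
      (fun t => thetaReg (c * t)) =O[nhdsWithin 0 (Ioi 0)] fun t : ℝ => t ^ (-0 : ℝ) := by
    intro c hc
    have ht : Tendsto (fun t : ℝ => c * t) (nhdsWithin 0 (Ioi 0)) (nhdsWithin 0 (Ioi 0)) := by
      refine tendsto_nhdsWithin_iff.mpr ⟨?_, ?_⟩
      · have : Tendsto (fun t : ℝ => c * t) (nhds 0) (nhds (c * 0)) :=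
          (continuous_const.mul continuous_id).tendsto 0
        rw [mul_zero] at this
        exact this.mono_left nhdsWithin_le_nhds
      · filter_upwards [self_mem_nhdsWithin] with t ht using mul_pos hc ht
    refine (isBigO_thetaReg_zero.comp_tendsto ht).congr_right fun t => ?_
    simp
  have h1 : (fun t => thetaReg (y * t) * thetaReg (y⁻¹ * t)) =O[atTop]
      fun t : ℝ => t ^ (-1 : ℝ) := by
    refine ((htop y hy).mul (htop _ (inv_pos.mpr hy))).congr' EventuallyEq.rfl ?_
    filter_upwards [eventually_gt_atTop 0] with t ht
    rw [← Real.rpow_add ht]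
    norm_num
  have h0 : (fun t => thetaReg (y * t) * thetaReg (y⁻¹ * t)) =O[nhdsWithin 0 (Ioi 0)]
      fun t : ℝ => t ^ (-0 : ℝ) := by
    refine ((hzero y hy).mul (hzero _ (inv_pos.mpr hy))).congr_right fun t => ?_
    simp
  exact ⟨mellinConvergent_of_isBigO_rpow hint h1 hs1 h0 hs0,
    mellin_differentiableAt_of_isBigO_rpow hint h1 hs1 h0 hs0⟩

/-- The completed Eisenstein series at `iy` in the right half of the critical strip. -/
theorem eisPair_Λ_eq {y : ℝ} (hy : 0 < y) {s : ℂ} (hs0 : 1 / 2 < s.re) (hs1 : s.re < 1) :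
    (eisPair hy).Λ s = mellin (fun t => thetaReg (y * t) * thetaReg (y⁻¹ * t)) s +
      2 * completedRiemannZeta (2 * s) * ((y : ℂ) ^ s + (y : ℂ) ^ (-s)) +
      2 * completedRiemannZeta (2 * s - 1) * ((y : ℂ) ^ (1 - s) + (y : ℂ) ^ (s - 1)) := by
  have hy0 : (y : ℂ) ≠ 0 := by exact_mod_cast hy.ne'
  have hinv : ∀ a : ℂ, ((y⁻¹ : ℝ) : ℂ) ^ a = (y : ℂ) ^ (-a) := fun a => by
    rw [Complex.ofReal_inv, Complex.inv_cpow _ _ (by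
      rw [Complex.arg_ofReal_of_nonneg hy.le]; exact Real.pi_pos.ne), Complex.cpow_neg]
  -- Write the factors as `ϑ₁ = 1 + a + R₁` and `ϑ₂ = 1 + b + R₂` with `ab = 1/t`. Then `ϑ₁ϑ₂ - 1 -
  -- 1/t = R₁R₂ + (ϑ₁ - 1) + (ϑ₂ - 1) + bR₁ + aR₂`, and the last four terms have Mellin transforms
  -- only to the right of `1/2`.
  have hA : HasMellin (fun t => thetaReg (y * t) * thetaReg (y⁻¹ * t)) s _ :=
    ⟨(mellinConvergent_thetaReg_mul hy (by linarith) hs1).1, rfl⟩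
  have hB := HasMellin.comp_mul_left (hasMellin_thetaKernel_sub_one hs0) hy
  have hC := HasMellin.comp_mul_left (hasMellin_thetaKernel_sub_one hs0) (inv_pos.mpr hy)
  have hre : ((s + -(1 / 2) : ℂ)).re = s.re - 1 / 2 := by simp; ring
  have hθ : HasMellin thetaReg (s + -(1 / 2)) (2 * completedRiemannZeta (2 * (s + -(1 / 2)))) :=
    hasMellin_thetaReg (by rw [hre]; linarith) (by rw [hre]; linarith)
  have hD := HasMellin.const_mul (HasMellin.cpow_mul (HasMellin.comp_mul_left hθ hy)) ((y : ℂ) ^ (1 / 2 : ℂ))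
  have hE := HasMellin.const_mul (HasMellin.cpow_mul (HasMellin.comp_mul_left hθ (inv_pos.mpr hy)))
    ((y : ℂ) ^ (-(1 / 2) : ℂ))
  have h := HasMellin.add (HasMellin.add (HasMellin.add (HasMellin.add hA hB) hC) hD) hE
  have h' := WeakFEPair.hasMellin_strip (eisPair hy) (s := s) (by linarith) hs1
  rw [← h'.2]
  refine (HasMellin.congr_ae h fun t ht _ => ?_).2.trans ?_
  rotate_left
  · rw [hinv, hinv, show 2 * (s + -(1 / 2)) = 2 * s - 1 by ring]
    have e1 : (y : ℂ) ^ (1 / 2 : ℂ) * (y : ℂ) ^ (-(s + -(1 / 2))) = (y : ℂ) ^ (1 - s) := by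
      rw [← Complex.cpow_add _ _ hy0]
      ring_nf
    have e2 : (y : ℂ) ^ (-(1 / 2) : ℂ) * (y : ℂ) ^ (-(-(s + -(1 / 2)))) = (y : ℂ) ^ (s - 1) := by
      rw [← Complex.cpow_add _ _ hy0]
      ring_nf
    rw [← e1, ← e2, neg_neg s]
    ring
  · have e1 : ((y * t : ℝ) : ℂ) ^ (-(1 / 2) : ℂ) =
        (y : ℂ) ^ (-(1 / 2) : ℂ) * (t : ℂ) ^ (-(1 / 2) : ℂ) := by
      rw [Complex.ofReal_mul, Complex.mul_cpow_ofReal_nonneg hy.le ht.le]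
    have e2 : ((y⁻¹ * t : ℝ) : ℂ) ^ (-(1 / 2) : ℂ) =
        (y : ℂ) ^ (1 / 2 : ℂ) * (t : ℂ) ^ (-(1 / 2) : ℂ) := by
      rw [Complex.ofReal_mul, Complex.mul_cpow_ofReal_nonneg (inv_pos.mpr hy).le ht.le, hinv,
        neg_neg]
    have e3 : (y : ℂ) ^ (1 / 2 : ℂ) * (y : ℂ) ^ (-(1 / 2) : ℂ) = 1 := by
      rw [← Complex.cpow_add _ _ hy0]
      simp
    have e4 : (t : ℂ) ^ (-(1 / 2) : ℂ) * (t : ℂ) ^ (-(1 / 2) : ℂ) = (t : ℂ) ^ (-(1 : ℝ) : ℂ) := by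
      rw [← Complex.cpow_add _ _ (by exact_mod_cast ht.ne')]
      norm_num
    simp only [eisPair, thetaProd, thetaReg, e1, e2, ← e4]
    generalize (y : ℂ) ^ (1 / 2 : ℂ) = p at *
    generalize (y : ℂ) ^ (-(1 / 2) : ℂ) = q at *
    generalize (t : ℂ) ^ (-(1 / 2) : ℂ) = r at *
    linear_combination -r ^ 2 * e3

/-- The part of the completed Eisenstein series at `iy` that oscillates. -/
noncomputable def geoP (T y : ℝ) : ℂ :=
  1 / 2 * mellin (fun t => thetaReg (y * t) * thetaReg (y⁻¹ * t)) (1 / 2 + I * T)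

/-- The functional equation sends `2iT` to `1 - 2iT`, the conjugate of `1 + 2iT`. -/
theorem completedRiemannZeta_two_I {T : ℝ} :
    completedRiemannZeta (2 * (1 / 2 + I * T) - 1) = (starRingEnd ℂ) (theta (1 / 2 + I * T)) := by
  rw [theta_eq_completedRiemannZeta (by simp), ← completedRiemannZeta_conj (by simp),
    ← completedRiemannZeta_one_sub]
  congr 1
  apply Complex.ext <;> simp

/-- The decomposition `eisPair_Λ_eq` holds just to the right of the line, and both sides are
continuous at `1/2 + iT` away from the real axis, so it passes to the limit. -/
theorem eisPair_Λ_half {y : ℝ} (hy : 0 < y) {T : ℝ} (hT : T ≠ 0) :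
    1 / 2 * (eisPair hy).Λ (1 / 2 + I * T) = geoP T y +
      theta (1 / 2 + I * T) * ((y : ℂ) ^ (1 / 2 + I * T) + (y : ℂ) ^ (-(1 / 2 + I * T))) +
      (starRingEnd ℂ) (theta (1 / 2 + I * T)) *
        ((y : ℂ) ^ (1 - (1 / 2 + I * T)) + (y : ℂ) ^ (1 / 2 + I * T - 1)) := by
  set s₀ : ℂ := 1 / 2 + I * T with hs₀
  have hy0 : (y : ℂ) ≠ 0 := by exact_mod_cast hy.ne'
  have him : s₀.im = T := by simp [hs₀]
  have hre : s₀.re = 1 / 2 := by simp [hs₀]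
  have hz : ∀ c : ℝ, 2 * s₀ - c ≠ 0 ∧ 2 * s₀ - c ≠ 1 := fun c => by
    constructor <;>
    · intro h
      have := congrArg Complex.im h
      simp [him, hT] at this
  set R : ℂ → ℂ := fun s => mellin (fun t => thetaReg (y * t) * thetaReg (y⁻¹ * t)) s +
      2 * completedRiemannZeta (2 * s) * ((y : ℂ) ^ s + (y : ℂ) ^ (-s)) +
      2 * completedRiemannZeta (2 * s - 1) * ((y : ℂ) ^ (1 - s) + (y : ℂ) ^ (s - 1)) with hR
  have hRd : DifferentiableAt ℂ R s₀ := by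
    have h1 := (mellinConvergent_thetaReg_mul hy (s := s₀) (by rw [hre]; norm_num)
      (by rw [hre]; norm_num)).2
    have h2 : DifferentiableAt ℂ (fun s => completedRiemannZeta (2 * s)) s₀ := by
      refine DifferentiableAt.comp (g := completedRiemannZeta) s₀ ?_ (by fun_prop)
      exact differentiableAt_completedZeta (by simpa using (hz 0).1) (by simpa using (hz 0).2)
    have h3 : DifferentiableAt ℂ (fun s => completedRiemannZeta (2 * s - 1)) s₀ := by
      refine DifferentiableAt.comp (g := completedRiemannZeta) s₀ ?_ (by fun_prop)
      exact differentiableAt_completedZeta (by simpa using (hz 1).1) (by simpa using (hz 1).2)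
    have h4 : ∀ g : ℂ → ℂ, DifferentiableAt ℂ g s₀ →
        DifferentiableAt ℂ (fun s => (y : ℂ) ^ g s) s₀ := fun g hg => hg.const_cpow (Or.inl hy0)
    exact (h1.add ((h2.const_mul 2).mul ((h4 _ differentiableAt_id).add
      (h4 _ differentiableAt_id.neg)))).add ((h3.const_mul 2).mul
      ((h4 _ (differentiableAt_id.const_sub 1)).add (h4 _ (differentiableAt_id.sub_const 1))))
  have hΛd : DifferentiableAt ℂ (eisPair hy).Λ s₀ := by
    refine (eisPair hy).differentiableAt_Λ (Or.inl fun h => ?_) (Or.inl fun h => ?_)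
    · rw [h] at him
      simp [hT.symm] at him
    · rw [h] at him
      simp [eisPair, hT.symm] at him
  have hpath : Tendsto (fun δ : ℝ => s₀ + δ) (nhdsWithin 0 (Ioi 0)) (nhds s₀) := by
    have : Tendsto (fun δ : ℝ => s₀ + δ) (nhds 0) (nhds (s₀ + (0 : ℝ))) :=
      (by fun_prop : Continuous fun δ : ℝ => s₀ + δ).tendsto 0
    rw [Complex.ofReal_zero, add_zero] at this
    exact this.mono_left nhdsWithin_le_nhds
  have hlim := tendsto_nhds_unique_of_eventuallyEq (hΛd.continuousAt.tendsto.comp hpath)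
    (hRd.continuousAt.tendsto.comp hpath) (by
      filter_upwards [Ioo_mem_nhdsGT (show (0 : ℝ) < 1 / 2 by norm_num)] with δ hδ
      have hδre : (s₀ + δ).re = 1 / 2 + δ := by simp [hre]
      exact eisPair_Λ_eq hy (by rw [hδre]; linarith [hδ.1]) (by rw [hδre]; linarith [hδ.2]))
  rw [hlim, hR]
  simp only
  rw [hs₀, completedRiemannZeta_two_I, ← theta_eq_completedRiemannZeta (by simp), geoP]
  ring

/-! ### The oscillating part as a Fourier integral -/

/-- The product of two values of the completed zeta function symmetric about height `T`. -/
noncomputable def critKer (T t : ℝ) : ℂ := critXi (T + t) * critXi (T - t)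

theorem exists_norm_critXi_le_inv : ∃ C : ℝ, 0 < C ∧ ∀ u : ℝ, ‖critXi u‖ ≤ C * (1 + u ^ 2)⁻¹ := by
  obtain ⟨C, hC, h⟩ := exists_norm_critXi_le (le_refl (0 : ℝ)) (by norm_num)
  refine ⟨C * 10, by positivity, fun u => ?_⟩
  have h1 := h u
  rw [neg_zero, Real.rpow_zero, mul_one] at h1
  have h2 : Real.exp (-(Real.pi * |u| / 4)) ≤ 10 * (1 + u ^ 2)⁻¹ := by
    rw [Real.exp_neg, ← div_eq_mul_inv, le_div_iff₀ (by positivity), ← div_eq_inv_mul,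
      div_le_iff₀ (Real.exp_pos _)]
    have hx : 0 ≤ Real.pi * |u| / 4 := by positivity
    have := Real.quadratic_le_exp_of_nonneg hx
    have hpi := Real.pi_gt_three
    have h9 : 9 / 16 * u ^ 2 ≤ (Real.pi * |u| / 4) ^ 2 := by
      rw [div_pow, mul_pow, sq_abs]
      have h9' : (9 : ℝ) ≤ Real.pi ^ 2 := by nlinarith
      nlinarith [sq_nonneg u]
    nlinarith
  calc _ ≤ C * Real.exp (-(Real.pi * |u| / 4)) := h1
    _ ≤ C * (10 * (1 + u ^ 2)⁻¹) := by gcongr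
    _ = _ := by ring

theorem integrable_critXi : Integrable critXi := by
  obtain ⟨C, -, h⟩ := exists_norm_critXi_le_inv
  exact (integrable_inv_one_add_sq.const_mul C).mono' continuous_critXi.aestronglyMeasurable
    (ae_of_all _ h)

/-- Mellin inversion along `Re s = 1/4`, where `2s` runs over the critical line. -/
theorem thetaReg_eq_integral {x : ℝ} (hx : 0 < x) :
    thetaReg x = 1 / Real.pi * ∫ u : ℝ, (x : ℂ) ^ (-(1 / 4) : ℂ) *
      Complex.exp (-(I * u * Real.log x)) * critXi (2 * u) := by
  have hmel : ∀ u : ℝ, mellin thetaReg ((1 / 4 : ℝ) + u * I) = 2 * critXi (2 * u) := fun u => by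
    rw [(hasMellin_thetaReg (by simp) (by norm_num)).2, critXi]
    congr 2
    push_cast
    ring
  have h := mellinInv_mellin_eq (1 / 4) thetaReg hx
    (hasMellin_thetaReg (by simp) (by norm_num)).1 (by
      rw [VerticalIntegrable]
      simp_rw [hmel]
      exact (integrable_critXi.comp_mul_left' two_ne_zero).const_mul 2)
    (continuousOn_thetaReg.continuousAt (Ioi_mem_nhds hx))
  rw [← h, mellinInv, Complex.real_smul, ← integral_const_mul, ← integral_const_mul]
  refine integral_congr_ae (ae_of_all _ fun u => ?_)
  simp only
  rw [hmel, smul_eq_mul, neg_add, Complex.cpow_add _ _ (by exact_mod_cast hx.ne'),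
    Complex.cpow_def_of_ne_zero (by exact_mod_cast hx.ne') (-(u * I)), Complex.ofReal_log hx.le]
  push_cast
  ring_nf

theorem integrable_critKer_comp (T : ℝ) : Integrable fun r : ℝ => critXi r * critXi (2 * T - r) := by
  obtain ⟨C, -, h⟩ := exists_norm_critXi_le_inv
  refine integrable_critXi.mul_bdd (c := C) ?_ (ae_of_all _ fun r => ?_)
  · exact (continuous_critXi.comp (by fun_prop)).aestronglyMeasurable
  · have h1 := h (2 * T - r)
    have h2 : (1 + (2 * T - r) ^ 2)⁻¹ ≤ 1 := inv_le_one_of_one_le₀ (by nlinarith [sq_nonneg (2 * T - r)])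
    have hC : 0 ≤ C := by
      have := (norm_nonneg _).trans (h 0)
      simpa using this
    nlinarith

/-- Parseval: expand the factor `thetaReg (y⁻¹ * t)` by Mellin inversion and exchange the integrals.
The remaining `t`-integral is the Mellin transform of the other factor, which gives `Ξ(2(T-u))
Ξ(2u)`. -/
theorem geoP_eq {y : ℝ} (hy : 0 < y) (T : ℝ) : geoP T y =
    1 / (2 * Real.pi) * ∫ t : ℝ, critKer T t * Complex.exp (-(I * t * Real.log y)) := by
  have hy0 : (y : ℂ) ≠ 0 := by exact_mod_cast hy.ne'
  have hyi : 0 < y⁻¹ := inv_pos.mpr hy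
  set A : ℝ → ℂ := fun t => (t : ℂ) ^ (-(1 / 2) + I * T : ℂ) * thetaReg (y * t) *
    ((y⁻¹ * t : ℝ) : ℂ) ^ (-(1 / 4) : ℂ) with hA
  set E : ℝ → ℝ → ℂ := fun t u => Complex.exp (-(I * u * Real.log (y⁻¹ * t))) with hE
  have hθ : ∀ u : ℝ, HasMellin (fun t => thetaReg (y * t)) (1 / 4 + I * ((T - u : ℝ) : ℂ))
      ((y : ℂ) ^ (-(1 / 4 + I * ((T - u : ℝ) : ℂ))) * (2 * critXi (2 * (T - u)))) := fun u => by
    have h := HasMellin.comp_mul_left (hasMellin_thetaReg (s := 1 / 4 + I * ((T - u : ℝ) : ℂ))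
      (by simp) (by norm_num)) hy
    convert h using 3
    rw [critXi]
    congr 1
    push_cast
    ring
  have hAE : ∀ u : ℝ, ∀ t ∈ Ioi (0 : ℝ), A t * E t u = (y : ℂ) ^ (1 / 4 + I * u : ℂ) *
      ((t : ℂ) ^ (1 / 4 + I * ((T - u : ℝ) : ℂ) - 1) • thetaReg (y * t)) := by
    intro u t ht
    have ht' : (0 : ℝ) < t := ht
    have ht0 : (t : ℂ) ≠ 0 := by exact_mod_cast ht'.ne'
    have hc : ((y⁻¹ * t : ℝ) : ℂ) ≠ 0 := by exact_mod_cast (mul_pos hyi ht').ne'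
    have h1 : ((y⁻¹ * t : ℝ) : ℂ) ^ (-(1 / 4) : ℂ) * E t u =
        ((y⁻¹ * t : ℝ) : ℂ) ^ (-(1 / 4 + I * u) : ℂ) := by
      rw [neg_add, Complex.cpow_add _ _ hc, Complex.cpow_def_of_ne_zero hc (-(I * u)),
        ← Complex.ofReal_log (mul_pos hyi ht').le]
      simp only [hE]
      ring_nf
    have h2 : ((y⁻¹ * t : ℝ) : ℂ) ^ (-(1 / 4 + I * u) : ℂ) =
        (y : ℂ) ^ (1 / 4 + I * u : ℂ) * (t : ℂ) ^ (-(1 / 4 + I * u) : ℂ) := by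
      rw [Complex.ofReal_mul, Complex.mul_cpow_ofReal_nonneg hyi.le ht'.le, Complex.ofReal_inv,
        Complex.inv_cpow _ _ (by
          rw [Complex.arg_ofReal_of_nonneg hy.le]; exact Real.pi_pos.ne), Complex.cpow_neg, inv_inv]
    have h3 : (t : ℂ) ^ (1 / 4 + I * ((T - u : ℝ) : ℂ) - 1) =
        (t : ℂ) ^ (-(1 / 2) + I * T : ℂ) * (t : ℂ) ^ (-(1 / 4 + I * u) : ℂ) := by
      rw [← Complex.cpow_add _ _ ht0]
      congr 1
      push_cast
      ring
    calc A t * E t u = (t : ℂ) ^ (-(1 / 2) + I * T : ℂ) * thetaReg (y * t) *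
          (((y⁻¹ * t : ℝ) : ℂ) ^ (-(1 / 4) : ℂ) * E t u) := by simp only [hA]; ring
      _ = _ := by
        rw [h1, h2, h3, smul_eq_mul]
        ring
  have hAint : IntegrableOn A (Ioi 0) := by
    have h := ((hθ 0).1.const_mul ((y : ℂ) ^ (1 / 4 + I * (0 : ℝ) : ℂ)))
    refine (integrableOn_congr_fun (fun t ht => ?_) measurableSet_Ioi).mpr h
    rw [← hAE 0 t ht]
    simp [hE]
  have hXint : Integrable fun u : ℝ => critXi (2 * u) := integrable_critXi.comp_mul_left' two_ne_zero
  have hprod : Integrable (Function.uncurry fun t u : ℝ => A t * critXi (2 * u) * E t u)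
      ((volume.restrict (Ioi 0)).prod volume) := by
    refine (hAint.mul_prod hXint).mul_bdd (c := 1) ?_ (ae_of_all _ fun p => ?_)
    · refine Measurable.aestronglyMeasurable ?_
      simp only [hE]
      fun_prop
    · simp only [hE]
      rw [Complex.norm_exp]
      simp
  have h1 : geoP T y = 1 / (2 * Real.pi) *
      ∫ t in Ioi (0 : ℝ), ∫ u : ℝ, A t * critXi (2 * u) * E t u := by
    rw [geoP, mellin, show (1 / (2 * Real.pi) : ℂ) = 1 / 2 * (1 / Real.pi) by ring, mul_assoc,
      ← integral_const_mul (1 / (Real.pi : ℂ))]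
    congr 1
    refine setIntegral_congr_fun measurableSet_Ioi fun t ht => ?_
    have ht' : (0 : ℝ) < t := ht
    rw [thetaReg_eq_integral (mul_pos hyi ht'), smul_eq_mul,
      show (1 / 2 + I * T - 1 : ℂ) = -(1 / 2) + I * T by ring, ← mul_assoc, mul_left_comm,
      ← integral_const_mul]
    congr 1
    refine integral_congr_ae (ae_of_all _ fun u => ?_)
    simp only [hA, hE]
    ring
  -- The substitution `T - 2u` makes the product symmetric about `T`; its Jacobian `1/2` absorbs the
  -- factor `2`.
  have h2 : ∀ u : ℝ, (∫ t in Ioi (0 : ℝ), A t * critXi (2 * u) * E t u) =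
      2 * ((fun t : ℝ => critKer T t * Complex.exp (-(I * t * Real.log y))) (T + u * (-2))) := by
    intro u
    have : (∫ t in Ioi (0 : ℝ), A t * critXi (2 * u) * E t u) = critXi (2 * u) *
        ((y : ℂ) ^ (1 / 4 + I * u : ℂ) * mellin (fun t => thetaReg (y * t))
          (1 / 4 + I * ((T - u : ℝ) : ℂ))) := by
      rw [mellin, ← integral_const_mul, ← integral_const_mul]
      refine setIntegral_congr_fun measurableSet_Ioi fun t ht => ?_
      rw [← hAE u t ht]
      ring
    simp only [critKer]
    rw [this, (hθ u).2, show T + (T + u * -2) = 2 * (T - u) by ring,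
      show T - (T + u * -2) = 2 * u by ring]
    have e : (y : ℂ) ^ (1 / 4 + I * u : ℂ) * (y : ℂ) ^ (-(1 / 4 + I * ((T - u : ℝ) : ℂ))) =
        Complex.exp (-(I * (T + u * (-2) : ℝ) * Real.log y)) := by
      rw [← Complex.cpow_add _ _ hy0, Complex.cpow_def_of_ne_zero hy0, ← Complex.ofReal_log hy.le]
      congr 1
      push_cast
      ring
    rw [← e]
    ring
  rw [h1, integral_integral_swap hprod]
  congr 1
  set F : ℝ → ℂ := fun t => critKer T t * Complex.exp (-(I * t * Real.log y)) with hF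
  have h3 := Measure.integral_comp_mul_right (fun t => F (T + t)) (-2 : ℝ)
  rw [integral_congr_ae (ae_of_all _ h2), integral_const_mul, h3, integral_add_left_eq_self F]
  norm_num
  ring

end GeodesicEisenstein

/-! ### The Eisenstein series as an Epstein zeta function -/

namespace GeodesicEisenstein

/-- The quadratic form `y c² + y⁻¹ d²` attached to the point `iy`. -/
noncomputable def quadForm (y : ℝ) (v : Fin 2 → ℤ) : ℝ := y * (v 0 : ℝ) ^ 2 + y⁻¹ * (v 1 : ℝ) ^ 2

theorem quadForm_nonneg {y : ℝ} (hy : 0 < y) (v : Fin 2 → ℤ) : 0 ≤ quadForm y v := by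
  rw [quadForm]
  positivity

theorem quadForm_smul (y : ℝ) (r : ℕ) (v : Fin 2 → ℤ) :
    quadForm y (r • v) = (r : ℝ) ^ 2 * quadForm y v := by
  simp only [quadForm, Pi.smul_apply, nsmul_eq_mul]
  push_cast
  ring

theorem le_quadForm {y : ℝ} (hy : 0 < y) (v : Fin 2 → ℤ) :
    min y y⁻¹ * ‖v‖ ^ 2 ≤ quadForm y v := by
  have hi : 0 < y⁻¹ := inv_pos.mpr hy
  have h0 : 0 ≤ min y y⁻¹ := (lt_min hy hi).le
  obtain ⟨i, hi'⟩ : ∃ i, ‖v‖ = ‖v i‖ := by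
    obtain ⟨i, -, h⟩ := Finset.exists_mem_eq_sup' Finset.univ_nonempty fun i => ‖v i‖₊
    refine ⟨i, ?_⟩
    rw [Pi.norm_def, ← Finset.sup'_eq_sup Finset.univ_nonempty, h]
    rfl
  have hsq : ‖v‖ ^ 2 = (v i : ℝ) ^ 2 := by rw [hi', Int.norm_eq_abs, sq_abs]
  rw [hsq, quadForm]
  have h1 : 0 ≤ (v 0 : ℝ) ^ 2 := sq_nonneg _
  have h2 : 0 ≤ (v 1 : ℝ) ^ 2 := sq_nonneg _
  fin_cases i
  · have := mul_le_mul_of_nonneg_right (min_le_left y y⁻¹) h1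
    have h3 := mul_nonneg hi.le h2
    simp only [Fin.zero_eta]
    linarith
  · have := mul_le_mul_of_nonneg_right (min_le_right y y⁻¹) h2
    have h3 := mul_nonneg hy.le h1
    simp only [Fin.mk_one]
    linarith

theorem quadForm_eq_zero {y : ℝ} (hy : 0 < y) {v : Fin 2 → ℤ} : quadForm y v = 0 ↔ v = 0 := by
  constructor
  · intro h
    have h1 := le_quadForm hy v
    have h2 : 0 < min y y⁻¹ := lt_min hy (inv_pos.mpr hy)
    rw [h] at h1
    have h3 : ‖v‖ ^ 2 ≤ 0 := by
      by_contra hc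
      exact absurd h1 (not_le.mpr (mul_pos h2 (not_le.mp hc)))
    exact norm_eq_zero.mp (pow_eq_zero_iff two_ne_zero |>.mp (le_antisymm h3 (sq_nonneg _)))
  · rintro rfl
    simp [quadForm]

theorem summable_quadForm {y : ℝ} (hy : 0 < y) {σ : ℝ} (hσ : 1 < σ) :
    Summable fun v : Fin 2 → ℤ => 1 / quadForm y v ^ σ := by
  have h2 : 0 < min y y⁻¹ := lt_min hy (inv_pos.mpr hy)
  refine ((EisensteinSeries.summable_one_div_norm_rpow (k := 2 * σ) (by linarith)).mul_left
    ((min y y⁻¹) ^ σ)⁻¹).of_nonneg_of_le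
    (fun v => by have := quadForm_nonneg hy v; positivity) fun v => ?_
  rcases eq_or_ne v 0 with rfl | hv
  · rw [(quadForm_eq_zero hy).mpr rfl, Real.zero_rpow (by linarith), norm_zero,
      Real.zero_rpow (by linarith)]
    simp
  · have hn : 0 < ‖v‖ := norm_pos_iff.mpr hv
    rw [Real.rpow_neg hn.le, ← mul_inv, one_div, Real.rpow_mul hn.le, Real.rpow_two,
      ← Real.mul_rpow h2.le (by positivity)]
    gcongr
    exact le_quadForm hy v

theorem summable_quadForm_cpow {y : ℝ} (hy : 0 < y) {s : ℂ} (hs : 1 < s.re) :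
    Summable fun v : Fin 2 → ℤ => 1 / (quadForm y v : ℂ) ^ s := by
  refine Summable.of_norm ((summable_quadForm hy hs).congr fun v => ?_)
  rw [norm_div, norm_one, Complex.norm_cpow_eq_rpow_re_of_nonneg (quadForm_nonneg hy v)
    (by linarith)]

/-- The product of the two theta series is a sum over `ℤ²` of `exp(-π Q(v) t)`. Subtracting `1`
drops `v = 0`, and the Mellin transform is taken termwise. -/
theorem eisPair_Λ_eq_tsum {y : ℝ} (hy : 0 < y) {s : ℂ} (hs : 1 < s.re) : (eisPair hy).Λ s =
    (Real.pi : ℂ) ^ (-s) * Complex.Gamma s * ∑' v : Fin 2 → ℤ, 1 / (quadForm y v : ℂ) ^ s := by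
  have h := (eisPair hy).hasMellin (s := s) hs
  have hker : ∀ c : ℝ, 0 < c →
      HasSum (fun n : ℤ => Real.exp (-Real.pi * (n : ℝ) ^ 2 * c)) (thetaKernel c) := fun c hc => by
    simpa [thetaKernel] using HurwitzZeta.hasSum_int_evenKernel 0 hc
  have hF : ∀ t ∈ Ioi (0 : ℝ), HasSum (fun v : Fin 2 → ℤ => if quadForm y v = 0 then 0 else
      (1 : ℂ) * Real.exp (-Real.pi * quadForm y v * t)) ((eisPair hy).f t - (eisPair hy).f₀) := by
    intro t ht
    have h1 := hker _ (mul_pos hy ht)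
    have h2 := hker _ (mul_pos (inv_pos.mpr hy) ht)
    have h3 := h1.mul h2 (h1.summable.mul_of_nonneg h2.summable (fun _ => (Real.exp_pos _).le)
      fun _ => (Real.exp_pos _).le)
    have h4 := (finTwoArrowEquiv ℤ).hasSum_iff.mpr h3
    have h5 := hasSum_ite_sub_hasSum (Complex.hasSum_ofReal.mpr h4) (0 : Fin 2 → ℤ)
    simp only [eisPair, thetaProd]
    convert! h5 using 1
    · funext v
      have hv2 : finTwoArrowEquiv ℤ v = (v 0, v 1) := rfl
      simp only [quadForm_eq_zero hy, Function.comp_apply, hv2]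
      split_ifs with hv
      · rfl
      · rw [one_mul, ← Real.exp_add, quadForm]
        congr 2
        ring
    · simp
  have hsum := hasSum_mellin_pi_mul₀ (a := fun _ => (1 : ℂ)) (p := quadForm y) (quadForm_nonneg hy)
    (by linarith) hF (by simpa using summable_quadForm hy hs)
  rw [← h.2, ← hsum.tsum_eq, ← tsum_mul_left]
  refine tsum_congr fun v => ?_
  ring

theorem one_div_quadForm_smul_cpow {y : ℝ} (hy : 0 < y) (s : ℂ) (r : ℕ) (v : Fin 2 → ℤ) :
    1 / (quadForm y (r • v) : ℂ) ^ s =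
      1 / (r : ℂ) ^ (2 * s) * (1 / (quadForm y v : ℂ) ^ s) := by
  rw [quadForm_smul, Complex.ofReal_mul,
    Complex.mul_cpow_ofReal_nonneg (by positivity) (quadForm_nonneg hy _), one_div_mul_one_div]
  congr 2
  rw [sq, Complex.ofReal_mul, Complex.mul_cpow_ofReal_nonneg (by positivity) (by positivity), ← sq,
    Complex.cpow_ofNat_mul, Complex.ofReal_natCast]

theorem tsum_gammaSet_quadForm {y : ℝ} (hy : 0 < y) {s : ℂ} (hs : s ≠ 0) (r : ℕ) :
    ∑' v : EisensteinSeries.gammaSet 1 r 0, 1 / (quadForm y (v : Fin 2 → ℤ) : ℂ) ^ s =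
      1 / (r : ℂ) ^ (2 * s) *
      ∑' v : EisensteinSeries.gammaSet 1 1 0, 1 / (quadForm y (v : Fin 2 → ℤ) : ℂ) ^ s := by
  have hterm : ∀ v : EisensteinSeries.gammaSet 1 r 0, 1 / (quadForm y (v : Fin 2 → ℤ) : ℂ) ^ s =
      1 / (r : ℂ) ^ (2 * s) *
        (1 / (quadForm y (EisensteinSeries.divIntMap r (v : Fin 2 → ℤ)) : ℂ) ^ s) := fun v => by
    rw [← one_div_quadForm_smul_cpow hy, ← EisensteinSeries.gammaSet_eq_gcd_mul_divIntMap v.2]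
  rw [tsum_congr hterm, tsum_mul_left]
  -- At `r = 0` the conventions `0 ^ (2 * s) = 0` and `1 / 0 = 0` make the right side vanish, and
  -- `hterm` has put the same factor on the left.
  rcases eq_or_ne r 0 with hr | hr
  · have h2 : (2 : ℂ) * s ≠ 0 := mul_ne_zero two_ne_zero hs
    rw [hr, Nat.cast_zero, Complex.zero_cpow h2, div_zero, zero_mul, zero_mul]
  · have : NeZero r := ⟨hr⟩
    congr 1
    exact (EisensteinSeries.gammaSetDivGcdEquiv r).tsum_eq
      fun v : EisensteinSeries.gammaSet 1 1 0 => 1 / (quadForm y (v : Fin 2 → ℤ) : ℂ) ^ s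

/-- Sort the vectors by their gcd `r`; homogeneity of degree two gives the factor `r^{-2s}`, and
these sum to the zeta value. -/
theorem tsum_quadForm_eq {y : ℝ} (hy : 0 < y) {s : ℂ} (hs : 1 < s.re) :
    ∑' v : Fin 2 → ℤ, 1 / (quadForm y v : ℂ) ^ s = riemannZeta (2 * s) *
      ∑' v : EisensteinSeries.gammaSet 1 1 0, 1 / (quadForm y (v : Fin 2 → ℤ) : ℂ) ^ s := by
  have hs0 : s ≠ 0 := fun h => by
    rw [h, Complex.zero_re] at hs
    linarith
  have h2 : 1 < (2 * s).re := by
    simp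
    linarith
  have hsig : ∑' v : Fin 2 → ℤ, 1 / (quadForm y v : ℂ) ^ s =
      ∑' p : (Σ r : ℕ, EisensteinSeries.gammaSet 1 r 0),
        1 / (quadForm y (p.2 : Fin 2 → ℤ) : ℂ) ^ s :=
    (EisensteinSeries.gammaSetDivGcdSigmaEquiv.symm.tsum_eq
      (fun v : Fin 2 → ℤ => 1 / (quadForm y v : ℂ) ^ s)).symm
  have hsig' : Summable fun p : (Σ r : ℕ, EisensteinSeries.gammaSet 1 r 0) =>
      1 / (quadForm y (p.2 : Fin 2 → ℤ) : ℂ) ^ s :=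
    (summable_quadForm_cpow hy hs).comp_injective
      EisensteinSeries.gammaSetDivGcdSigmaEquiv.symm.injective
  rw [hsig, hsig'.tsum_sigma, zeta_eq_tsum_one_div_nat_cpow h2, ← tsum_mul_right]
  exact tsum_congr fun r => tsum_gammaSet_quadForm hy hs0 r

/-! ### Cosets and coprime pairs -/

/-- The bottom row of a matrix, up to a sign. -/
noncomputable def cosetRow (p : Quotient (QuotientGroup.rightRel stabInfty) × ℤˣ) :
    EisensteinSeries.gammaSet 1 1 0 :=
  ⟨fun i => (p.2 : ℤ) * p.1.out 1 i, by
    rw [EisensteinSeries.mem_gammaSet_one]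
    exact (isCoprime_mul_unit_left p.2.isUnit _ _).mpr (ModularGroup.bottom_row_coprime p.1.out)⟩

theorem mul_inv_one_zero (g h : SL(2, ℤ)) : (g * h⁻¹) 1 0 = g 1 0 * h 1 1 - g 1 1 * h 1 0 := by
  simp [Matrix.SpecialLinearGroup.coe_inv, Matrix.adjugate_fin_two, Matrix.mul_apply,
    Fin.sum_univ_two]
  ring

theorem exists_unit_of_rel {g h : SL(2, ℤ)} (hgh : g * h⁻¹ ∈ stabInfty) :
    ∃ ε : ℤˣ, ∀ i, h 1 i = ε * g 1 i := by
  have h0 : (g * h⁻¹) 1 0 = 0 := hgh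
  obtain ⟨k, hk⟩ : ∃ k, k = g * h⁻¹ := ⟨_, rfl⟩
  rw [← hk] at h0
  have hg : g = k * h := by rw [hk, inv_mul_cancel_right]
  have hdet : k 0 0 * k 1 1 = 1 := by
    have h := k.det_coe
    rw [Matrix.det_fin_two, h0] at h
    simpa using h
  have hu : k 1 1 * k 0 0 = 1 := by rw [mul_comm]; exact hdet
  refine ⟨⟨k 0 0, k 1 1, hdet, hu⟩, fun i => ?_⟩
  rw [hg]
  simp only [Matrix.SpecialLinearGroup.coe_mul, Matrix.mul_apply, Fin.sum_univ_two, h0, zero_mul,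
    zero_add]
  rw [← mul_assoc, hdet, one_mul]

/-- The lower left entry of `g h⁻¹` is the determinant formed by the two bottom rows, so rows equal
up to sign determine the coset. The extra sign records which of the two rows `±(c, d)` is meant, and
accounts for the factor `1/2` in `eisensteinSum_eq`. -/
theorem cosetRow_bijective : Function.Bijective cosetRow := by
  constructor
  · rintro ⟨p, ε⟩ ⟨q, δ⟩ h
    have hi : ∀ i, (ε : ℤ) * p.out 1 i = δ * q.out 1 i := fun i =>
      congrFun (congrArg Subtype.val h) i
    have hp : p = q := by
      rw [← Quotient.out_eq p, ← Quotient.out_eq q]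
      refine Quotient.sound (QuotientGroup.rightRel_apply.mpr ?_)
      change (q.out * p.out⁻¹) 1 0 = 0
      rw [mul_inv_one_zero]
      have hε : (ε : ℤ) * ε = 1 := by rw [← Units.val_mul, Int.units_mul_self, Units.val_one]
      have e : ∀ i, p.out 1 i = ε * (δ * q.out 1 i) := fun i => by
        rw [← hi, ← mul_assoc, hε, one_mul]
      rw [e 0, e 1]
      ring
    subst hp
    have : ∃ i, p.out 1 i ≠ 0 := by
      by_contra! hc
      have := ModularGroup.bottom_row_coprime p.out
      rw [hc 0, hc 1] at this
      exact not_isCoprime_zero_zero this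
    obtain ⟨i, hne⟩ := this
    have := mul_right_cancel₀ hne (hi i)
    rw [Units.ext this]
  · rintro ⟨v, hv⟩
    obtain ⟨g, -, hg⟩ := ModularGroup.bottom_row_surj (R := ℤ)
      ((EisensteinSeries.mem_gammaSet_one v).mp hv)
    have hrel : g * (Quotient.mk (QuotientGroup.rightRel stabInfty) g).out⁻¹ ∈ stabInfty :=
      QuotientGroup.rightRel_apply.mp (Quotient.mk_out (s := QuotientGroup.rightRel stabInfty) g)
    obtain ⟨ε, hε⟩ := exists_unit_of_rel hrel
    refine ⟨(Quotient.mk _ g, ε), Subtype.ext (funext fun i => ?_)⟩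
    change (ε : ℤ) * (Quotient.mk (QuotientGroup.rightRel stabInfty) g).out 1 i = v i
    rw [hε, ← mul_assoc, ← Units.val_mul, Int.units_mul_self, Units.val_one, one_mul]
    exact congrFun hg i

theorem imCoset_eq {y : ℝ} (hy : 0 < y) (p : Quotient (QuotientGroup.rightRel stabInfty) × ℤˣ) :
    imCoset (UpperHalfPlane.ofComplex ((y : ℂ) * I)) p.1 =
      1 / quadForm y (cosetRow p : Fin 2 → ℤ) := by
  have him : 0 < ((y : ℂ) * I).im := by simpa using hy
  have h1 : imCoset (UpperHalfPlane.ofComplex ((y : ℂ) * I)) p.1 =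
      (p.1.out • UpperHalfPlane.ofComplex ((y : ℂ) * I)).im := by
    conv_lhs => rw [← Quotient.out_eq p.1]
    rfl
  have hsq : (((p.2 : ℤ) : ℝ)) ^ 2 = 1 := by
    have : (p.2 : ℤ) ^ 2 = 1 := by rw [← Units.val_pow_eq_pow_val, Int.units_sq, Units.val_one]
    exact_mod_cast this
  rw [h1, ModularGroup.im_smul_eq_div_normSq, ModularGroup.denom_apply,
    UpperHalfPlane.ofComplex_apply_of_im_pos him, quadForm]
  simp only [cosetRow, Int.cast_mul, mul_pow, hsq, one_mul]
  have hn : Complex.normSq ((p.1.out 1 0 : ℂ) * (y * I) + p.1.out 1 1) =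
      y * (y * (p.1.out 1 0 : ℝ) ^ 2 + y⁻¹ * (p.1.out 1 1 : ℝ) ^ 2) := by
    rw [Complex.normSq_apply]
    simp
    field_simp
    ring
  rw [hn]
  change ((y : ℂ) * I).im / _ = _
  rw [show ((y : ℂ) * I).im = y by simp, div_mul_cancel_left₀ hy.ne', one_div]

theorem eisensteinSum_eq {y : ℝ} (hy : 0 < y) {s : ℂ} (hs : 1 < s.re) :
    eisensteinSum (UpperHalfPlane.ofComplex ((y : ℂ) * I)) s =
      1 / 2 * ∑' v : EisensteinSeries.gammaSet 1 1 0, 1 / (quadForm y (v : Fin 2 → ℤ) : ℂ) ^ s := by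
  have hsum : Summable fun v : EisensteinSeries.gammaSet 1 1 0 =>
      1 / (quadForm y (v : Fin 2 → ℤ) : ℂ) ^ s := (summable_quadForm_cpow hy hs).subtype _
  have hterm : ∀ p : Quotient (QuotientGroup.rightRel stabInfty) × ℤˣ,
      1 / (quadForm y (cosetRow p : Fin 2 → ℤ) : ℂ) ^ s =
        (imCoset (UpperHalfPlane.ofComplex ((y : ℂ) * I)) p.1 : ℂ) ^ s := by
    intro p
    rw [imCoset_eq hy, one_div, one_div, Complex.ofReal_inv, Complex.inv_cpow]
    rw [Complex.arg_ofReal_of_nonneg (quadForm_nonneg hy _)]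
    exact Real.pi_pos.ne
  have h1 := (Equiv.ofBijective cosetRow cosetRow_bijective).tsum_eq
    (fun v : EisensteinSeries.gammaSet 1 1 0 => 1 / (quadForm y (v : Fin 2 → ℤ) : ℂ) ^ s)
  have h2 := (Equiv.ofBijective cosetRow cosetRow_bijective).summable_iff.mpr hsum
  simp only [Function.comp_def, Equiv.ofBijective_apply, hterm] at h1 h2
  rw [← h1, h2.tsum_prod, eisensteinSum, ← tsum_mul_left]
  refine tsum_congr fun q => ?_
  rw [tsum_fintype]
  simp

theorem theta_mul_eisensteinSum {y : ℝ} (hy : 0 < y) {s : ℂ} (hs : 1 < s.re) :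
    theta s * eisensteinSum (UpperHalfPlane.ofComplex ((y : ℂ) * I)) s =
      1 / 2 * (eisPair hy).Λ s := by
  rw [eisensteinSum_eq hy hs, eisPair_Λ_eq_tsum hy hs, tsum_quadForm_eq hy hs, theta]
  ring

theorem analyticAt_eisPair_Λ {y : ℝ} (hy : 0 < y) {s : ℂ} (h0 : s ≠ 0) (h1 : s ≠ 1) :
    AnalyticAt ℂ (eisPair hy).Λ s := by
  rw [Complex.analyticAt_iff_eventually_differentiableAt]
  filter_upwards [isOpen_ne.mem_nhds h0, isOpen_ne.mem_nhds h1] with z hz0 hz1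
  exact (eisPair hy).differentiableAt_Λ (Or.inl hz0) (Or.inl (by simpa [eisPair] using hz1))

theorem meromorphic_eisPair_Λ {y : ℝ} (hy : 0 < y) : MeromorphicOn (eisPair hy).Λ univ := by
  intro s _
  have h0 : AnalyticAt ℂ (eisPair hy).Λ₀ s := (eisPair hy).differentiable_Λ₀.analyticAt s
  refine (h0.meromorphicAt.sub ?_).sub ?_
  · exact ((MeromorphicAt.const (1 : ℂ) s).div analyticAt_id.meromorphicAt).smul
      (MeromorphicAt.const (eisPair hy).f₀ s)
  · exact ((MeromorphicAt.const (eisPair hy).ε s).div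
      ((MeromorphicAt.const _ s).sub analyticAt_id.meromorphicAt)).smul
      (MeromorphicAt.const (eisPair hy).g₀ s)

theorem analyticAt_completedRiemannZeta {s : ℂ} (h0 : s ≠ 0) (h1 : s ≠ 1) :
    AnalyticAt ℂ completedRiemannZeta s := by
  rw [Complex.analyticAt_iff_eventually_differentiableAt]
  filter_upwards [isOpen_ne.mem_nhds h0, isOpen_ne.mem_nhds h1] with z hz0 hz1
  exact differentiableAt_completedZeta hz0 hz1

theorem meromorphicAt_completedRiemannZeta (s : ℂ) : MeromorphicAt completedRiemannZeta s := by
  have e : completedRiemannZeta = fun s => completedRiemannZeta₀ s - 1 / s - 1 / (1 - s) :=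
    funext completedRiemannZeta_eq
  rw [e]
  have h0 : AnalyticAt ℂ completedRiemannZeta₀ s := differentiable_completedZeta₀.analyticAt s
  exact (h0.meromorphicAt.sub ((MeromorphicAt.const (1 : ℂ) s).div analyticAt_id.meromorphicAt)).sub
    ((MeromorphicAt.const (1 : ℂ) s).div
      ((MeromorphicAt.const (1 : ℂ) s).sub analyticAt_id.meromorphicAt))

/-- The value of the continued Eisenstein series on the critical line. -/
theorem theta_mul_eisensteinE {y : ℝ} (hy : 0 < y) {T : ℝ} (hT : T ≠ 0) :
    theta (1 / 2 + I * T) *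
        eisensteinE (UpperHalfPlane.ofComplex ((y : ℂ) * I)) (1 / 2 + I * T) =
      1 / 2 * (eisPair hy).Λ (1 / 2 + I * T) := by
  -- A global meromorphic extension of the Eisenstein series, analytic at `1/2 + iT` because zeta
  -- does not vanish on `Re s = 1`.
  set G : ℂ → ℂ := fun s => 1 / 2 * (eisPair hy).Λ s / completedRiemannZeta (2 * s) with hG
  have hmul : ∀ s : ℂ, AnalyticAt ℂ (fun s : ℂ => 2 * s) s := fun s =>
    analyticAt_const.mul analyticAt_id
  have hmer : MeromorphicOn G univ := fun s hs =>
    ((MeromorphicAt.const (1 / 2 : ℂ) s).mul (meromorphic_eisPair_Λ hy s hs)).div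
      (MeromorphicAt.comp_analyticAt (f := completedRiemannZeta)
        (meromorphicAt_completedRiemannZeta (2 * s)) (hmul s))
  have han : ∀ s : ℂ, s ≠ 0 → s ≠ 1 → 2 * s ≠ 1 → completedRiemannZeta (2 * s) ≠ 0 →
      AnalyticAt ℂ G s := fun s h0 h1 h2 hz =>
    (analyticAt_const.mul (analyticAt_eisPair_Λ hy h0 h1)).div
      (AnalyticAt.comp (g := completedRiemannZeta)
        (analyticAt_completedRiemannZeta (mul_ne_zero two_ne_zero h0) h2) (hmul s)) hz
  have hzne : ∀ s : ℂ, 1 < s.re → theta s ≠ 0 := fun s hs => by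
    rw [theta_eq_completedRiemannZeta (by linarith),
      completedRiemannZeta_eq_Gammaℝ_mul (by simp; linarith)]
    exact mul_ne_zero (Gammaℝ_ne_zero_of_re_pos (by simp; linarith))
      (riemannZeta_ne_zero_of_one_le_re (by simp; linarith))
  have hhalf : (1 / 2 + I * T : ℂ).re = 1 / 2 := by simp
  have himg : (1 / 2 + I * T : ℂ).im = T := by simp
  have hval := meromorphicContinuation_eq (σ := 1)
    (f := eisensteinSum (UpperHalfPlane.ofComplex ((y : ℂ) * I))) hmer (fun s hs => by
      refine han s (fun h => ?_) (fun h => ?_) (fun h => ?_) ?_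
      · rw [h, Complex.zero_re] at hs
        linarith
      · rw [h, Complex.one_re] at hs
        linarith
      · have := congrArg Complex.re h
        simp at this
        linarith
      · rw [← theta_eq_completedRiemannZeta (by linarith)]
        exact hzne s hs) (fun s hs => by
      simp only [hG]
      rw [← theta_mul_eisensteinSum hy hs, ← theta_eq_completedRiemannZeta (by linarith),
        mul_div_cancel_left₀ _ (hzne s hs)]) (s₀ := 1 / 2 + I * T) (by
      refine han _ (fun h => ?_) (fun h => ?_) (fun h => ?_) ?_
      · rw [h] at himg
        exact hT (by simpa using himg.symm)
      · rw [h] at himg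
        exact hT (by simpa using himg.symm)
      · have := congrArg Complex.im h
        simp at this
        exact hT this
      · rw [← theta_eq_completedRiemannZeta (by rw [hhalf]; norm_num)]
        exact theta_ne_zero T)
  rw [eisensteinE, hval]
  simp only [hG]
  rw [← theta_eq_completedRiemannZeta (by rw [hhalf]; norm_num),
    mul_div_cancel₀ _ (theta_ne_zero T)]

end GeodesicEisenstein

/-! ### The `L`-function and the Gamma factor -/

namespace GeodesicEisenstein

theorem meromorphicAt_riemannZeta (s : ℂ) : MeromorphicAt riemannZeta s := by
  by_cases h : s = 1
  · have h1 : MeromorphicAt (fun s => completedRiemannZeta s * (Gammaℝ s)⁻¹) s :=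
      (meromorphicAt_completedRiemannZeta s).mul
        (differentiable_Gammaℝ_inv.analyticAt s).meromorphicAt
    refine h1.congr (Filter.Eventually.filter_mono nhdsWithin_le_nhds ?_)
    filter_upwards [isOpen_ne.mem_nhds (show s ≠ 0 by rw [h]; exact one_ne_zero)] with z hz
    rw [riemannZeta_def_of_ne_zero hz, div_eq_mul_inv]
  · exact (analyticOn_riemannZeta s h).meromorphicAt

theorem lseriesHasSum_natCast_cpow {s a : ℂ} (hs : 1 < (s - a).re) :
    LSeriesSummable (fun n : ℕ => (n : ℂ) ^ a) s ∧
      LSeries (fun n : ℕ => (n : ℂ) ^ a) s = riemannZeta (s - a) := by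
  have hne : s - a ≠ 0 := fun h => by
    rw [h, Complex.zero_re] at hs
    linarith
  have hterm : LSeries.term (fun n : ℕ => (n : ℂ) ^ a) s = fun n : ℕ => 1 / (n : ℂ) ^ (s - a) := by
    funext n
    rcases eq_or_ne n 0 with rfl | hn
    · rw [LSeries.term_zero, Nat.cast_zero, Complex.zero_cpow hne, div_zero]
    · have hn' : (n : ℂ) ≠ 0 := by exact_mod_cast hn
      rw [LSeries.term_of_ne_zero hn, Complex.cpow_sub _ _ hn', one_div_div]
  refine ⟨?_, ?_⟩
  · rw [LSeriesSummable, hterm]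
    exact Complex.summable_one_div_nat_cpow.mpr hs
  · rw [LSeries, hterm, zeta_eq_tsum_one_div_nat_cpow hs]

theorem tau_eq_convolution (T : ℝ) : tau T = LSeries.convolution (fun n : ℕ => (n : ℂ) ^ (I * (T : ℂ)))
    (fun n : ℕ => (n : ℂ) ^ (-(I * (T : ℂ)))) := by
  rw [LSeries.convolution_def]
  funext n
  refine Finset.sum_congr rfl fun p _ => ?_
  have h1 : ((p.1 : ℂ) / (p.2 : ℂ)) = ((p.1 : ℝ) : ℂ) * (((p.2 : ℝ)⁻¹ : ℝ) : ℂ) := by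
    push_cast
    rfl
  rw [h1, Complex.mul_cpow_ofReal_nonneg (by positivity) (by positivity), Complex.cpow_neg,
    Complex.ofReal_inv, Complex.inv_cpow, Complex.ofReal_natCast, Complex.ofReal_natCast]
  rw [Complex.arg_ofReal_of_nonneg (by positivity)]
  exact Real.pi_pos.ne

/-- The coefficients are the Dirichlet convolution of `n^{iT}` and `n^{-iT}`, so the identity holds
for `Re s > 1`, and uniqueness of continuation extends it. -/
theorem LEis_eq {T : ℝ} {s : ℂ} (h1 : s + I * T ≠ 1) (h2 : s - I * T ≠ 1) :
    LEis T s = riemannZeta (s + I * T) * riemannZeta (s - I * T) := by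
  have hp : ∀ s : ℂ, AnalyticAt ℂ (fun s => s + I * T) s := fun s => analyticAt_id.add analyticAt_const
  have hm : ∀ s : ℂ, AnalyticAt ℂ (fun s => s - I * T) s := fun s => analyticAt_id.sub analyticAt_const
  have han : ∀ s : ℂ, s + I * T ≠ 1 → s - I * T ≠ 1 →
      AnalyticAt ℂ (fun s => riemannZeta (s + I * T) * riemannZeta (s - I * T)) s := fun s h1 h2 =>
    (AnalyticAt.comp (g := riemannZeta) (f := fun s => s + I * T) (analyticOn_riemannZeta _ h1) (hp s)).mul
      (AnalyticAt.comp (g := riemannZeta) (f := fun s => s - I * T) (analyticOn_riemannZeta _ h2) (hm s))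
  have hne : ∀ s : ℂ, 1 < s.re → ∀ b : ℝ, s + I * b ≠ 1 := fun s hs b h => by
    have := congrArg Complex.re h
    simp at this
    linarith
  refine meromorphicContinuation_eq
    (G := fun s => riemannZeta (s + I * T) * riemannZeta (s - I * T)) (fun s _ => ?_)
    (fun s hs => han s (hne s hs T) ?_) (fun s hs => ?_) (han s h1 h2)
  · exact (MeromorphicAt.comp_analyticAt (f := riemannZeta) (meromorphicAt_riemannZeta _) (hp s)).mul
      (MeromorphicAt.comp_analyticAt (f := riemannZeta) (meromorphicAt_riemannZeta _) (hm s))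
  · have := hne s hs (-T)
    rwa [Complex.ofReal_neg, mul_neg, ← sub_eq_add_neg] at this
  · have ha := lseriesHasSum_natCast_cpow (s := s) (a := I * T) (by simpa using hs)
    have hb := lseriesHasSum_natCast_cpow (s := s) (a := -(I * T)) (by simpa using hs)
    rw [tau_eq_convolution, LSeries_convolution' ha.1 hb.1, ha.2, hb.2, sub_neg_eq_add, mul_comm]

/-! ### The Beta integral in hyperbolic form -/

/-- Substitute the sigmoid `x = e^{v/2} / (2 cosh(v/2))`, for which `dx = x (1 - x) dv`, and then `v
= 2u`. -/
theorem betaIntegral_eq_integral_cosh (a b : ℂ) : betaIntegral a b =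
    2 * ∫ u : ℝ, Complex.exp ((a - b) * u) * ((2 * Real.cosh u : ℝ) : ℂ) ^ (-(a + b)) := by
  have h1 : betaIntegral a b = ∫ v : ℝ, Complex.exp ((a - b) * (v / 2 : ℝ)) *
      ((2 * Real.cosh (v / 2) : ℝ) : ℂ) ^ (-(a + b)) := by
    rw [betaIntegral, intervalIntegral.integral_of_le zero_le_one, integral_Ioc_eq_integral_Ioo,
      ← Real.range_sigmoid, ← image_univ, integral_image_eq_integral_abs_deriv_smul
        MeasurableSet.univ (fun x _ => (Real.hasDerivAt_sigmoid x).hasDerivWithinAt)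
        Real.sigmoid_injective.injOn, setIntegral_univ]
    refine integral_congr_ae (ae_of_all _ fun v => ?_)
    have hc : 0 < 2 * Real.cosh (v / 2) := mul_pos two_pos (Real.cosh_pos _)
    have hlog : ∀ w : ℝ, Real.sigmoid w = Real.exp (w / 2 - Real.log (2 * Real.cosh (w / 2))) := by
      intro w
      have hc : 0 < 2 * Real.cosh (w / 2) := mul_pos two_pos (Real.cosh_pos _)
      rw [Real.sigmoid_def, Real.exp_sub, Real.exp_log hc, Real.cosh_eq,
        show Real.exp (-w) = Real.exp (-(w / 2)) / Real.exp (w / 2) by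
          rw [← Real.exp_sub]; ring_nf]
      have := Real.exp_pos (w / 2)
      have := Real.exp_pos (-(w / 2))
      field_simp
    have hneg : 1 - Real.sigmoid v = Real.exp (-(v / 2) - Real.log (2 * Real.cosh (v / 2))) := by
      rw [← Real.sigmoid_neg, hlog, neg_div, Real.cosh_neg]
    have hcp : ∀ (x : ℝ) (c : ℂ), ((Real.exp x : ℝ) : ℂ) ^ c = Complex.exp (x * c) := fun x c => by
      rw [Complex.cpow_def_of_ne_zero (by exact_mod_cast (Real.exp_pos x).ne'),
        ← Complex.ofReal_log (Real.exp_pos x).le, Real.log_exp]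
    simp only
    rw [abs_of_nonneg (mul_nonneg (Real.sigmoid_nonneg v) (by linarith [Real.sigmoid_le_one v])),
      ← Complex.ofReal_one, ← Complex.ofReal_sub, hneg, hlog v, hcp, hcp, Complex.real_smul,
      Complex.ofReal_mul, Complex.ofReal_exp, Complex.ofReal_exp,
      Complex.cpow_def_of_ne_zero (by exact_mod_cast hc.ne'), ← Complex.ofReal_log hc.le,
      ← Complex.exp_add, ← Complex.exp_add, ← Complex.exp_add, ← Complex.exp_add]
    congr 1
    push_cast
    ring
  rw [h1]
  have h2 := Measure.integral_comp_mul_right (fun u : ℝ => Complex.exp ((a - b) * u) *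
    ((2 * Real.cosh u : ℝ) : ℂ) ^ (-(a + b))) (2⁻¹ : ℝ)
  rw [inv_inv, abs_two, Complex.real_smul, Complex.ofReal_ofNat] at h2
  rw [← h2]
  simp only [div_eq_mul_inv]

theorem integrableOn_cosh_rpow {σ : ℝ} (hσ : 0 < σ) :
    IntegrableOn (fun u : ℝ => Real.cosh u ^ (-σ)) (Ioi 0) := by
  have h := (integrableOn_Ioi_comp_mul_left_iff (fun u => Real.exp (-u)) 0 hσ).mpr
    (by rw [mul_zero]; exact integrableOn_exp_neg_Ioi 0)
  refine Integrable.mono' (h.const_mul (2 ^ σ)) ?_ (ae_of_all _ fun u => ?_)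
  · refine (Continuous.rpow_const Real.continuous_cosh fun u => Or.inl ?_).aestronglyMeasurable
    exact (Real.cosh_pos u).ne'
  · have hc := Real.cosh_pos u
    rw [Real.norm_of_nonneg (by positivity), Real.rpow_neg hc.le, Real.exp_neg, ← div_eq_mul_inv,
      inv_eq_one_div, div_le_div_iff₀ (by positivity) (by positivity), one_mul,
      show σ * u = u * σ by ring, Real.exp_mul, ← Real.mul_rpow (by norm_num) hc.le]
    gcongr
    rw [Real.cosh_eq]
    have := Real.exp_pos (-u)
    linarith

theorem integral_cosh_mul_cosh_cpow (T : ℝ) {w : ℂ} (hw : 0 < w.re) :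
    ∫ u in Ioi (0 : ℝ), Complex.cosh (I * T * u) * (Real.cosh u : ℂ) ^ (-w) =
      2 ^ (w - 2) * betaIntegral ((w + I * T) / 2) ((w - I * T) / 2) := by
  set f : ℝ → ℝ → ℂ := fun T u => Complex.exp (I * T * u) * (Real.cosh u : ℂ) ^ (-w) with hf
  have hcont : ∀ T, Continuous (f T) := fun T => by
    refine Continuous.mul (by fun_prop) ?_
    exact (Complex.continuous_ofReal.comp Real.continuous_cosh).cpow continuous_const
      fun u => Or.inl (by simpa using Real.cosh_pos u)
  have hint : ∀ T, IntegrableOn (f T) (Ioi 0) := fun T => by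
    refine Integrable.mono' (integrableOn_cosh_rpow hw) (hcont T).aestronglyMeasurable
      (ae_of_all _ fun u => ?_)
    simp only [hf]
    rw [norm_mul, Complex.norm_exp, Complex.norm_cpow_eq_rpow_re_of_pos (Real.cosh_pos u)]
    simp
  have hneg : ∀ T u, f T (-u) = f (-T) u := fun T u => by
    simp only [hf, Real.cosh_neg]
    push_cast
    ring_nf
  have hIic : IntegrableOn (f T) (Iic 0) := by
    have h := (hint (-T)).comp_neg
    simp only [hneg, neg_neg, Set.neg_Ioi, neg_zero] at h
    exact (integrableOn_Iic_iff_integrableOn_Iio (b := 0)).mpr h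
  have hsplit := intervalIntegral.integral_Iic_add_Ioi hIic (hint T)
  have hI : ∫ u in Iic (0 : ℝ), f T u = ∫ u in Ioi (0 : ℝ), f (-T) u := by
    have := integral_comp_neg_Ioi (0 : ℝ) (f T)
    rw [neg_zero] at this
    rw [← this]
    simp only [hneg]
  have hL : ∫ u in Ioi (0 : ℝ), Complex.cosh (I * T * u) * (Real.cosh u : ℂ) ^ (-w) =
      1 / 2 * ∫ u : ℝ, f T u := by
    rw [← hsplit, hI, ← integral_add (hint _) (hint _), ← integral_const_mul]
    refine integral_congr_ae (ae_of_all _ fun u => ?_)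
    simp only [hf, Complex.cosh]
    push_cast
    ring_nf
  rw [hL, betaIntegral_eq_integral_cosh, show (w + I * T) / 2 - (w - I * T) / 2 = I * T by ring,
    show (w + I * T) / 2 + (w - I * T) / 2 = w by ring, ← mul_assoc, ← integral_const_mul,
    ← integral_const_mul]
  refine integral_congr_ae (ae_of_all _ fun u => ?_)
  simp only [hf]
  rw [Complex.ofReal_mul, Complex.mul_cpow_ofReal_nonneg (by norm_num) (Real.cosh_pos u).le,
    Complex.cpow_sub _ _ two_ne_zero, Complex.cpow_neg, Complex.ofReal_ofNat]
  have h2 : (2 : ℂ) ^ w ≠ 0 := by simp [Complex.cpow_eq_zero_iff]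
  rw [Complex.cpow_neg 2 w]
  norm_num
  field_simp
  norm_num

/-! ### The Mellin transform of the Bessel function -/

/-- Integrating first over `y` gives `Γ(w) (cosh u)^{-w}`; the remaining integral is a Beta
function, whose denominator `Γ(w)` cancels. -/
theorem mellin_besselK (T : ℝ) {w : ℂ} (hw : 0 < w.re) :
    mellin (besselK (I * T)) w =
      2 ^ (w - 2) * Complex.Gamma ((w + I * T) / 2) * Complex.Gamma ((w - I * T) / 2) := by
  set F : ℝ → ℝ → ℂ := fun y u => (y : ℂ) ^ (w - 1) *
    Complex.exp (-((Real.cosh u : ℝ) * y)) * Complex.cosh (I * T * u) with hF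
  have hinner : ∀ u : ℝ, ∫ y in Ioi (0 : ℝ), F y u =
      Complex.Gamma w * (Complex.cosh (I * T * u) * (Real.cosh u : ℂ) ^ (-w)) := fun u => by
    simp only [hF]
    rw [integral_mul_const, Complex.integral_cpow_mul_exp_neg_mul_Ioi hw
      (by simpa using Real.cosh_pos u), one_div, Complex.inv_cpow _ _ (by
        rw [Complex.arg_ofReal_of_nonneg (Real.cosh_pos u).le]; exact Real.pi_pos.ne),
      Complex.cpow_neg]
    ring
  have hnormF : ∀ y : ℝ, 0 < y → ∀ u : ℝ, ‖F y u‖ ≤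
      y ^ (w.re - 1) * Real.exp (-(Real.cosh u * y)) := fun y hy u => by
    simp only [hF]
    rw [norm_mul, norm_mul, Complex.norm_cpow_eq_rpow_re_of_pos hy, Complex.norm_exp]
    have h1 : ‖Complex.cosh (I * T * u)‖ ≤ 1 := by
      rw [show I * T * u = ((T * u : ℝ) : ℂ) * I by push_cast; ring, Complex.cosh_mul_I,
        ← Complex.ofReal_cos, Complex.norm_real]
      exact Real.abs_cos_le_one _
    have h2 : (-(((Real.cosh u : ℝ) : ℂ) * (y : ℂ))).re = -(Real.cosh u * y) := by
      rw [← Complex.ofReal_mul, ← Complex.ofReal_neg, Complex.ofReal_re]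
    rw [h2, Complex.sub_re, Complex.one_re]
    exact mul_le_of_le_one_right (by positivity) h1
  have hmeas : AEStronglyMeasurable (Function.uncurry F)
      ((volume.restrict (Ioi 0)).prod (volume.restrict (Ioi 0))) := by
    refine Measurable.aestronglyMeasurable ?_
    simp only [hF, Function.uncurry_def]
    fun_prop
  have hdom : Integrable (Function.uncurry fun y u : ℝ =>
      y ^ (w.re - 1) * Real.exp (-(Real.cosh u * y)))
      ((volume.restrict (Ioi 0)).prod (volume.restrict (Ioi 0))) := by
    have hm : AEStronglyMeasurable (Function.uncurry fun y u : ℝ =>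
        y ^ (w.re - 1) * Real.exp (-(Real.cosh u * y)))
        ((volume.restrict (Ioi 0)).prod (volume.restrict (Ioi 0))) := by
      refine Measurable.aestronglyMeasurable ?_
      simp only [Function.uncurry_def]
      fun_prop
    rw [integrable_prod_iff' hm]
    refine ⟨ae_of_all _ fun u => ?_, ?_⟩
    · have := integrableOn_rpow_mul_exp_neg_mul_rpow (s := w.re - 1) (p := 1) (b := Real.cosh u)
        (by linarith) one_pos (Real.cosh_pos u)
      simpa [IntegrableOn] using this
    · refine ((integrableOn_cosh_rpow hw).const_mul (Real.Gamma w.re)).congr (ae_of_all _ fun u => ?_)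
      have h1 : ∫ y in Ioi (0 : ℝ), ‖y ^ (w.re - 1) * Real.exp (-(Real.cosh u * y))‖ =
          ∫ y in Ioi (0 : ℝ), y ^ (w.re - 1) * Real.exp (-(Real.cosh u * y)) :=
        setIntegral_congr_fun measurableSet_Ioi fun y (hy : 0 < y) =>
          Real.norm_of_nonneg (by positivity)
      simp only [Function.uncurry_apply_pair]
      rw [h1, Real.integral_rpow_mul_exp_neg_mul_Ioi hw (Real.cosh_pos u), one_div,
        Real.inv_rpow (Real.cosh_pos u).le, Real.rpow_neg (Real.cosh_pos u).le, mul_comm]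
  have hprod : Integrable (Function.uncurry F)
      ((volume.restrict (Ioi 0)).prod (volume.restrict (Ioi 0))) := by
    refine hdom.mono' hmeas ?_
    rw [Measure.prod_restrict]
    filter_upwards [ae_restrict_mem (measurableSet_Ioi.prod measurableSet_Ioi)] with p hp
    exact hnormF p.1 hp.1 p.2
  have h1 : mellin (besselK (I * T)) w = ∫ y in Ioi (0 : ℝ), ∫ u in Ioi (0 : ℝ), F y u := by
    rw [mellin]
    refine integral_congr_ae (ae_of_all _ fun y => ?_)
    simp only [besselK, smul_eq_mul]
    rw [← integral_const_mul]
    refine integral_congr_ae (ae_of_all _ fun u => ?_)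
    simp only [hF]
    push_cast
    ring_nf
  have hre : ∀ c : ℝ, 0 < ((w + I * c) / 2).re := fun c => by
    rw [show ((w + I * c) / 2).re = w.re / 2 by simp]
    linarith
  have hre' : 0 < ((w - I * T) / 2).re := by
    have := hre (-T)
    rwa [Complex.ofReal_neg, mul_neg, ← sub_eq_add_neg] at this
  rw [h1, integral_integral_swap hprod, integral_congr_ae (ae_of_all _ hinner), integral_const_mul,
    integral_cosh_mul_cosh_cpow T hw, mul_assoc, Complex.Gamma_mul_Gamma_eq_betaIntegral (hre T) hre',
    show (w + I * T) / 2 + (w - I * T) / 2 = w by ring]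
  ring

theorem gammaV_eq (T : ℝ) {w : ℂ} (hw : 0 < w.re) : gammaV T w =
    (Real.pi : ℂ) ^ (1 / 2 : ℂ) * 2 ^ (-(3 / 2) : ℂ) * ((Real.pi : ℂ) ^ (-w) *
      Complex.Gamma ((w + I * T) / 2) * Complex.Gamma ((w - I * T) / 2)) := by
  have h1 : mellin (VBessel T) (w - 1 / 2) = mellin (besselK (I * T)) w := by
    rw [← sub_add_cancel w (1 / 2), ← mellin_cpow_smul, sub_add_cancel, mellin, mellin]
    refine setIntegral_congr_fun measurableSet_Ioi fun y hy => ?_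
    have hy' : (0 : ℝ) ≤ y := le_of_lt hy
    simp only [VBessel, smul_eq_mul]
    rw [Real.sqrt_eq_rpow, Complex.ofReal_cpow hy']
    push_cast
    rfl
  have hpi : (Real.pi : ℂ) ≠ 0 := by exact_mod_cast Real.pi_ne_zero
  have h2 : ((2 * Real.pi : ℝ) : ℂ) ^ (-(w - 1 / 2)) * 2 ^ (w - 2) =
      (Real.pi : ℂ) ^ (1 / 2 : ℂ) * 2 ^ (-(3 / 2) : ℂ) * (Real.pi : ℂ) ^ (-w) := by
    rw [Complex.ofReal_mul, Complex.mul_cpow_ofReal_nonneg (by norm_num) Real.pi_pos.le,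
      show -(w - 1 / 2) = 1 / 2 + -w by ring, Complex.cpow_add _ _ hpi, Complex.ofReal_ofNat]
    have h3 : (2 : ℂ) ^ (1 / 2 + -w) * 2 ^ (w - 2) = 2 ^ (-(3 / 2) : ℂ) := by
      rw [← Complex.cpow_add _ _ two_ne_zero]
      congr 1
      ring
    rw [← h3]
    ring
  rw [gammaV, mellin_comp_mul_left _ _ (by positivity), h1, mellin_besselK T hw, smul_eq_mul]
  linear_combination Complex.Gamma ((w + I * T) / 2) * Complex.Gamma ((w - I * T) / 2) * h2

/-- The two Gamma factors and `π^{-w}` are exactly what completes the two zeta functions; evenness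
of `critXi` replaces `t - T` by `T - t`. -/
theorem LEis_mul_gammaV {T : ℝ} (t : ℝ) :
    LEis T (1 / 2 + I * t) * gammaV T (1 / 2 + I * t) =
      (Real.pi : ℂ) ^ (1 / 2 : ℂ) * 2 ^ (-(3 / 2) : ℂ) * critKer T t := by
  have hpi : (Real.pi : ℂ) ≠ 0 := by exact_mod_cast Real.pi_ne_zero
  have hne : ∀ b : ℝ, (1 / 2 + I * t + I * b : ℂ) ≠ 1 := fun b h => by
    have := congrArg Complex.re h
    norm_num at this
  have hne' : (1 / 2 + I * t - I * T : ℂ) ≠ 1 := by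
    have := hne (-T)
    rwa [Complex.ofReal_neg, mul_neg, ← sub_eq_add_neg] at this
  rw [LEis_eq (hne T) hne', gammaV_eq T (by simp), critKer, ← neg_sub t T, critXi_neg, critXi, critXi,
    show (1 / 2 + I * ((T + t : ℝ) : ℂ) : ℂ) = 1 / 2 + I * t + I * T by push_cast; ring,
    show (1 / 2 + I * ((t - T : ℝ) : ℂ) : ℂ) = 1 / 2 + I * t - I * T by push_cast; ring,
    completedRiemannZeta_eq_Gammaℝ_mul (by simp), completedRiemannZeta_eq_Gammaℝ_mul (by simp),
    Gammaℝ_def, Gammaℝ_def]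
  have h : (Real.pi : ℂ) ^ (-(1 / 2 + I * t + I * T : ℂ) / 2) *
      (Real.pi : ℂ) ^ (-(1 / 2 + I * t - I * T : ℂ) / 2) = (Real.pi : ℂ) ^ (-(1 / 2 + I * t : ℂ)) := by
    rw [← Complex.cpow_add _ _ hpi]
    congr 1
    ring
  rw [← h]
  ring

end GeodesicEisenstein

/-! ### The symmetric kernel -/

namespace GeodesicEisenstein

theorem critKer_neg (T t : ℝ) : critKer T (-t) = critKer T t := by
  rw [critKer, critKer, sub_neg_eq_add, ← sub_eq_add_neg, mul_comm]

theorem conj_critKer (T t : ℝ) : (starRingEnd ℂ) (critKer T t) = critKer T t := by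
  rw [critKer, map_mul, conj_critXi, conj_critXi]

theorem integrable_critKer (T : ℝ) : Integrable (critKer T) := by
  refine ((integrable_critKer_comp T).comp_add_left T).congr (ae_of_all _ fun t => ?_)
  simp only [critKer]
  congr 2
  ring

/-- As `|T+t| + |T-t| ≥ 2T`, the exponentials multiply to at most `e^{-πT/2}` and the polynomial
bases to at least `T`. Near `t = ±T` one factor has bounded height, so the saving is `T^{-a}` and
not `T^{-2a}`. -/
theorem exists_norm_critKer_le {a : ℝ} (ha0 : 0 ≤ a) (ha : a < 1 / 12) : ∃ C : ℝ, 0 < C ∧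
    ∀ T : ℝ, 1 ≤ T → ∀ t : ℝ,
      ‖critKer T t‖ ≤ C * T ^ (-a) * Real.exp (-(Real.pi * T / 2)) := by
  obtain ⟨C, hC, h⟩ := exists_norm_critXi_le ha0 ha
  refine ⟨C ^ 2, by positivity, fun T hT t => ?_⟩
  have htri : 2 * T ≤ |T + t| + |T - t| := by
    have h1 := le_abs_self (T + t)
    have h2 := le_abs_self (T - t)
    linarith
  have hpos : 0 < (1 + |T + t|) * (1 + |T - t|) := by positivity
  have hpow : ((1 + |T + t|) * (1 + |T - t|)) ^ (-a) ≤ T ^ (-a) := by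
    refine Real.rpow_le_rpow_of_nonpos (by linarith) ?_ (by linarith)
    have := mul_nonneg (abs_nonneg (T + t)) (abs_nonneg (T - t))
    nlinarith
  have hexp : Real.exp (-(Real.pi * |T + t| / 4)) * Real.exp (-(Real.pi * |T - t| / 4)) ≤
      Real.exp (-(Real.pi * T / 2)) := by
    rw [← Real.exp_add]
    gcongr
    have := Real.pi_pos
    nlinarith
  rw [critKer, norm_mul]
  calc ‖critXi (T + t)‖ * ‖critXi (T - t)‖
      ≤ (C * (1 + |T + t|) ^ (-a) * Real.exp (-(Real.pi * |T + t| / 4))) *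
        (C * (1 + |T - t|) ^ (-a) * Real.exp (-(Real.pi * |T - t| / 4))) :=
        mul_le_mul (h _) (h _) (norm_nonneg _) (by positivity)
    _ = C ^ 2 * ((1 + |T + t|) * (1 + |T - t|)) ^ (-a) *
        (Real.exp (-(Real.pi * |T + t| / 4)) * Real.exp (-(Real.pi * |T - t| / 4))) := by
        rw [Real.mul_rpow (by positivity) (by positivity)]
        ring
    _ ≤ C ^ 2 * T ^ (-a) * Real.exp (-(Real.pi * T / 2)) := by gcongr

/-- The autocorrelation of the symmetric kernel. -/
noncomputable def critCorr (T v : ℝ) : ℂ := ∫ t : ℝ, critKer T t * critKer T (v - t)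

theorem critCorr_eq_convolution (T : ℝ) : critCorr T =
    MeasureTheory.convolution (critKer T) (critKer T) (ContinuousLinearMap.mul ℂ ℂ) volume := rfl

theorem integrable_critCorr (T : ℝ) : Integrable (critCorr T) := by
  rw [critCorr_eq_convolution]
  exact (integrable_critKer T).integrable_convolution _ (integrable_critKer T)

theorem integrable_mul_exp_I {g : ℝ → ℂ} (hg : Integrable g) (L : ℝ) :
    Integrable fun t : ℝ => g t * Complex.exp (-(I * t * L)) := by
  refine hg.mul_bdd (c := 1) (Continuous.aestronglyMeasurable (by fun_prop)) (ae_of_all _ fun t => ?_)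
  rw [Complex.norm_exp]
  simp

/-- The integral of a convolution is the product of the integrals, and the character factors out of
the convolution. -/
theorem geoP_sq {y : ℝ} (hy : 0 < y) (T : ℝ) : geoP T y ^ 2 =
    1 / (4 * Real.pi ^ 2) * ∫ v : ℝ, critCorr T v * Complex.exp (-(I * v * Real.log y)) := by
  have hf := integrable_mul_exp_I (integrable_critKer T) (Real.log y)
  have h := integral_convolution (ContinuousLinearMap.mul ℂ ℂ) hf hf
  rw [ContinuousLinearMap.mul_apply'] at h
  have h2 : ∀ v : ℝ, MeasureTheory.convolution
      (fun t : ℝ => critKer T t * Complex.exp (-(I * t * Real.log y)))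
      (fun t : ℝ => critKer T t * Complex.exp (-(I * t * Real.log y)))
      (ContinuousLinearMap.mul ℂ ℂ) volume v =
      critCorr T v * Complex.exp (-(I * v * Real.log y)) := fun v => by
    rw [convolution_mul, critCorr, ← integral_mul_const]
    refine integral_congr_ae (ae_of_all _ fun t => ?_)
    simp only
    rw [mul_mul_mul_comm, ← Complex.exp_add]
    congr 2
    push_cast
    ring
  rw [integral_congr_ae (ae_of_all _ h2)] at h
  rw [h, geoP_eq hy]
  ring

/-- The Fourier integral of a real even kernel is real. -/
theorem conj_geoP {y : ℝ} (hy : 0 < y) (T : ℝ) : (starRingEnd ℂ) (geoP T y) = geoP T y := by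
  have h : (starRingEnd ℂ) (∫ t : ℝ, critKer T t * Complex.exp (-(I * t * Real.log y))) =
      ∫ t : ℝ, critKer T t * Complex.exp (-(I * t * Real.log y)) := by
    rw [← integral_conj, ← integral_neg_eq_self]
    refine integral_congr_ae (ae_of_all _ fun t => ?_)
    simp only [map_mul, conj_critKer, critKer_neg, ← Complex.exp_conj]
    simp
  rw [geoP_eq hy, map_mul, h]
  simp [Complex.conj_ofNat]

theorem continuousOn_geoP (T : ℝ) : ContinuousOn (geoP T) (Ioi 0) := by
  have hc : Continuous fun L : ℝ => ∫ t : ℝ, critKer T t * Complex.exp (-(I * t * L)) := by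
    refine continuous_of_dominated (bound := fun t => ‖critKer T t‖)
      (fun L => (integrable_mul_exp_I (integrable_critKer T) L).aestronglyMeasurable)
      (fun L => ae_of_all _ fun t => ?_) (integrable_critKer T).norm (ae_of_all _ fun t => ?_)
    · rw [norm_mul, Complex.norm_exp]
      simp
    · fun_prop
  have h2 : ContinuousOn (fun y : ℝ => 1 / (2 * Real.pi : ℂ) *
      ∫ t : ℝ, critKer T t * Complex.exp (-(I * t * Real.log y))) (Ioi 0) :=
    continuousOn_const.mul (hc.comp_continuousOn (Real.continuousOn_log.mono fun y hy => (ne_of_gt hy)))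
  exact h2.congr fun y hy => geoP_eq hy T

/-! ### The moment integrals -/

theorem momentIntegrand_eq (T : ℝ) {v : ℂ} (hv : v.re = 0) (t : ℝ) :
    momentIntegrand T v ((t : ℂ) * I) =
      Real.pi / 8 * (critKer T (v.im + t) * critKer T t) := by
  have h1 : (1 / 2 + (t : ℂ) * I + v) = 1 / 2 + I * ((v.im + t : ℝ) : ℂ) := by
    apply Complex.ext <;> simp [hv, add_comm]
  have h2 : (1 / 2 - (t : ℂ) * I) = 1 / 2 + I * ((-t : ℝ) : ℂ) := by
    push_cast
    ring
  have hc : ((Real.pi : ℂ) ^ (1 / 2 : ℂ) * 2 ^ (-(3 / 2) : ℂ)) ^ 2 = Real.pi / 8 := by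
    rw [mul_pow, ← Complex.cpow_nat_mul, ← Complex.cpow_nat_mul,
      show ((2 : ℕ) : ℂ) * (1 / 2) = 1 by norm_num,
      show ((2 : ℕ) : ℂ) * (-(3 / 2)) = -((3 : ℕ) : ℂ) by norm_num, Complex.cpow_one,
      Complex.cpow_neg, Complex.cpow_natCast]
    norm_num
    ring
  have e1 := LEis_mul_gammaV (T := T) (v.im + t)
  have e2 := LEis_mul_gammaV (T := T) (-t)
  rw [critKer_neg] at e2
  rw [momentIntegrand, h1, h2, ← hc]
  linear_combination LEis T (1 / 2 + I * ((-t : ℝ) : ℂ)) * gammaV T (1 / 2 + I * ((-t : ℝ) : ℂ)) * e1 +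
    (Real.pi : ℂ) ^ (1 / 2 : ℂ) * 2 ^ (-(3 / 2) : ℂ) * critKer T (v.im + t) * e2

theorem exists_norm_critKer_bound (T : ℝ) : ∃ C : ℝ, ∀ t : ℝ, ‖critKer T t‖ ≤ C := by
  obtain ⟨C, hC, h⟩ := exists_norm_critXi_le_inv
  have h' : ∀ u, ‖critXi u‖ ≤ C := fun u => (h u).trans
    (mul_le_of_le_one_right hC.le (inv_le_one_of_one_le₀ (by nlinarith [sq_nonneg u])))
  refine ⟨C * C, fun t => ?_⟩
  rw [critKer, norm_mul]
  exact mul_le_mul (h' _) (h' _) (norm_nonneg _) hC.le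

theorem integrable_momentIntegrand (T : ℝ) {v : ℂ} (hv : v.re = 0) :
    Integrable fun t : ℝ => momentIntegrand T v ((t : ℂ) * I) := by
  simp only [momentIntegrand_eq T hv]
  obtain ⟨C, hC⟩ := exists_norm_critKer_bound T
  exact (((integrable_critKer T).comp_add_left v.im).mul_bdd
    (integrable_critKer T).aestronglyMeasurable (ae_of_all _ hC)).const_mul _

theorem momentM_eq (T v : ℝ) : momentM T ((v : ℂ) * I) =
    Real.cosh (Real.pi * T) / 16 * critCorr T v := by
  have h : ∀ t : ℝ, momentIntegrand T ((v : ℂ) * I) (((0 : ℝ) : ℂ) + (t : ℂ) * I) * I =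
      Real.pi / 8 * I * (critKer T (v + t) * critKer T t) := fun t => by
    rw [Complex.ofReal_zero, zero_add, momentIntegrand_eq T (by simp)]
    simp only [Complex.mul_im, Complex.ofReal_re, Complex.I_im, mul_one, Complex.ofReal_im,
      Complex.I_re, mul_zero, add_zero]
    ring
  -- Evenness of the kernel turns a correlation into a convolution after `t ↦ -t`.
  have h2 : ∫ t : ℝ, critKer T (v + t) * critKer T t = critCorr T v := by
    rw [critCorr, ← integral_neg_eq_self]
    refine integral_congr_ae (ae_of_all _ fun t => ?_)
    simp only
    rw [critKer_neg, ← sub_eq_add_neg, mul_comm]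
  have hpi : (Real.pi : ℂ) ≠ 0 := by exact_mod_cast Real.pi_ne_zero
  rw [momentM, lineIntegral, integral_congr_ae (ae_of_all _ h), integral_const_mul, h2]
  field_simp
  ring

/-! ### Mellin transforms against the test function -/

theorem mellinConvergent_mul {ψ : ℝ → ℂ} (hψ : Continuous ψ) (hψc : HasCompactSupport ψ)
    (hψ0 : tsupport ψ ⊆ Ioi (0 : ℝ)) {g : ℝ → ℂ} (hg : ContinuousOn g (Ioi 0)) (s : ℂ) :
    MellinConvergent (fun y => ψ y * g y) s := by
  have h1 : IntegrableOn (fun y : ℝ => (y : ℂ) ^ (s - 1) • (ψ y * g y)) (tsupport ψ) := by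
    refine ContinuousOn.integrableOn_compact hψc.isCompact ?_
    have hc : ContinuousOn (fun y : ℝ => (y : ℂ) ^ (s - 1)) (tsupport ψ) := fun y hy => ?_
    · exact hc.smul (hψ.continuousOn.mul (hg.mono hψ0))
    exact (Complex.continuousAt_ofReal_cpow_const _ _
      (Or.inr (ne_of_gt (hψ0 hy)))).continuousWithinAt
  refine IntegrableOn.of_forall_sdiff_eq_zero h1 measurableSet_Ioi fun y hy => ?_
  simp only [image_eq_zero_of_notMem_tsupport hy.2, zero_mul, smul_zero]

theorem continuous_mellin_line {ψ : ℝ → ℂ} (hψ : Continuous ψ) (hψc : HasCompactSupport ψ)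
    (hψ0 : tsupport ψ ⊆ Ioi (0 : ℝ)) (a : ℂ) :
    Continuous fun t : ℝ => mellin ψ (a - I * t) := by
  have htop : ∀ r : ℝ, ψ =O[atTop] fun t : ℝ => t ^ (-r) := fun r => by
    refine EventuallyEq.trans_isBigO (f₂ := fun _ => (0 : ℂ)) ?_ (isBigO_zero _ _)
    filter_upwards [atTop_le_cocompact hψc.isCompact.compl_mem_cocompact] with y hy
    exact image_eq_zero_of_notMem_tsupport hy
  have hzero : ∀ r : ℝ, ψ =O[nhdsWithin 0 (Ioi 0)] fun t : ℝ => t ^ (-r) := fun r => by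
    refine EventuallyEq.trans_isBigO (f₂ := fun _ => (0 : ℂ)) ?_ (isBigO_zero _ _)
    have h0 : (0 : ℝ) ∉ tsupport ψ := fun h => lt_irrefl (0 : ℝ) (hψ0 h)
    filter_upwards [nhdsWithin_le_nhds ((isClosed_tsupport ψ).isOpen_compl.mem_nhds h0)] with y hy
    exact image_eq_zero_of_notMem_tsupport hy
  have hd : Differentiable ℂ (mellin ψ) := fun s =>
    mellin_differentiableAt_of_isBigO_rpow (a := s.re + 1) (b := s.re - 1)
      (hψ.locallyIntegrable.locallyIntegrableOn _) (htop _) (by linarith) (hzero _) (by linarith)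
  exact hd.continuous.comp (by fun_prop)

/-- Fubini's theorem for a test function against a Fourier integral in the logarithm. -/
theorem mellin_mul_fourier {ψ : ℝ → ℂ} (hψ : Continuous ψ) (hψc : HasCompactSupport ψ)
    (hψ0 : tsupport ψ ⊆ Ioi (0 : ℝ)) {g : ℝ → ℂ} (hg : Integrable g) (s : ℂ) :
    mellin (fun y => ψ y * ∫ t : ℝ, g t * Complex.exp (-(I * t * Real.log y))) s =
      ∫ t : ℝ, g t * mellin ψ (s - I * t) := by
  have hψs : IntegrableOn (fun y : ℝ => (y : ℂ) ^ (s - 1) * ψ y) (Ioi 0) := by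
    simpa [MellinConvergent] using mellinConvergent_mul hψ hψc hψ0 (g := fun _ => 1)
      continuousOn_const s
  have hprod : Integrable (Function.uncurry fun y t : ℝ => (y : ℂ) ^ (s - 1) * ψ y * g t *
      Complex.exp (-(I * t * Real.log y))) ((volume.restrict (Ioi 0)).prod volume) := by
    refine (hψs.mul_prod hg).mul_bdd (c := 1) ?_ (ae_of_all _ fun p => ?_)
    · exact Measurable.aestronglyMeasurable (by fun_prop)
    · rw [Complex.norm_exp]
      simp
  have h1 : mellin (fun y => ψ y * ∫ t : ℝ, g t * Complex.exp (-(I * t * Real.log y))) s =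
      ∫ y in Ioi (0 : ℝ), ∫ t : ℝ, (y : ℂ) ^ (s - 1) * ψ y * g t *
        Complex.exp (-(I * t * Real.log y)) := by
    rw [mellin]
    refine integral_congr_ae (ae_of_all _ fun y => ?_)
    simp only
    rw [smul_eq_mul, ← mul_assoc, ← integral_const_mul]
    simp only [mul_assoc]
  rw [h1, integral_integral_swap hprod]
  refine integral_congr_ae (ae_of_all _ fun t => ?_)
  simp only
  rw [mellin, ← integral_const_mul]
  refine setIntegral_congr_fun measurableSet_Ioi fun y hy => ?_
  have hy' : (0 : ℝ) < y := hy
  have hy0 : (y : ℂ) ≠ 0 := by exact_mod_cast hy'.ne'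
  rw [show s - I * t - 1 = (s - 1) + -(I * t) by ring, Complex.cpow_add _ _ hy0,
    Complex.cpow_def_of_ne_zero hy0 (-(I * t)), ← Complex.ofReal_log hy'.le, smul_eq_mul,
    show (Real.log y : ℂ) * -(I * t) = -(I * t * Real.log y) by ring]
  ring

end GeodesicEisenstein

/-! ### The exact formula for the geodesic integral -/

namespace GeodesicEisenstein

theorem conj_ofReal_cpow {y : ℝ} (hy : 0 < y) (a : ℂ) :
    (starRingEnd ℂ) ((y : ℂ) ^ a) = (y : ℂ) ^ ((starRingEnd ℂ) a) := by
  have h : (y : ℂ).arg ≠ Real.pi := by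
    rw [Complex.arg_ofReal_of_nonneg hy.le]
    exact Real.pi_pos.ne
  have hc := Complex.cpow_conj (y : ℂ) a h
  rw [Complex.conj_ofReal] at hc
  exact hc.symm

theorem norm_theta_ne_zero (T : ℝ) : (‖theta (1 / 2 + I * T)‖ : ℂ) ≠ 0 := by
  exact_mod_cast norm_ne_zero_iff.mpr (theta_ne_zero T)

theorem theta_eq_muT (T : ℝ) : theta (1 / 2 + I * T) = muT T * ‖theta (1 / 2 + I * T)‖ := by
  rw [muT, div_mul_cancel₀ _ (norm_theta_ne_zero T)]

theorem norm_muT (T : ℝ) : ‖muT T‖ = 1 := by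
  rw [muT, norm_div, Complex.norm_real, norm_norm,
    div_self (norm_ne_zero_iff.mpr (theta_ne_zero T))]

theorem muT_mul_conj (T : ℝ) : muT T * (starRingEnd ℂ) (muT T) = 1 := by
  rw [Complex.mul_conj', norm_muT]
  simp

/-- The constant term of the Eisenstein series at `iy` together with its reflection, normalized. -/
noncomputable def geoD (T y : ℝ) : ℂ :=
  muT T * ((y : ℂ) ^ (1 / 2 + I * T) + (y : ℂ) ^ (-(1 / 2) - I * T)) +
    (starRingEnd ℂ) (muT T) * ((y : ℂ) ^ (1 / 2 - I * T) + (y : ℂ) ^ (-(1 / 2) + I * T))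

theorem conj_geoD {y : ℝ} (hy : 0 < y) (T : ℝ) : (starRingEnd ℂ) (geoD T y) = geoD T y := by
  have e : ∀ a b : ℝ, (starRingEnd ℂ) ((y : ℂ) ^ (a + I * b : ℂ)) = (y : ℂ) ^ (a - I * b : ℂ) :=
    fun a b => by
      rw [conj_ofReal_cpow hy]
      congr 1
      apply Complex.ext <;> simp
  have e1 := e (1 / 2) T
  have e2 := e (1 / 2) (-T)
  have e3 := e (-(1 / 2)) T
  have e4 := e (-(1 / 2)) (-T)
  push_cast at e1 e2 e3 e4
  simp only [mul_neg, sub_neg_eq_add, ← sub_eq_add_neg] at e1 e2 e3 e4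
  rw [geoD]
  simp only [map_add, map_mul, Complex.conj_conj, e1, e2, e3, e4]
  ring

/-- Dividing `θE` by `|θ|` gives `μE`, a sum of two real functions, so the squared modulus is an
ordinary square and no conjugates appear when it is expanded. -/
theorem norm_sq_eisensteinE {y : ℝ} (hy : 0 < y) {T : ℝ} (hT : T ≠ 0) :
    ((‖eisensteinE (UpperHalfPlane.ofComplex ((y : ℂ) * I)) (1 / 2 + I * T)‖ ^ 2 : ℝ) : ℂ) =
      ((‖theta (1 / 2 + I * T)‖ : ℂ)⁻¹ * geoP T y + geoD T y) ^ 2 := by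
  set E := eisensteinE (UpperHalfPlane.ofComplex ((y : ℂ) * I)) (1 / 2 + I * T) with hE
  set N : ℂ := (‖theta (1 / 2 + I * T)‖ : ℂ) with hN
  have hN0 : N ≠ 0 := norm_theta_ne_zero T
  have h := theta_mul_eisensteinE hy hT
  rw [eisPair_Λ_half hy hT, ← hE] at h
  have hθ : theta (1 / 2 + I * T) = muT T * N := theta_eq_muT T
  have hθc : (starRingEnd ℂ) (theta (1 / 2 + I * T)) = (starRingEnd ℂ) (muT T) * N := by
    rw [hθ, map_mul, hN, Complex.conj_ofReal]
  have h1 : muT T * E = N⁻¹ * geoP T y + geoD T y := by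
    rw [hθ] at h
    rw [← hθ, hθc, hθ, show -(1 / 2 + I * T) = -(1 / 2) - I * T by ring,
      show 1 - (1 / 2 + I * T) = 1 / 2 - I * T by ring,
      show (1 / 2 + I * T - 1 : ℂ) = -(1 / 2) + I * T by ring] at h
    refine mul_left_cancel₀ hN0 ?_
    rw [mul_add, mul_inv_cancel_left₀ hN0, geoD]
    linear_combination h
  have hnorm : ‖E‖ = ‖N⁻¹ * geoP T y + geoD T y‖ := by rw [← h1, norm_mul, norm_muT, one_mul]
  rw [hnorm, Complex.ofReal_pow, ← Complex.mul_conj', map_add, map_mul, conj_geoD hy, conj_geoP hy,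
    map_inv₀, hN, Complex.conj_ofReal, sq]

/-- Products in which the powers `y^{±iT}` cancel form the integrand of `b(T)`; the others carry
`y^{±2iT}`. -/
theorem geoD_sq {y : ℝ} (hy : 0 < y) (T : ℝ) : geoD T y ^ 2 =
    2 * ((y : ℂ) + (y : ℂ)⁻¹ + muT T ^ 2 + (starRingEnd ℂ) (muT T) ^ 2) +
      (muT T ^ 2 * ((y : ℂ) ^ (1 + I * (2 * T : ℝ)) + (y : ℂ) ^ (-1 + I * (-(2 * T) : ℝ))) +
        (starRingEnd ℂ) (muT T) ^ 2 *
          ((y : ℂ) ^ (1 + I * (-(2 * T) : ℝ)) + (y : ℂ) ^ (-1 + I * (2 * T : ℝ))) +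
        2 * ((y : ℂ) ^ (0 + I * (2 * T : ℝ)) + (y : ℂ) ^ (0 + I * (-(2 * T) : ℝ)))) := by
  have hy0 : (y : ℂ) ≠ 0 := by exact_mod_cast hy.ne'
  have hm := muT_mul_conj T
  have hadd : ∀ a b c : ℂ, a + b = c → (y : ℂ) ^ c = (y : ℂ) ^ a * (y : ℂ) ^ b := fun a b c h => by
    rw [← h, Complex.cpow_add _ _ hy0]
  rw [geoD]
  set p := (y : ℂ) ^ (1 / 2 + I * T)
  set p' := (y : ℂ) ^ (-(1 / 2) - I * T)
  set q := (y : ℂ) ^ (1 / 2 - I * T)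
  set q' := (y : ℂ) ^ (-(1 / 2) + I * T)
  have h1 : (y : ℂ) ^ (1 + I * (2 * T : ℝ)) = p * p := hadd _ _ _ (by push_cast; ring)
  have h2 : (y : ℂ) ^ (-1 + I * (-(2 * T) : ℝ)) = p' * p' := hadd _ _ _ (by push_cast; ring)
  have h3 : (y : ℂ) ^ (1 + I * (-(2 * T) : ℝ)) = q * q := hadd _ _ _ (by push_cast; ring)
  have h4 : (y : ℂ) ^ (-1 + I * (2 * T : ℝ)) = q' * q' := hadd _ _ _ (by push_cast; ring)
  have h5 : (y : ℂ) ^ (0 + I * (2 * T : ℝ)) = p * q' := hadd _ _ _ (by push_cast; ring)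
  have h6 : (y : ℂ) ^ (0 + I * (-(2 * T) : ℝ)) = p' * q := hadd _ _ _ (by push_cast; ring)
  have h7 : (1 : ℂ) = p * p' := by rw [← hadd _ _ 0 (by ring), Complex.cpow_zero]
  have h8 : (1 : ℂ) = q * q' := by rw [← hadd _ _ 0 (by ring), Complex.cpow_zero]
  have h9 : (y : ℂ) = p * q := by rw [← hadd _ _ 1 (by ring), Complex.cpow_one]
  have h10 : (y : ℂ)⁻¹ = p' * q' := by rw [← hadd _ _ (-1) (by ring), Complex.cpow_neg_one]
  rw [h1, h2, h3, h4, h5, h6, h10, h9]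
  set m := muT T
  set m' := (starRingEnd ℂ) (muT T)
  linear_combination (-2 * m ^ 2) * h7 + (-2 * m' ^ 2) * h8 +
    2 * (p * q + p * q' + p' * q + p' * q') * hm

/-- The integral of the test function against the cross term. -/
noncomputable def crossTerm (ψ : ℝ → ℂ) (T : ℝ) (a : ℂ) : ℂ :=
  1 / (2 * Real.pi) * ∫ t : ℝ, critKer T t * mellin ψ (a - I * t)

variable {ψ : ℝ → ℂ}

theorem continuousOn_ofReal_cpow (a : ℂ) : ContinuousOn (fun y : ℝ => (y : ℂ) ^ a) (Ioi 0) :=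
  fun _ hy => (Complex.continuousAt_ofReal_cpow_const _ _ (Or.inr (ne_of_gt hy))).continuousWithinAt

theorem hasMellin_mul_cpow (hψ : Continuous ψ) (hψc : HasCompactSupport ψ)
    (hψ0 : tsupport ψ ⊆ Ioi (0 : ℝ)) (a : ℂ) :
    HasMellin (fun y => ψ y * (y : ℂ) ^ a) 0 (mellin ψ a) := by
  refine ⟨mellinConvergent_mul hψ hψc hψ0 (continuousOn_ofReal_cpow a) 0, ?_⟩
  have := mellin_cpow_smul ψ 0 a
  rw [zero_add] at this
  rw [← this]
  simp only [smul_eq_mul, mul_comm]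

theorem mellin_cross (hψ : Continuous ψ) (hψc : HasCompactSupport ψ)
    (hψ0 : tsupport ψ ⊆ Ioi (0 : ℝ)) (T : ℝ) (a : ℂ) :
    HasMellin (fun y => ψ y * (geoP T y * (y : ℂ) ^ a)) 0 (crossTerm ψ T a) := by
  refine ⟨mellinConvergent_mul hψ hψc hψ0
    ((continuousOn_geoP T).mul (continuousOn_ofReal_cpow a)) 0, ?_⟩
  have h := mellin_cpow_smul (fun y => ψ y *
    ∫ t : ℝ, critKer T t * Complex.exp (-(I * t * Real.log y))) 0 a
  rw [zero_add, mellin_mul_fourier hψ hψc hψ0 (integrable_critKer T)] at h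
  rw [crossTerm, ← h, ← smul_eq_mul, ← mellin_const_smul, mellin, mellin]
  refine setIntegral_congr_fun measurableSet_Ioi fun y hy => ?_
  simp only [smul_eq_mul]
  rw [geoP_eq hy]
  ring

theorem mellin_main (hψ : Continuous ψ) (hψc : HasCompactSupport ψ)
    (hψ0 : tsupport ψ ⊆ Ioi (0 : ℝ)) (T : ℝ) :
    HasMellin (fun y => ψ y * geoP T y ^ 2) 0
      (1 / (4 * Real.pi ^ 2) * ∫ v : ℝ, critCorr T v * mellin ψ (0 - I * v)) := by
  refine ⟨mellinConvergent_mul hψ hψc hψ0 ((continuousOn_geoP T).pow 2) 0, ?_⟩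
  rw [← mellin_mul_fourier hψ hψc hψ0 (integrable_critCorr T), ← smul_eq_mul, ← mellin_const_smul,
    mellin, mellin]
  refine setIntegral_congr_fun measurableSet_Ioi fun y hy => ?_
  simp only [smul_eq_mul]
  rw [geoP_sq hy]
  ring

/-- Bookkeeping of constants: the hyperbolic cosines cancel, and `4 · (2/π) · 1/(2πi) · i/16 =
1/(4π²)`. -/
theorem mainTerm_eq (ψ : ℝ → ℂ) (T : ℝ) :
    4 * ((rhoStar T ^ 2 / Real.cosh (Real.pi * T) : ℝ) : ℂ) * (1 / (2 * (Real.pi : ℂ) * I)) *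
        lineIntegral 0 (fun v : ℂ => mellin ψ (-v) * momentM T v) =
      (‖theta (1 / 2 + I * T)‖ : ℂ)⁻¹ ^ 2 *
        (1 / (4 * Real.pi ^ 2) * ∫ v : ℝ, critCorr T v * mellin ψ (0 - I * v)) := by
  have h : ∀ v : ℝ, mellin ψ (-(((0 : ℝ) : ℂ) + (v : ℂ) * I)) *
      momentM T (((0 : ℝ) : ℂ) + (v : ℂ) * I) * I =
      Real.cosh (Real.pi * T) / 16 * I * (critCorr T v * mellin ψ (0 - I * v)) := fun v => by
    rw [Complex.ofReal_zero, zero_add, momentM_eq, show -((v : ℂ) * I) = 0 - I * v by ring]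
    ring
  have hpi : (Real.pi : ℂ) ≠ 0 := by exact_mod_cast Real.pi_ne_zero
  have hcosh : (Real.cosh (Real.pi * T) : ℂ) ≠ 0 := by exact_mod_cast (Real.cosh_pos _).ne'
  have hN := norm_theta_ne_zero T
  rw [lineIntegral, integral_congr_ae (ae_of_all _ h), integral_const_mul, rhoStar, mul_pow,
    Real.sq_sqrt (by positivity)]
  rw [Complex.ofReal_div, Complex.ofReal_mul, Complex.ofReal_div, Complex.ofReal_pow,
    Complex.ofReal_inv]
  generalize (Real.cosh (Real.pi * T) : ℂ) = c at *
  generalize ∫ v : ℝ, critCorr T v * mellin ψ (0 - I * v) = J at *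
  have hI := Complex.I_ne_zero
  field_simp
  push_cast
  ring

end GeodesicEisenstein

namespace GeodesicEisenstein

/-! ### The error terms -/

/-- The contribution of the products of the constant term with the oscillating part. -/
noncomputable def crossError (ψ : ℝ → ℂ) (T : ℝ) : ℂ :=
  2 * (‖theta (1 / 2 + I * T)‖ : ℂ)⁻¹ *
    (muT T * (crossTerm ψ T (1 / 2 + I * T) + crossTerm ψ T (-(1 / 2) - I * T)) +
      (starRingEnd ℂ) (muT T) *
        (crossTerm ψ T (1 / 2 - I * T) + crossTerm ψ T (-(1 / 2) + I * T)))

/-- The contribution of the oscillating part of the square of the constant term. -/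
noncomputable def diagError (ψ : ℝ → ℂ) (T : ℝ) : ℂ :=
  muT T ^ 2 * (mellin ψ (1 + I * (2 * T : ℝ)) + mellin ψ (-1 + I * (-(2 * T) : ℝ))) +
    (starRingEnd ℂ) (muT T) ^ 2 *
      (mellin ψ (1 + I * (-(2 * T) : ℝ)) + mellin ψ (-1 + I * (2 * T : ℝ))) +
    2 * (mellin ψ (0 + I * (2 * T : ℝ)) + mellin ψ (0 + I * (-(2 * T) : ℝ)))

variable {ψ : ℝ → ℂ}

theorem hasMellin_bTerm (hψ : Continuous ψ) (hψc : HasCompactSupport ψ)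
    (hψ0 : tsupport ψ ⊆ Ioi (0 : ℝ)) (T : ℝ) :
    HasMellin (fun y => ψ y *
      (2 * ((y : ℂ) + (y : ℂ)⁻¹ + muT T ^ 2 + (starRingEnd ℂ) (muT T) ^ 2))) 0 (bTerm ψ T) := by
  have hc : ContinuousOn (fun y : ℝ => (2 : ℂ) * ((y : ℂ) + (y : ℂ)⁻¹ + muT T ^ 2 +
      (starRingEnd ℂ) (muT T) ^ 2)) (Ioi 0) := by
    have h1 : ContinuousOn (fun y : ℝ => (y : ℂ)) (Ioi 0) := Complex.continuous_ofReal.continuousOn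
    have h2 : ContinuousOn (fun y : ℝ => (y : ℂ)⁻¹) (Ioi 0) :=
      h1.inv₀ fun y hy => by exact_mod_cast (ne_of_gt hy : y ≠ 0)
    exact continuousOn_const.mul (((h1.add h2).add continuousOn_const).add continuousOn_const)
  refine ⟨mellinConvergent_mul hψ hψc hψ0 hc 0, ?_⟩
  rw [bTerm, mellin, ← integral_const_mul]
  refine integral_congr_ae (ae_of_all _ fun y => ?_)
  simp only
  rw [zero_sub, Complex.cpow_neg_one, smul_eq_mul, div_eq_mul_inv]
  ring

/-- At `s = 0` the Mellin weight is `dy/y`. Each piece of the expanded square is continuous on `(0,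
∞)`, so it is integrable against `ψ` and the transforms add. -/
theorem hasMellin_norm_sq_eisensteinE (hψ : Continuous ψ) (hψc : HasCompactSupport ψ)
    (hψ0 : tsupport ψ ⊆ Ioi (0 : ℝ)) {T : ℝ} (hT : T ≠ 0) :
    HasMellin (fun y => ψ y * ((‖eisensteinE (UpperHalfPlane.ofComplex ((y : ℂ) * I))
      (1 / 2 + I * (T : ℂ))‖ ^ 2 : ℝ) : ℂ)) 0
      ((‖theta (1 / 2 + I * T)‖ : ℂ)⁻¹ ^ 2 *
        (1 / (4 * Real.pi ^ 2) * ∫ v : ℝ, critCorr T v * mellin ψ (0 - I * v)) +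
        bTerm ψ T + crossError ψ T + diagError ψ T) := by
  have hP := mellin_main hψ hψc hψ0 T
  have hB := hasMellin_bTerm hψ hψc hψ0 T
  have hX := mellin_cross hψ hψc hψ0 T
  have hY := hasMellin_mul_cpow hψ hψc hψ0
  have hcross := HasMellin.const_mul (HasMellin.add
    (HasMellin.const_mul (HasMellin.add (hX (1 / 2 + I * T)) (hX (-(1 / 2) - I * T))) (muT T))
    (HasMellin.const_mul (HasMellin.add (hX (1 / 2 - I * T)) (hX (-(1 / 2) + I * T)))
      ((starRingEnd ℂ) (muT T)))) (2 * (‖theta (1 / 2 + I * T)‖ : ℂ)⁻¹)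
  have hdiag := HasMellin.add (HasMellin.add
    (HasMellin.const_mul (HasMellin.add (hY (1 + I * (2 * T : ℝ)))
      (hY (-1 + I * (-(2 * T) : ℝ)))) (muT T ^ 2))
    (HasMellin.const_mul (HasMellin.add (hY (1 + I * (-(2 * T) : ℝ)))
      (hY (-1 + I * (2 * T : ℝ)))) ((starRingEnd ℂ) (muT T) ^ 2)))
    (HasMellin.const_mul (HasMellin.add (hY (0 + I * (2 * T : ℝ)))
      (hY (0 + I * (-(2 * T) : ℝ)))) 2)
  refine HasMellin.congr_ae (HasMellin.add (HasMellin.add (HasMellin.add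
    (HasMellin.const_mul hP ((‖theta (1 / 2 + I * T)‖ : ℂ)⁻¹ ^ 2)) hB) hcross) hdiag) fun y hy _ => ?_
  rw [norm_sq_eisensteinE hy hT, add_sq, geoD_sq hy, geoD]
  ring

theorem geodesicIntegrand_eq (ψ : ℝ → ℂ) (T : ℝ) : geodesicIntegrand ψ T = fun y : ℝ =>
    (y : ℂ) ^ (0 - 1 : ℂ) • (ψ y * ((‖eisensteinE (UpperHalfPlane.ofComplex ((y : ℂ) * I))
      (1 / 2 + I * (T : ℂ))‖ ^ 2 : ℝ) : ℂ)) := by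
  funext y
  rw [geodesicIntegrand, zero_sub, Complex.cpow_neg_one, smul_eq_mul, div_eq_inv_mul]

/-- The exact formula for the geodesic integral: the main term, the term `b(T)`, and two errors. -/
theorem geodesicIntegral_sub_eq (hψ : Continuous ψ) (hψc : HasCompactSupport ψ)
    (hψ0 : tsupport ψ ⊆ Ioi (0 : ℝ)) {T : ℝ} (hT : T ≠ 0) :
    geodesicIntegral ψ T -
      (4 * ((rhoStar T ^ 2 / Real.cosh (Real.pi * T) : ℝ) : ℂ) * (1 / (2 * (Real.pi : ℂ) * I)) *
        lineIntegral 0 (fun v : ℂ => mellin ψ (-v) * momentM T v) + bTerm ψ T) =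
      crossError ψ T + diagError ψ T := by
  have h := (hasMellin_norm_sq_eisensteinE hψ hψc hψ0 hT).2
  rw [mellin, ← geodesicIntegrand_eq] at h
  rw [geodesicIntegral, h, mainTerm_eq]
  ring

/-- The supremum of the kernel times the `L¹` norm of the Mellin transform on a vertical line. That
norm is translation invariant, hence the uniformity in `τ`. -/
theorem exists_norm_crossTerm_le (hψ : ContDiff ℝ ∞ ψ) (hψc : HasCompactSupport ψ)
    (hψ0 : tsupport ψ ⊆ Ioi (0 : ℝ)) {a : ℝ} (ha0 : 0 ≤ a) (ha : a < 1 / 12) (σ : ℝ) :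
    ∃ C : ℝ, 0 < C ∧ ∀ T : ℝ, 1 ≤ T → ∀ τ : ℝ,
      ‖crossTerm ψ T (σ + I * τ)‖ ≤ C * T ^ (-a) * Real.exp (-(Real.pi * T / 2)) := by
  obtain ⟨C, hC, hK⟩ := exists_norm_critKer_le ha0 ha
  obtain ⟨D, hD, hM⟩ := exists_norm_mellin_le hψ hψc hψ0 σ
  refine ⟨C * D, by positivity, fun T hT τ => ?_⟩
  set B := C * T ^ (-a) * Real.exp (-(Real.pi * T / 2)) with hB
  have hB0 : 0 ≤ B := by positivity
  have hbound : ∀ t : ℝ, ‖critKer T t * mellin ψ (σ + I * τ - I * t)‖ ≤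
      B * D * (1 + (τ - t) ^ 2)⁻¹ := fun t => by
    have h1 := hM (τ - t)
    rw [show (σ + I * ((τ - t : ℝ) : ℂ) : ℂ) = σ + I * τ - I * t by push_cast; ring] at h1
    have h2 : ((1 + (τ - t) ^ 2) ^ 2)⁻¹ ≤ (1 + (τ - t) ^ 2)⁻¹ := by
      gcongr
      nlinarith [sq_nonneg (τ - t)]
    rw [norm_mul, mul_assoc B]
    exact mul_le_mul (hK T hT t) (h1.trans (by gcongr)) (norm_nonneg _) hB0
  have hint : Integrable fun t : ℝ => B * D * (1 + (τ - t) ^ 2)⁻¹ :=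
    (integrable_inv_one_add_sq.comp_sub_left τ).const_mul _
  have hle := norm_integral_le_of_norm_le hint (ae_of_all _ hbound)
  rw [integral_const_mul, integral_sub_left_eq_self (fun x : ℝ => (1 + x ^ 2)⁻¹),
    integral_univ_inv_one_add_sq] at hle
  have hn : ‖(1 / (2 * Real.pi) : ℂ)‖ = 1 / (2 * Real.pi) := by
    rw [norm_div, norm_mul, Complex.norm_real, Real.norm_of_nonneg Real.pi_pos.le]
    simp
  rw [crossTerm, norm_mul, hn]
  calc _ ≤ 1 / (2 * Real.pi) * (B * D * Real.pi) := by gcongr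
    _ = B * D / 2 := by
      have := Real.pi_ne_zero
      field_simp
    _ ≤ B * D := by
      have := mul_nonneg hB0 hD.le
      linarith
    _ = _ := by
      rw [hB]
      ring

theorem exists_norm_crossError_le (hψ : ContDiff ℝ ∞ ψ) (hψc : HasCompactSupport ψ)
    (hψ0 : tsupport ψ ⊆ Ioi (0 : ℝ)) {ε : ℝ} (hε : 0 < ε) :
    ∃ C : ℝ, ∀ T : ℝ, 1 ≤ T → ‖crossError ψ T‖ ≤ C * T ^ (-(1 / 12 : ℝ) + ε) := by
  -- Half of `ε` is spent on the kernel and half on `1/|θ|`; the maximum with `0` covers large `ε`,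
  -- since the kernel bound needs `a ≥ 0`.
  set a : ℝ := max 0 (1 / 12 - ε / 2) with ha
  have ha0 : 0 ≤ a := le_max_left _ _
  have ha1 : a < 1 / 12 := max_lt (by norm_num) (by linarith)
  have ha2 : 1 / 12 - ε / 2 ≤ a := le_max_right _ _
  obtain ⟨C₁, hC₁, h1⟩ := exists_norm_crossTerm_le hψ hψc hψ0 ha0 ha1 (1 / 2)
  obtain ⟨C₂, hC₂, h2⟩ := exists_norm_crossTerm_le hψ hψc hψ0 ha0 ha1 (-(1 / 2))
  obtain ⟨C₃, hC₃, h3⟩ := exists_inv_norm_theta_le (half_pos hε)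
  refine ⟨4 * C₃ * (C₁ + C₂), fun T hT => ?_⟩
  have hT0 : 0 < T := by linarith
  have e1 := h1 T hT T
  have e2 := h2 T hT (-T)
  have e3 := h1 T hT (-T)
  have e4 := h2 T hT T
  have e5 := h3 T hT
  push_cast at e1 e2 e3 e4
  rw [mul_neg, ← sub_eq_add_neg] at e2 e3
  set X := T ^ (-a) * Real.exp (-(Real.pi * T / 2)) with hX
  have hX0 : 0 ≤ X := by positivity
  rw [mul_assoc, ← hX] at e1 e2 e3 e4
  have hsum : ‖muT T * (crossTerm ψ T (1 / 2 + I * T) + crossTerm ψ T (-(1 / 2) - I * T)) +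
      (starRingEnd ℂ) (muT T) *
        (crossTerm ψ T (1 / 2 - I * T) + crossTerm ψ T (-(1 / 2) + I * T))‖ ≤
      2 * (C₁ + C₂) * X := by
    refine (norm_add_le _ _).trans ?_
    rw [norm_mul, norm_mul, RCLike.norm_conj, norm_muT, one_mul, one_mul]
    refine (add_le_add (norm_add_le _ _) (norm_add_le _ _)).trans ?_
    linarith
  -- The growth of `1/|θ|` cancels the exponential decay of the kernel exactly.
  have hXe : (T ^ (ε / 2) * Real.exp (Real.pi * T / 2)) * X ≤ T ^ (-(1 / 12 : ℝ) + ε) := by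
    have h : (T ^ (ε / 2) * Real.exp (Real.pi * T / 2)) * X = T ^ (ε / 2 + -a) *
        (Real.exp (Real.pi * T / 2) * Real.exp (-(Real.pi * T / 2))) := by
      rw [hX, Real.rpow_add hT0]
      ring
    rw [h, ← Real.exp_add, add_neg_cancel, Real.exp_zero, mul_one]
    exact Real.rpow_le_rpow_of_exponent_le hT (by linarith)
  rw [crossError, norm_mul, norm_mul, norm_inv, Complex.norm_real, norm_norm, Complex.norm_ofNat]
  calc _ ≤ 2 * (C₃ * T ^ (ε / 2) * Real.exp (Real.pi * T / 2)) * (2 * (C₁ + C₂) * X) := by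
        gcongr
    _ = 4 * C₃ * (C₁ + C₂) * ((T ^ (ε / 2) * Real.exp (Real.pi * T / 2)) * X) := by ring
    _ ≤ _ := by gcongr

/-- Every Mellin transform here is evaluated at height `±2T`, where it decays like `T^{-4}`; the
exponent `-1` is enough. -/
theorem exists_norm_diagError_le (hψ : ContDiff ℝ ∞ ψ) (hψc : HasCompactSupport ψ)
    (hψ0 : tsupport ψ ⊆ Ioi (0 : ℝ)) :
    ∃ C : ℝ, 0 ≤ C ∧ ∀ T : ℝ, 1 ≤ T → ‖diagError ψ T‖ ≤ C * T ^ (-1 : ℝ) := by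
  obtain ⟨C₁, hC₁, h1⟩ := exists_norm_mellin_le hψ hψc hψ0 1
  obtain ⟨C₂, hC₂, h2⟩ := exists_norm_mellin_le hψ hψc hψ0 (-1)
  obtain ⟨C₃, hC₃, h3⟩ := exists_norm_mellin_le hψ hψc hψ0 0
  refine ⟨2 * C₁ + 2 * C₂ + 4 * C₃, by positivity, fun T hT => ?_⟩
  have hdec : ∀ r : ℝ, r ^ 2 = (2 * T) ^ 2 → ((1 + r ^ 2) ^ 2)⁻¹ ≤ T ^ (-1 : ℝ) := fun r hr => by
    rw [Real.rpow_neg_one, hr]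
    gcongr
    nlinarith [sq_nonneg (T ^ 2)]
  have hb : ∀ (z : ℂ) (C : ℝ), 0 < C → ∀ r : ℝ, r ^ 2 = (2 * T) ^ 2 →
      ‖z‖ ≤ C * ((1 + r ^ 2) ^ 2)⁻¹ → ‖z‖ ≤ C * T ^ (-1 : ℝ) := fun z C hC r hr h =>
    h.trans (by gcongr; exact hdec r hr)
  have e1 := hb _ _ hC₁ _ rfl (h1 (2 * T))
  have e1' := hb _ _ hC₁ _ (neg_sq _) (h1 (-(2 * T)))
  have e2 := hb _ _ hC₂ _ rfl (h2 (2 * T))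
  have e2' := hb _ _ hC₂ _ (neg_sq _) (h2 (-(2 * T)))
  have e3 := hb _ _ hC₃ _ rfl (h3 (2 * T))
  have e3' := hb _ _ hC₃ _ (neg_sq _) (h3 (-(2 * T)))
  rw [Complex.ofReal_one] at e1 e1'
  rw [Complex.ofReal_neg 1, Complex.ofReal_one] at e2 e2'
  rw [Complex.ofReal_zero] at e3 e3'
  rw [diagError]
  refine (norm_add_le _ _).trans ((add_le_add (norm_add_le _ _) le_rfl).trans ?_)
  rw [norm_mul, norm_mul, norm_mul, norm_pow, norm_pow, RCLike.norm_conj, norm_muT, one_pow, one_mul,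
    one_mul, Complex.norm_ofNat]
  have n1 := norm_add_le (mellin ψ (1 + I * (2 * T : ℝ))) (mellin ψ (-1 + I * (-(2 * T) : ℝ)))
  have n2 := norm_add_le (mellin ψ (1 + I * (-(2 * T) : ℝ))) (mellin ψ (-1 + I * (2 * T : ℝ)))
  have n3 := norm_add_le (mellin ψ (0 + I * (2 * T : ℝ))) (mellin ψ (0 + I * (-(2 * T) : ℝ)))
  linarith

theorem integrable_mellin_mul_momentM (hψ : ContDiff ℝ ∞ ψ) (hψc : HasCompactSupport ψ)
    (hψ0 : tsupport ψ ⊆ Ioi (0 : ℝ)) (T : ℝ) :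
    Integrable fun t : ℝ => mellin ψ (-((t : ℂ) * I)) * momentM T ((t : ℂ) * I) := by
  obtain ⟨D, hD, h⟩ := exists_norm_mellin_le hψ hψc hψ0 0
  have hcont := continuous_mellin_line hψ.continuous hψc hψ0 0
  have hbound : ∀ t : ℝ, ‖mellin ψ (0 - I * t)‖ ≤ D := fun t => by
    have h1 := h (-t)
    rw [show ((0 : ℝ) : ℂ) + I * ((-t : ℝ) : ℂ) = 0 - I * t by push_cast; ring] at h1
    refine h1.trans (mul_le_of_le_one_right hD.le (inv_le_one_of_one_le₀ ?_))
    nlinarith [sq_nonneg (-t)]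
  refine (((integrable_critCorr T).const_mul (Real.cosh (Real.pi * T) / 16 : ℂ)).bdd_mul
    hcont.aestronglyMeasurable (ae_of_all _ hbound)).congr (ae_of_all _ fun t => ?_)
  simp only
  rw [momentM_eq, show -((t : ℂ) * I) = 0 - I * t by ring]

end GeodesicEisenstein

/-! ### Absolute convergence and the asymptotic formula -/

theorem mainTheorem8 (ψ : ℝ → ℂ) (hψ : ContDiff ℝ ∞ ψ) (hψc : HasCompactSupport ψ)
    (hψ0 : tsupport ψ ⊆ Set.Ioi (0 : ℝ)) :
    (∀ T : ℝ, 0 < T →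
      MeasureTheory.IntegrableOn (GeodesicEisenstein.geodesicIntegrand ψ T) (Set.Ioi (0 : ℝ)) ∧
      (∀ v : ℂ, v.re = 0 → MeasureTheory.Integrable
        (fun t : ℝ => GeodesicEisenstein.momentIntegrand T v ((t : ℂ) * Complex.I))) ∧
      MeasureTheory.Integrable (fun t : ℝ =>
        mellin ψ (-((t : ℂ) * Complex.I)) *
          GeodesicEisenstein.momentM T ((t : ℂ) * Complex.I))) ∧
    ∀ ε : ℝ, 0 < ε →
      (fun T : ℝ =>
        GeodesicEisenstein.geodesicIntegral ψ T -
          (4 * ((GeodesicEisenstein.rhoStar T ^ 2 / Real.cosh (Real.pi * T) : ℝ) : ℂ) *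
              (1 / (2 * (Real.pi : ℂ) * Complex.I)) *
              GeodesicEisenstein.lineIntegral 0
                (fun v : ℂ => mellin ψ (-v) * GeodesicEisenstein.momentM T v) +
            GeodesicEisenstein.bTerm ψ T))
        =O[Filter.atTop] fun T : ℝ => T ^ (-(1 / 12 : ℝ) + ε) := by
  refine ⟨fun T hT => ⟨?_, fun v hv => GeodesicEisenstein.integrable_momentIntegrand T hv,
    GeodesicEisenstein.integrable_mellin_mul_momentM hψ hψc hψ0 T⟩, fun ε hε => ?_⟩
  · rw [GeodesicEisenstein.geodesicIntegrand_eq]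
    exact (GeodesicEisenstein.hasMellin_norm_sq_eisensteinE hψ.continuous hψc hψ0 hT.ne').1
  · obtain ⟨C₁, h₁⟩ := GeodesicEisenstein.exists_norm_crossError_le hψ hψc hψ0 hε
    obtain ⟨C₂, hC₂, h₂⟩ := GeodesicEisenstein.exists_norm_diagError_le hψ hψc hψ0
    refine Asymptotics.IsBigO.of_bound (C₁ + C₂) ?_
    filter_upwards [Filter.eventually_ge_atTop 1] with T hT
    rw [GeodesicEisenstein.geodesicIntegral_sub_eq hψ.continuous hψc hψ0 (by linarith : T ≠ 0),
      Real.norm_of_nonneg (by positivity), add_mul]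
    refine (norm_add_le _ _).trans (add_le_add (h₁ T hT) ((h₂ T hT).trans ?_))
    gcongr
    linarith
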